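/- **Setting.** Let $\gamma\ge 3$ be an odd integer, $Q_h=[-\pi\gamma^h,\pi\gamma^h]^2$, and $-\hat\Delta(p)=2\sum_{i=0,1}(1-\cos p_i)$. A *finite range decomposition on the scales $\gamma^h$* is a family of complex functions $\hat A_{h,n}$, $0\le n<h$, differentiable on $Q_h$, such that, with $$F_h(p)=\prod_{n=0}^{h-1}|\hat A_{h,n}(p)|^2\ (F_0=1),\qquad C_h(x)=\int_{Q_0}\frac{d^2p}{(2\pi)^2}\,\frac{e^{ip\cdot x}}{-\hat\Delta(p)}\big[F_h(\gamma^hp)-F_{h+1}(\gamma^{h+1}p)\big]\quad(x\in\mathbb Z^2),$$ every $C_h$ is real, positive semidefinite, and $C_h(x)=0$ if $\max(|x_0|,|x_1|)>\gamma^{h+1}/2$; and such that for some constant $K$ and all $0\le n<h$, $p\in Q_h$: $\hat A_{h,n}(0)=1$, $|\hat A_{h,n}(p)|\le 1$, $|1-\hat A_{h,n}(p)|\le K|p|\gamma^{-(h-n)}$, $|\hat A_{h,n}(p)|\le K/(1+(\gamma^{-(h-n-1)}|p|)^4)$, $|\hat A_{h,n}(p)-\hat A_{h+1,n+1}(p)|\le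 K\gamma^{-n}$. For $L=\gamma^M$, $M\ge1$, let $\Gamma_j=\sum_{m=0}^{M-1}C_{jM+m}$, $\Gamma_{j,n}=\Gamma_n+\dots+\Gamma_j$ (zero if $n>j$), $f(0|y)=f(0)-f(y)$, $\partial^\mu f(y)=f(y+\mu)-f(y)$, and let $\sum_\mu$ denote one half of the sum over the four unit vectors of $\mathbb Z^2$. The second order coefficients of the renormalization group flow of the two-dimensional Coulomb gas are $$a_j=\frac{\alpha^2}{2}\sum_{y\in\mathbb Z^2}|y|^2\Big[w_{b,j}(y)\big(e^{-\alpha^2\Gamma_j(0|y)}-1\big)+e^{-\alpha^2\Gamma_j(0)}\big(e^{\alpha^2\Gamma_j(y)}-1\big)L^{-4j}\Big],$$ $$w_{b,j}(y)=\sum_{n=0}^{j-1}e^{-\alpha^2\Gamma_{j-1,n+1}(0|y)}e^{-\alpha^2\Gamma_n(0)}\big(e^{\alpha^2\Gamma_n(y)}-1\big)L^{-4n},$$ $$b_j=\frac{\alpha^2}{2}\sum_{y\in\mathbb Z^2}\sum_\mu\Big[(\partial^\mu\Gamma_j)^2(y)+2\sum_{n=0}^{j-1}(\partial^\mu\Gamma_n)(y)(\partial^\mu\Gamma_j)(y)\,e^{-\frac{\alpha^2}{2}\Gamma_{j-1,n}(0)}L^{2(j-n)}\Big],$$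 with $|y|$ the Euclidean length. **Statement.** For every odd $\gamma\ge3$ finite range decompositions on the scales $\gamma^h$ exist. For every such decomposition the limit $u(p)=\lim_{h\to\infty}F_h(p)$ exists for all $p\in\mathbb R^2$, and there is a constant $c$ such that, as $|x|\to\infty$, $$\int_{\mathbb R^2}\frac{d^2p}{(2\pi)^2}\,(e^{ip\cdot x}-1)\frac{u(p)}{p^2}=-\frac1{2\pi}\ln|x|+c+o(1),$$ the integral being absolutely convergent for every $x\in\mathbb R^2$. Moreover there is a constant $C$ and, for every $L=\gamma^M$ with $M\ge 1$, a constant $C(L)$ such that, if $\alpha^2=8\pi$, $a=8\pi^2e^{8\pi c}\ln L$ and $b=2\ln L$, then for all $j\ge0$ $$\big|L^2e^{-\frac{\alpha^2}{2}\Gamma_j(0)}-1\big|\le C\,L^{-j/4},\qquad |a_j-a|\le C(L)L^{-j/4},\qquad |b_j-b|\le C(L)L^{-j/4}.$$ In particular $a_j\to a$ and $b_j\to b$ as $j\to\infty$. -/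

import Mathlib

namespace CoulombGas

/-- Momenta (and points of the continuum) in `ℝ²`, with the Euclidean norm. -/
abbrev Plane := EuclideanSpace ℝ (Fin 2)

/-- Sites of the lattice `ℤ²`. -/
abbrev Site := Fin 2 → ℤ

/-- The pairing `p · x` of a momentum with a lattice site. -/
noncomputable def pair (p : Plane) (x : Site) : ℝ := ∑ i, p i * (x i : ℝ)

/-- The Euclidean length squared `|y|² = y₀² + y₁²` of a lattice site. -/
def sqLen (y : Site) : ℝ := ∑ i, (y i : ℝ) ^ 2

/-- The maximum norm `max (|x₀|, |x₁|)` of a lattice site. -/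
def maxLen (x : Site) : ℤ := max |x 0| |x 1|

/-- The box `Q_h = [-π γ^h, π γ^h]²`; `Q_0` is the Brillouin zone of `ℤ²`. -/
def box (γ h : ℕ) : Set Plane := {p | ∀ i, |p i| ≤ Real.pi * (γ : ℝ) ^ h}

/-- The Fourier multiplier `2 ∑ᵢ (1 - cos pᵢ)` of minus the lattice Laplacian on `ℤ²`. -/
noncomputable def lapSymbol (p : Plane) : ℝ := 2 * ∑ i, (1 - Real.cos (p i))

/-- The cutoff function `F_h(p) = ∏_{n = 0}^{h - 1} |A_{h,n}(p)|²`; in particular `F_0 = 1`. -/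
noncomputable def cutoff (A : ℕ → ℕ → Plane → ℂ) (h : ℕ) (p : Plane) : ℝ :=
  ∏ n ∈ Finset.range h, ‖A h n p‖ ^ 2

/-- The massless covariance of the scale `γ^h`,
`C_h(x) = ∫_{Q_0} d²p/(2π)² e^{i p·x} [F_h(γ^h p) - F_{h+1}(γ^{h+1} p)] / (-Δ̂(p))`. -/
noncomputable def sliceCov (γ : ℕ) (A : ℕ → ℕ → Plane → ℂ) (h : ℕ) (x : Site) : ℂ :=
  (((2 * Real.pi) ^ 2 : ℝ) : ℂ)⁻¹ *
    ∫ p in box γ 0, Complex.exp (Complex.I * (pair p x : ℂ)) *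
      (((cutoff A h ((γ : ℝ) ^ h • p) - cutoff A (h + 1) ((γ : ℝ) ^ (h + 1) • p))
        / lapSymbol p : ℝ) : ℂ)

/-- `A` defines a finite range multiscale decomposition, on the scales `γ^h`, of the massless
lattice propagator on `ℤ²`. By `F_0 = 1` the slices `C_0, …, C_{h-1}` sum, at the level of Fourier
transforms, to the propagator `1 / (-Δ̂(p))` minus the remainder `F_h(γ^h p) / (-Δ̂(p))`; each slice
is the covariance of a real Gaussian field and has finite range. The last field gives the uniform
regularity of the factors: normalization at zero momentum, decay at large momenta, and comparison
of consecutive lattice spacings. -/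
structure IsFiniteRangeDecomposition (γ : ℕ) (A : ℕ → ℕ → Plane → ℂ) : Prop where
  differentiableOn : ∀ h n, n < h → DifferentiableOn ℝ (A h n) (box γ h)
  real : ∀ h x, (sliceCov γ A h x).im = 0
  posSemidef : ∀ h, Matrix.PosSemidef
    (Matrix.of fun x y : Site => (sliceCov γ A h (x - y)).re)
  finiteRange : ∀ h x, (γ : ℝ) ^ (h + 1) / 2 < (maxLen x : ℝ) → sliceCov γ A h x = 0
  bounds : ∃ K : ℝ, ∀ h n, n < h → A h n 0 = 1 ∧ ∀ p ∈ box γ h,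
    ‖A h n p‖ ≤ 1 ∧
    ‖1 - A h n p‖ ≤ K * ‖p‖ * ((γ : ℝ) ^ (h - n))⁻¹ ∧
    ‖A h n p‖ ≤ K / (1 + (((γ : ℝ) ^ (h - n - 1))⁻¹ * ‖p‖) ^ 4) ∧
    ‖A h n p - A (h + 1) (n + 1) p‖ ≤ K * ((γ : ℝ) ^ n)⁻¹

/-- The covariance of the block scale `j` for the block size `L = γ^M`: `Γ_j` is the sum of the `M`
slices `C_{jM}, …, C_{jM + M - 1}`, i.e. those of the scales from `L^j` up to `L^{j+1} / γ`. -/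
noncomputable def blockCov (γ M : ℕ) (A : ℕ → ℕ → Plane → ℂ) (j : ℕ) (x : Site) : ℝ :=
  ∑ m ∈ Finset.range M, (sliceCov γ A (j * M + m) x).re

/-- `Γ_n + Γ_{n+1} + ⋯ + Γ_{j-1}`, which is zero if `n ≥ j`. -/
noncomputable def sumCov (Γ : ℕ → Site → ℝ) (n j : ℕ) (x : Site) : ℝ :=
  ∑ k ∈ Finset.Ico n j, Γ k x

/-- The kernel `w_{b,j}` of the neutral second order interaction,
`∑_{n < j} e^{-α² Γ_{j-1,n+1}(0|y)} e^{-α² Γ_n(0)} (e^{α² Γ_n(y)} - 1) L^{-4n}`, where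
`f(0|y) = f(0) - f(y)`. -/
noncomputable def neutralKernel (α L : ℝ) (Γ : ℕ → Site → ℝ) (j : ℕ) (y : Site) : ℝ :=
  ∑ n ∈ Finset.range j,
    Real.exp (-α ^ 2 * (sumCov Γ (n + 1) j 0 - sumCov Γ (n + 1) j y)) *
      Real.exp (-α ^ 2 * Γ n 0) * (Real.exp (α ^ 2 * Γ n y) - 1) * (L ^ (4 * n))⁻¹

/-- The coefficient `a_j` in `s_{j+1} = s_j - a_j z_j² + ⋯`. -/
noncomputable def aCoeff (α L : ℝ) (Γ : ℕ → Site → ℝ) (j : ℕ) : ℝ :=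
  α ^ 2 / 2 * ∑' y : Site, sqLen y *
    (neutralKernel α L Γ j y * (Real.exp (-α ^ 2 * (Γ j 0 - Γ j y)) - 1) +
      Real.exp (-α ^ 2 * Γ j 0) * (Real.exp (α ^ 2 * Γ j y) - 1) * (L ^ (4 * j))⁻¹)

/-- The lattice derivative `(∂^μ f)(y) = f(y + μ) - f(y)`. -/
def latticeDeriv (μ : Site) (f : Site → ℝ) (y : Site) : ℝ := f (y + μ) - f y

/-- The sum over the four unit vectors `μ ∈ {±e₀, ±e₁}`, with the customary factor `1/2`. -/
noncomputable def dirSum (f : Site → ℝ) : ℝ :=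
  (1 / 2) * ∑ i : Fin 2, (f (Pi.single i 1) + f (Pi.single i (-1)))

/-- The coefficient `b_j` in `z_{j+1} = L² e^{-α² Γ_j(0) / 2} (z_j - b_j s_j z_j + ⋯)`. -/
noncomputable def bCoeff (α L : ℝ) (Γ : ℕ → Site → ℝ) (j : ℕ) : ℝ :=
  α ^ 2 / 2 * ∑' y : Site, dirSum fun μ =>
    latticeDeriv μ (Γ j) y ^ 2 +
      2 * ∑ n ∈ Finset.range j, latticeDeriv μ (Γ n) y * latticeDeriv μ (Γ j) y *
        Real.exp (-(α ^ 2 / 2) * sumCov Γ n j 0) * L ^ (2 * (j - n))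

/-- The integrand `(e^{i p·x} - 1) u(p) / p²` of the normalized continuum potential. -/
noncomputable def potentialIntegrand (u : Plane → ℝ) (x p : Plane) : ℂ :=
  (Complex.exp (Complex.I * (inner ℝ p x : ℂ)) - 1) * ((u p / ‖p‖ ^ 2 : ℝ) : ℂ)

/-- `c` is the constant in `∫ d²p/(2π)² (e^{i p·x} - 1) u(p) / p² = -(1/2π) ln |x| + c + o(1)`
as `|x| → ∞`, the integral being absolutely convergent for every `x`. -/
def IsPotentialConstant (u : Plane → ℝ) (c : ℝ) : Prop :=
  (∀ x, MeasureTheory.Integrable (potentialIntegrand u x)) ∧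
  Filter.Tendsto
    (fun x : Plane => (((2 * Real.pi) ^ 2 : ℝ) : ℂ)⁻¹ * (∫ p, potentialIntegrand u x p) +
      ((1 / (2 * Real.pi) * Real.log ‖x‖ : ℝ) : ℂ))
    (Filter.cocompact Plane) (nhds (c : ℂ))

end CoulombGas

/-! Every slice is compared, on its own scale, with a continuum potential. The two flow coefficients
then telescope in the limit, and both are evaluated by the plane Frullani integral (`frullani`): for
φ decaying at infinity, the integral of [φ(x) - φ(Lx)]/|x|² is 2π φ(0) ln L.

Slices. Matching factor n of F_h with factor n + 1 of F_{h+1} and interpolating between the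
available bounds gives F_h → u with error of order γ^{-h/4} |p|^{1/4}/(1 + |p|²)
(`exists_cutoffEstimates`). In the variable q = γ^h p the Fourier transform of C_h is [F_h(q) -
F_{h+1}(γq)]/Λ_h(q), where Λ_h is the symbol on spacing γ^{-h}. It converges in L¹ to [u(q) -
u(γq)]/|q|² (`abs_kernel_sub_le`). If V is the potential normalized by V(0) = 0, this says that C_h
at γ^h x tends to V(x) - V(x/γ) + ln γ/(2π), the constant being Frullani's (`limitCov_eq`). At α² =
8π it follows that L² e^{-α²Γ_j(0)/2} → 1. The errors of the slices in a block form a geometric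
series, so the block constants do not depend on M (`ScaleProfile.block`).

The constant c. Comparing u with a Gaussian cutoff leaves an integrable difference, to which the
Riemann–Lebesgue lemma applies, while the Gaussian potential is explicit
(`exists_isPotentialConstant`). The finite range survives the limit, so V + ln|x|/(2π) is invariant
under x ↦ γx as soon as some coordinate exceeds 1/2 in modulus. Hence it equals its limit c there,
exactly (`ScaleProfile.pot_eq_log`). In particular V is exactly logarithmic at every nonzero lattice
site.

The coefficient a_j. Replacing e^{-8πΓ_n(0)} by its limit L^{-4} makes the sum over n in the neutral
kernel telescope to |y|^{-4} N(y/L^j), with N(x) = e^{8π(c - V(x))} - |x|⁴ of compact support. The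
whole summand becomes [N(y/L^{j+1}) - N(y/L^j)]/|y|² (`ScaleProfile.limitSummand_eq`). Its lattice
sum is close to its integral, which is 2π N(0) ln L = 2π e^{8πc} ln L, and the prefactor is α²/2 =
4π.

The coefficient b_j. By Parseval, the sum over lattice gradients cancels one of two inverse
Laplacian symbols (`CutoffEstimates.hasSum_dirSum`). The weights e^{-4πΓ_{j-1,n}(0)} L^{2(j-n)} may
be replaced by 1, because the overlap of blocks n and j decays like L^{-(j-n)}. With G, G' the
cutoffs before and after block j, the numerators add up to (G - G')² + 2(1 - G)(G - G') = (2G - G²)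
- (2G' - G'²). Frullani for 2u - u² gives 2π ln L, and the prefactor is 1/π.

Existence. The factors are fourth powers of normalized Dirichlet kernels in an angle φ with 8 sin²φ
equal to the Laplacian symbol. By Chebyshev they are polynomials in the Laplacian. Their degrees add
up to less than the allowed range, and their values in [0, 1] give positivity
(`exists_isFiniteRangeDecomposition`). -/

namespace CoulombGas

open MeasureTheory Filter Topology Set

/-! ### Radial integrals and the Frullani integral in the plane. -/

/-- Interpolation between two upper bounds. -/
lemma le_rpow_mul_rpow_of_le {x a b θ : ℝ} (hx : 0 ≤ x) (ha : x ≤ a) (hb : x ≤ b)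
    (h0 : 0 ≤ θ) (h1 : θ ≤ 1) : x ≤ a ^ θ * b ^ (1 - θ) := by
  calc x = x ^ θ * x ^ (1 - θ) := by
        rw [← Real.rpow_add_of_nonneg hx h0 (by linarith)]; simp
    _ ≤ a ^ θ * b ^ (1 - θ) := by
        have := Real.rpow_nonneg (hx.trans ha) θ
        have := Real.rpow_le_rpow hx hb (z := 1 - θ) (by linarith)
        gcongr

lemma finrank_plane : Module.finrank ℝ Plane = 2 := by simp

lemma volume_real_ball (r : ℝ) (hr : 0 ≤ r) :
    (volume : Measure Plane).real (Metric.ball 0 r) = Real.pi * r ^ 2 := by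
  rw [Measure.real, EuclideanSpace.volume_ball_fin_two]
  simp [ENNReal.toReal_ofReal, hr, Real.pi_nonneg, mul_comm]

/-- Integrals of radial functions on the plane. -/
lemma integral_radial (f : ℝ → ℝ) :
    ∫ x : Plane, f ‖x‖ = 2 * Real.pi * ∫ r in Ioi (0 : ℝ), r * f r := by
  have := integral_fun_norm_addHaar (volume : Measure Plane) f
  rw [this, finrank_plane, volume_real_ball 1 zero_le_one]
  simp
  ring

lemma integrable_radial_iff (f : ℝ → ℝ) :
    Integrable (fun x : Plane => f ‖x‖) ↔ IntegrableOn (fun r => r * f r) (Ioi 0) := by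
  rw [integrable_fun_norm_addHaar (volume : Measure Plane), finrank_plane]
  simp

/-- The radial weights `‖q‖ ^ s / (1 + ‖q‖²)`. -/
noncomputable def weight (s : ℝ) (q : Plane) : ℝ := ‖q‖ ^ s / (1 + ‖q‖ ^ 2)

lemma weight_nonneg (s : ℝ) (q : Plane) : 0 ≤ weight s q := by
  unfold weight; positivity

/-- In polar coordinates the integrand is r^{s+1}/(1 + r²): s > -2 serves the origin and s < 0
serves infinity. These weights dominate all momentum integrals below. -/
lemma integrable_weight {s : ℝ} (h1 : -2 < s) (h2 : s < 0) : Integrable (weight s) := by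
  unfold weight
  rw [integrable_radial_iff (fun r => r ^ s / (1 + r ^ 2)), ← Ioc_union_Ioi_eq_Ioi zero_le_one]
  have meas : AEStronglyMeasurable (fun r : ℝ => r * (r ^ s / (1 + r ^ 2))) volume := by
    have : Measurable (fun r : ℝ => r * (r ^ s / (1 + r ^ 2))) := by fun_prop
    exact this.aestronglyMeasurable
  refine IntegrableOn.union ?_ ?_
  · have h : IntegrableOn (fun r : ℝ => r ^ (s + 1)) (Ioc 0 1) := by
      have := intervalIntegral.intervalIntegrable_rpow' (a := 0) (b := 1) (r := s + 1) (by linarith)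
      rwa [intervalIntegrable_iff_integrableOn_Ioc_of_le zero_le_one] at this
    refine Integrable.mono' h meas.restrict ?_
    refine (ae_restrict_mem measurableSet_Ioc).mono fun r hr => ?_
    have hr0 : 0 < r := hr.1
    rw [Real.norm_of_nonneg (by positivity), Real.rpow_add_one hr0.ne', mul_comm (r ^ s)]
    gcongr
    exact div_le_self (by positivity) (by nlinarith)
  · have h : IntegrableOn (fun r : ℝ => r ^ (s - 1)) (Ioi 1) :=
      integrableOn_Ioi_rpow_of_lt (by linarith) zero_lt_one
    refine Integrable.mono' h meas.restrict ?_
    refine (ae_restrict_mem measurableSet_Ioi).mono fun r hr => ?_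
    have hr0 : 0 < r := zero_lt_one.trans hr
    rw [Real.norm_of_nonneg (by positivity), Real.rpow_sub_one hr0.ne']
    rw [mul_div_assoc', div_le_div_iff₀ (by positivity) hr0]
    have : 0 < r ^ s := by positivity
    nlinarith

/-- Powers of the norm are integrable on discs, with the expected scaling. -/
lemma integrableOn_norm_rpow {s R : ℝ} (hs : -2 < s) (hR : 0 ≤ R) :
    IntegrableOn (fun x : Plane => ‖x‖ ^ s) (Metric.closedBall 0 R) ∧
      ∫ x in Metric.closedBall (0 : Plane) R, ‖x‖ ^ s
        = 2 * Real.pi * (R ^ (s + 2) / (s + 2)) := by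
  have hi : (Metric.closedBall (0 : Plane) R).indicator (fun x : Plane => ‖x‖ ^ s) =
      fun x : Plane => (Iic R).indicator (fun r => r ^ s) ‖x‖ := by
    ext x
    simp [indicator]
  have h2 : (fun r : ℝ => r * (Iic R).indicator (fun r => r ^ s) r) =
      (Iic R).indicator (fun r => r * r ^ s) := by
    ext r; simp [indicator]
  have h4 : EqOn (fun r : ℝ => r * r ^ s) (fun r => r ^ (s + 1)) (Ioc 0 R) := fun r hr => by
    simp only []
    rw [Real.rpow_add_one hr.1.ne', mul_comm]
  constructor
  · rw [← integrable_indicator_iff Metric.isClosed_closedBall.measurableSet, hi,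
      integrable_radial_iff, h2, IntegrableOn, integrable_indicator_iff measurableSet_Iic,
      IntegrableOn, Measure.restrict_restrict measurableSet_Iic, inter_comm, Ioi_inter_Iic]
    refine IntegrableOn.congr_fun ?_ h4.symm measurableSet_Ioc
    have := intervalIntegral.intervalIntegrable_rpow' (a := 0) (b := R) (r := s + 1) (by linarith)
    rwa [intervalIntegrable_iff_integrableOn_Ioc_of_le hR] at this
  · rw [← integral_indicator Metric.isClosed_closedBall.measurableSet, hi, integral_radial, h2,
      integral_indicator measurableSet_Iic, Measure.restrict_restrict measurableSet_Iic, inter_comm,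
      Ioi_inter_Iic, setIntegral_congr_fun measurableSet_Ioc h4,
      ← intervalIntegral.integral_of_le hR, integral_rpow (Or.inl (by linarith))]
    rw [Real.zero_rpow (by linarith)]
    ring_nf

/-- Dilation invariance of the measure `dx / ‖x‖²`. -/
lemma integral_dilation (f : Plane → ℝ) {L : ℝ} (hL : 0 < L) :
    ∫ x, f (L • x) / ‖x‖ ^ 2 = ∫ x, f x / ‖x‖ ^ 2 := by
  have := Measure.integral_comp_smul (volume : Measure Plane) (fun x => f x / ‖x‖ ^ 2) L
  rw [finrank_plane, abs_of_pos (by positivity)] at this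
  have h2 : ∀ x : Plane, f (L • x) / ‖x‖ ^ 2 = L ^ 2 * (f (L • x) / ‖L • x‖ ^ 2) := by
    intro x
    rw [norm_smul, Real.norm_of_nonneg hL.le, mul_pow]
    by_cases hx : ‖x‖ = 0
    · simp [hx]
    · field_simp
  simp_rw [h2]
  rw [integral_const_mul, this, smul_eq_mul]
  field_simp

lemma integrable_dilation {f : Plane → ℝ} {L : ℝ} (hL : 0 < L)
    (hf : Integrable (fun x => f x / ‖x‖ ^ 2)) : Integrable (fun x => f (L • x) / ‖x‖ ^ 2) := by
  have := (hf.comp_smul hL.ne').const_mul (L ^ 2)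
  refine this.congr (Eventually.of_forall fun x => ?_)
  simp only []
  rw [norm_smul, Real.norm_of_nonneg hL.le, mul_pow]
  by_cases hx : ‖x‖ = 0
  · simp [hx]
  · field_simp

/-- The logarithmic measure of an annulus. -/
lemma integral_annulus {L : ℝ} (hL : 1 ≤ L) :
    let χ : Plane → ℝ := (Metric.closedBall 0 1).indicator 1
    Integrable (fun x => (χ x - χ (L • x)) / ‖x‖ ^ 2) ∧
      ∫ x, (χ x - χ (L • x)) / ‖x‖ ^ 2 = 2 * Real.pi * Real.log L := by
  intro χ
  have hL0 : 0 < L := by linarith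
  -- The difference is the indicator of the annulus L⁻¹ < |x| ≤ 1, where r · r⁻² = r⁻¹ integrates to
  -- ln L.
  have h1 : (fun x : Plane => (χ x - χ (L • x)) / ‖x‖ ^ 2) =
      fun x : Plane => (Ioc L⁻¹ 1).indicator (fun r => r⁻¹ ^ 2) ‖x‖ := by
    ext x
    have e1 : χ x = if ‖x‖ ≤ 1 then 1 else 0 := by simp [χ, indicator]
    have e2 : χ (L • x) = if ‖x‖ ≤ L⁻¹ then 1 else 0 := by
      have : ‖L • x‖ ≤ 1 ↔ ‖x‖ ≤ L⁻¹ := by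
        rw [norm_smul, Real.norm_of_nonneg hL0.le, ← one_div, le_div_iff₀' hL0]
      simp [χ, indicator, this]
    have hL1 : L⁻¹ ≤ 1 := inv_le_one_of_one_le₀ hL
    rw [e1, e2]
    simp only [indicator, mem_Ioc]
    split_ifs <;> first | (exfalso; grind) | simp_all
  have h2 : (fun r : ℝ => r * (Ioc L⁻¹ 1).indicator (fun r => r⁻¹ ^ 2) r) =
      (Ioc L⁻¹ 1).indicator (fun r => r⁻¹) := by
    ext r
    simp only [indicator]
    split_ifs with h
    · have : r ≠ 0 := (lt_trans (by positivity) h.1).ne'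
      field_simp
    · simp
  have hsub : Ioc L⁻¹ 1 ∩ Ioi 0 = Ioc L⁻¹ 1 :=
    inter_eq_left.2 fun r hr => lt_trans (by positivity) hr.1
  rw [h1]
  constructor
  · rw [integrable_radial_iff, h2, IntegrableOn, integrable_indicator_iff measurableSet_Ioc,
      IntegrableOn, Measure.restrict_restrict measurableSet_Ioc, hsub]
    have : IntervalIntegrable (fun r : ℝ => r⁻¹) volume L⁻¹ 1 := by
      apply intervalIntegral.intervalIntegrable_inv (f := fun r => r)
      · intro r hr
        rw [uIcc_of_le (inv_le_one_of_one_le₀ hL)] at hr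
        exact (lt_of_lt_of_le (by positivity) hr.1).ne'
      · fun_prop
    rwa [intervalIntegrable_iff_integrableOn_Ioc_of_le (inv_le_one_of_one_le₀ hL)] at this
  · rw [integral_radial, h2, integral_indicator measurableSet_Ioc,
      Measure.restrict_restrict measurableSet_Ioc, hsub,
      ← intervalIntegral.integral_of_le (inv_le_one_of_one_le₀ hL),
      integral_inv_of_pos (by positivity) one_pos]
    simp

/-- Frullani's integral in the plane. -/
lemma frullani {φ : Plane → ℝ} {φ₀ C L : ℝ} (hφ : Measurable φ)
    (h0 : ∀ x, |φ x - φ₀| ≤ C * ‖x‖) (h1 : ∀ x, |φ x| ≤ C / (1 + ‖x‖ ^ 2)) (hL : 1 ≤ L) :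
    Integrable (fun x => (φ x - φ (L • x)) / ‖x‖ ^ 2) ∧
      ∫ x, (φ x - φ (L • x)) / ‖x‖ ^ 2 = 2 * Real.pi * φ₀ * Real.log L := by
  have hL0 : 0 < L := by linarith
  set χ : Plane → ℝ := (Metric.closedBall 0 1).indicator 1 with hχ
  obtain ⟨i1, i2⟩ := integral_annulus hL
  have hmχ : Measurable χ := measurable_one.indicator Metric.isClosed_closedBall.measurableSet
  have hC : 0 ≤ C := by
    have := (abs_nonneg _).trans (h1 0)
    simpa using this
  -- Subtracting φ₀ times the indicator of the unit disc leaves a function that is integrable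
  -- against dx/|x|². By dilation invariance it contributes nothing, so the annulus carries the
  -- whole integral.
  have hψ : Integrable (fun x => (φ x - φ₀ * χ x) / ‖x‖ ^ 2) := by
    refine Integrable.mono' ((integrable_weight (s := -1) (by norm_num) (by norm_num)).const_mul
      (2 * C)) (Measurable.aestronglyMeasurable (by fun_prop)) (Eventually.of_forall fun x => ?_)
    by_cases hx0 : x = 0
    · subst hx0; simp [weight]
    have hx : 0 < ‖x‖ := norm_pos_iff.2 hx0
    rw [Real.norm_eq_abs, abs_div, abs_of_nonneg (sq_nonneg ‖x‖), weight, Real.rpow_neg_one]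
    have key : |φ x - φ₀ * χ x| ≤ 2 * C * (‖x‖ / (1 + ‖x‖ ^ 2)) := by
      by_cases hx1 : ‖x‖ ≤ 1
      · have : χ x = 1 := by simp [hχ, hx1]
        rw [this, mul_one]
        refine (h0 x).trans ?_
        rw [mul_div_assoc', le_div_iff₀ (by positivity)]
        have : 0 ≤ C * ‖x‖ := by positivity
        have : ‖x‖ ^ 2 ≤ 1 := pow_le_one₀ hx.le hx1
        nlinarith
      · have : χ x = 0 := by simp [hχ, hx1]
        rw [this, mul_zero, sub_zero]
        refine (h1 x).trans ?_
        rw [mul_div_assoc']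
        gcongr
        push Not at hx1
        nlinarith
    calc |φ x - φ₀ * χ x| / ‖x‖ ^ 2 ≤ 2 * C * (‖x‖ / (1 + ‖x‖ ^ 2)) / ‖x‖ ^ 2 := by gcongr
      _ = 2 * C * (‖x‖⁻¹ / (1 + ‖x‖ ^ 2)) := by field_simp
  have hψL := integrable_dilation hL0 hψ
  have e : (fun x => (φ x - φ (L • x)) / ‖x‖ ^ 2) = fun x =>
      ((φ x - φ₀ * χ x) / ‖x‖ ^ 2 - (φ (L • x) - φ₀ * χ (L • x)) / ‖x‖ ^ 2)
        + φ₀ * ((χ x - χ (L • x)) / ‖x‖ ^ 2) := by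
    ext x; ring
  rw [e]
  refine ⟨(hψ.sub hψL).add (i1.const_mul φ₀), ?_⟩
  have hs := hψ.sub hψL
  rw [integral_add (by exact hs) (by exact i1.const_mul φ₀), integral_sub hψ hψL,
    integral_dilation (fun x => φ x - φ₀ * χ x) hL0, integral_const_mul, i2]
  ring

end CoulombGas

/-! ### Convergence of the cutoff functions F_h. -/

namespace CoulombGas

open MeasureTheory Filter Topology Set

/-- Exchange the factors one at a time; all the others are at most 1. -/
lemma abs_prod_sub_prod_le {a b : ℕ → ℝ} (n : ℕ) (ha : ∀ i < n, a i ∈ Icc (0 : ℝ) 1)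
    (hb : ∀ i < n, b i ∈ Icc (0 : ℝ) 1) :
    |∏ i ∈ Finset.range n, a i - ∏ i ∈ Finset.range n, b i|
      ≤ ∑ i ∈ Finset.range n, |a i - b i| := by
  induction n with
  | zero => simp
  | succ n ih =>
    rw [Finset.prod_range_succ, Finset.prod_range_succ, Finset.sum_range_succ]
    have ih' := ih (fun i hi => ha i (by omega)) (fun i hi => hb i (by omega))
    set p := ∏ i ∈ Finset.range n, a i
    set q := ∏ i ∈ Finset.range n, b i
    have hq0 : 0 ≤ q := Finset.prod_nonneg fun i hi => (hb i (by simp at hi; omega)).1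
    have hq1 : q ≤ 1 := Finset.prod_le_one (fun i hi => (hb i (by simp at hi; omega)).1)
      (fun i hi => (hb i (by simp at hi; omega)).2)
    have han := ha n (by omega)
    calc |p * a n - q * b n| = |(p - q) * a n + q * (a n - b n)| := by ring_nf
      _ ≤ |p - q| * a n + q * |a n - b n| := by
        refine (abs_add_le _ _).trans ?_
        rw [abs_mul, abs_mul, abs_of_nonneg han.1, abs_of_nonneg hq0]
      _ ≤ |p - q| * 1 + 1 * |a n - b n| := by
        gcongr
        exact han.2
      _ ≤ _ := by linarith

lemma sum_geometric_le {r : ℝ} (h0 : 0 ≤ r) (h1 : r < 1) (n : ℕ) :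
    ∑ i ∈ Finset.range n, r ^ i ≤ (1 - r)⁻¹ := by
  rw [← tsum_geometric_of_lt_one h0 h1]
  exact (summable_geometric_of_lt_one h0 h1).sum_le_tsum _ fun i _ => by positivity

/-- The fourth root of the inverse of the basic scaling factor. -/
noncomputable def rate (γ : ℕ) : ℝ := (γ : ℝ) ^ (-(1 / 4) : ℝ)

lemma rate_pos {γ : ℕ} (hγ : 1 < γ) : 0 < rate γ := by
  have : (0 : ℝ) < γ := by positivity
  unfold rate; positivity

lemma rate_lt_one {γ : ℕ} (hγ : 1 < γ) : rate γ < 1 :=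
  Real.rpow_lt_one_of_one_lt_of_neg (by exact_mod_cast hγ) (by norm_num)

lemma rate_pow_four (γ : ℕ) : rate γ ^ 4 = (γ : ℝ)⁻¹ := by
  rw [rate, ← Real.rpow_natCast, ← Real.rpow_mul (by positivity)]
  norm_num
  rw [Real.rpow_neg_one]

lemma rate_pow (γ n : ℕ) : rate γ ^ n = (γ : ℝ) ^ (-(n : ℝ) / 4) := by
  rw [rate, ← Real.rpow_natCast, ← Real.rpow_mul (by positivity)]
  ring_nf

/-- Uniform estimates for the cutoff functions `F_h` and their limit `u`. -/
structure CutoffEstimates (γ : ℕ) (A : ℕ → ℕ → Plane → ℂ) (u : Plane → ℝ) (C : ℝ) : Prop where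
  one_le : 1 ≤ C
  continuousOn : ∀ h, ContinuousOn (cutoff A h) (box γ h)
  nonneg : ∀ h p, 0 ≤ cutoff A h p
  le_one : ∀ h, ∀ p ∈ box γ h, cutoff A h p ≤ 1
  decay : ∀ h, ∀ p ∈ box γ h, cutoff A h p ≤ C / (1 + ‖p‖ ^ 2) ^ 4
  origin : ∀ h, ∀ p ∈ box γ h, |1 - cutoff A h p| ≤ C * ‖p‖
  tendsto : ∀ p, Tendsto (fun h => cutoff A h p) atTop (𝓝 (u p))
  measurable : Measurable u
  lim_nonneg : ∀ p, 0 ≤ u p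
  lim_le_one : ∀ p, u p ≤ 1
  lim_decay : ∀ p, u p ≤ C / (1 + ‖p‖ ^ 2) ^ 4
  lim_origin : ∀ p, |1 - u p| ≤ C * ‖p‖
  dist : ∀ h, ∀ p ∈ box γ h, |cutoff A h p - u p| ≤ C * rate γ ^ h * (‖p‖ ^ (1 / 4 : ℝ) / (1 + ‖p‖ ^ 2))

lemma isClosed_box (γ h : ℕ) : IsClosed (box γ h) := by
  have : box γ h = ⋂ i, {p : Plane | |p i| ≤ Real.pi * (γ : ℝ) ^ h} := by ext; simp [box]
  rw [this]
  exact isClosed_iInter fun i => isClosed_le (by fun_prop) continuous_const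

lemma measurableSet_box (γ h : ℕ) : MeasurableSet (box γ h) := (isClosed_box γ h).measurableSet

lemma box_subset_succ {γ : ℕ} (hγ : 1 < γ) (h : ℕ) : box γ h ⊆ box γ (h + 1) := by
  intro p hp i
  refine (hp i).trans ?_
  have : (1 : ℝ) ≤ γ := by exact_mod_cast hγ.le
  gcongr
  omega

lemma box_mono {γ : ℕ} (hγ : 1 < γ) : Monotone (box γ) :=
  monotone_nat_of_le_succ (box_subset_succ hγ)

lemma exists_mem_box {γ : ℕ} (hγ : 1 < γ) (p : Plane) : ∃ h, p ∈ box γ h := by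
  obtain ⟨n, hn⟩ := pow_unbounded_of_one_lt ‖p‖ (show (1 : ℝ) < γ by exact_mod_cast hγ)
  refine ⟨n, fun i => ?_⟩
  have h1 : |p i| ≤ ‖p‖ := PiLp.norm_apply_le p i
  have h2 := Real.pi_gt_three
  have : 0 ≤ ‖p‖ := norm_nonneg p
  nlinarith

lemma norm_le_of_mem_box {γ h : ℕ} {p : Plane} (hp : p ∈ box γ h) :
    ‖p‖ ≤ 5 * (γ : ℝ) ^ h := by
  have h0 := hp 0
  have h1 := hp 1
  have hpi := Real.pi_lt_d2
  have : ‖p‖ ^ 2 ≤ (5 * (γ : ℝ) ^ h) ^ 2 := by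
    rw [EuclideanSpace.norm_sq_eq, Fin.sum_univ_two]
    simp only [Real.norm_eq_abs]
    have e : Real.pi * (γ : ℝ) ^ h ≤ 3.15 * (γ : ℝ) ^ h := by gcongr
    have a0 : |p 0| ^ 2 ≤ (3.15 * (γ : ℝ) ^ h) ^ 2 := by gcongr; exact h0.trans e
    have a1 : |p 1| ^ 2 ≤ (3.15 * (γ : ℝ) ^ h) ^ 2 := by gcongr; exact h1.trans e
    nlinarith [sq_nonneg ((γ : ℝ) ^ h)]
  exact le_of_sq_le_sq this (by positivity)

lemma norm_le_of_notMem_box {γ h : ℕ} {p : Plane} (hp : p ∉ box γ h) : (γ : ℝ) ^ h ≤ ‖p‖ := by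
  simp only [box, mem_ofPred_eq, not_forall, not_le] at hp
  obtain ⟨i, hi⟩ := hp
  have h1 : |p i| ≤ ‖p‖ := PiLp.norm_apply_le p i
  have h2 := Real.pi_gt_three
  have : (0 : ℝ) ≤ (γ : ℝ) ^ h := by positivity
  nlinarith

lemma smul_mem_box {γ h n : ℕ} {p : Plane} (hp : p ∈ box γ h) :
    (γ : ℝ) ^ n • p ∈ box γ (h + n) := by
  intro i
  have := hp i
  rw [PiLp.smul_apply, smul_eq_mul, abs_mul, abs_of_nonneg (by positivity), pow_add]
  calc _ ≤ (γ : ℝ) ^ n * (Real.pi * (γ : ℝ) ^ h) := by gcongr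
    _ = _ := by ring

lemma inv_smul_mem_box_iff {γ h : ℕ} (hγ : 1 < γ) {p : Plane} :
    ((γ : ℝ) ^ h)⁻¹ • p ∈ box γ 0 ↔ p ∈ box γ h := by
  have : (0 : ℝ) < (γ : ℝ) ^ h := by positivity
  simp only [box, mem_ofPred_eq, PiLp.smul_apply, smul_eq_mul, abs_mul, pow_zero, mul_one]
  refine forall_congr' fun i => ?_
  rw [abs_of_pos (by positivity), inv_mul_le_iff₀ this, mul_comm]

section

variable {γ : ℕ} {A : ℕ → ℕ → Plane → ℂ}

lemma abs_sq_sub_sq_le {x y : ℂ} (hx : ‖x‖ ≤ 1) (hy : ‖y‖ ≤ 1) :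
    |‖x‖ ^ 2 - ‖y‖ ^ 2| ≤ 2 * ‖x - y‖ := by
  have h1 : |‖x‖ - ‖y‖| ≤ ‖x - y‖ := abs_norm_sub_norm_le x y
  rw [sq_sub_sq, abs_mul, abs_of_nonneg (by positivity)]
  have := abs_nonneg (‖x‖ - ‖y‖)
  nlinarith [norm_nonneg x, norm_nonneg y]

lemma cutoff_nonneg (h : ℕ) (p : Plane) : 0 ≤ cutoff A h p :=
  Finset.prod_nonneg fun _ _ => by positivity

lemma sum_inv_pow_sub_le (hγ : 1 < γ) (h : ℕ) :
    ∑ n ∈ Finset.range h, ((γ : ℝ) ^ (h - n))⁻¹ ≤ 1 := by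
  have hg : (2 : ℝ) ≤ γ := by exact_mod_cast hγ
  have hr1 : (γ : ℝ)⁻¹ ≤ 1 / 2 := by rw [one_div]; gcongr
  rw [← Finset.sum_range_reflect]
  calc _ = ∑ i ∈ Finset.range h, (γ : ℝ)⁻¹ * (γ : ℝ)⁻¹ ^ i := by
        refine Finset.sum_congr rfl fun i hi => ?_
        have : h - (h - 1 - i) = i + 1 := by simp at hi; omega
        rw [this, pow_succ', mul_inv, inv_pow]
    _ ≤ (γ : ℝ)⁻¹ * (1 - (γ : ℝ)⁻¹)⁻¹ := by
        rw [← Finset.mul_sum]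
        gcongr
        exact sum_geometric_le (by positivity) (by linarith) h
    _ ≤ (1 / 2) * (1 - 1 / 2)⁻¹ := by
        refine mul_le_mul hr1 ?_ (inv_nonneg.2 (by linarith)) (by norm_num)
        exact inv_anti₀ (by norm_num) (by linarith)
    _ = 1 := by norm_num

/-- Factor n of F_h is matched with factor n + 1 of F_{h+1}, which has the same h - n. Both are
within K|p|γ^{-(h-n)} of 1, and they differ by at most Kγ^{-n}. Interpolation with exponents 1/3 and
2/3 gives γ^{-h/3} γ^{-n/3}, which is summable in n. -/
lemma exists_cutoff_step (hγ : 1 < γ) {K : ℝ} (hK : 1 ≤ K)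
    (hb : ∀ h n, n < h → ∀ p ∈ box γ h, ‖A h n p‖ ≤ 1 ∧
      ‖1 - A h n p‖ ≤ K * ‖p‖ * ((γ : ℝ) ^ (h - n))⁻¹ ∧
      ‖A h n p - A (h + 1) (n + 1) p‖ ≤ K * ((γ : ℝ) ^ n)⁻¹) :
    ∃ C, 0 ≤ C ∧ ∀ h, ∀ p ∈ box γ h,
      |cutoff A h p - cutoff A (h + 1) p| ≤ C * (γ : ℝ) ^ (-(h : ℝ) / 3) * ‖p‖ ^ (1 / 3 : ℝ) := by
  have hg : (0 : ℝ) < γ := by positivity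
  set r : ℝ := (γ : ℝ) ^ (-(1 / 3) : ℝ) with hr
  have hr0 : 0 < r := by positivity
  have hr1 : r < 1 := Real.rpow_lt_one_of_one_lt_of_neg (by exact_mod_cast hγ) (by norm_num)
  refine ⟨4 * K * (1 - r)⁻¹ + 2 * K, by
    have : 0 < 1 - r := by linarith
    positivity, fun h p hp => ?_⟩
  have hp1 := box_subset_succ hγ h hp
  have hrn : ∀ n : ℕ, r ^ n = (γ : ℝ) ^ (-(n : ℝ) / 3) := fun n => by
    rw [hr, ← Real.rpow_natCast, ← Real.rpow_mul hg.le]; ring_nf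
  rw [← hrn]
  have m1 : ∀ n < h, ‖A h n p‖ ^ 2 ∈ Icc (0 : ℝ) 1 := fun n hn =>
    ⟨by positivity, pow_le_one₀ (norm_nonneg _) (hb h n hn p hp).1⟩
  have m2 : ∀ n < h, ‖A (h + 1) (n + 1) p‖ ^ 2 ∈ Icc (0 : ℝ) 1 := fun n hn =>
    ⟨by positivity, pow_le_one₀ (norm_nonneg _) (hb (h + 1) (n + 1) (by omega) p hp1).1⟩
  have term : ∀ n ∈ Finset.range h, |‖A h n p‖ ^ 2 - ‖A (h + 1) (n + 1) p‖ ^ 2| ≤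
      4 * K * r ^ h * ‖p‖ ^ (1 / 3 : ℝ) * r ^ n := by
    intro n hn
    rw [Finset.mem_range] at hn
    obtain ⟨b1, b2, b3⟩ := hb h n hn p hp
    obtain ⟨c1, c2, -⟩ := hb (h + 1) (n + 1) (by omega) p hp1
    rw [Nat.add_sub_add_right] at c2
    have x1 := abs_sq_sub_sq_le b1 c1
    have x2 : ‖A h n p - A (h + 1) (n + 1) p‖ ≤ 2 * (K * ‖p‖ * ((γ : ℝ) ^ (h - n))⁻¹) := by
      have : A h n p - A (h + 1) (n + 1) p = (1 - A (h + 1) (n + 1) p) - (1 - A h n p) := by ring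
      rw [this]
      exact (norm_sub_le _ _).trans (by linarith)
    have x3 := le_rpow_mul_rpow_of_le (norm_nonneg _) (x2.trans_eq (show _ =
      (2 * K) * (‖p‖ * ((γ : ℝ) ^ (h - n))⁻¹) by ring)) (b3.trans (show _ ≤ (2 * K) *
      ((γ : ℝ) ^ n)⁻¹ by gcongr; linarith)) (θ := 1 / 3) (by norm_num) (by norm_num)
    have e : (2 * K * (‖p‖ * ((γ : ℝ) ^ (h - n))⁻¹)) ^ (1 / 3 : ℝ) *
        (2 * K * ((γ : ℝ) ^ n)⁻¹) ^ (1 - 1 / 3 : ℝ) = 2 * K * r ^ h * ‖p‖ ^ (1 / 3 : ℝ) * r ^ n := by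
      rw [Real.mul_rpow (x := 2 * K) (by positivity) (by positivity), Real.mul_rpow (x := ‖p‖)
        (by positivity) (by positivity), Real.mul_rpow (x := 2 * K) (by positivity)
        (by positivity)]
      have e1 : (2 * K) ^ (1 / 3 : ℝ) * (2 * K) ^ (1 - 1 / 3 : ℝ) = 2 * K := by
        rw [← Real.rpow_add (by positivity)]; norm_num
      have e2 : (((γ : ℝ) ^ (h - n))⁻¹) ^ (1 / 3 : ℝ) * (((γ : ℝ) ^ n)⁻¹) ^ (1 - 1 / 3 : ℝ)
          = r ^ h * r ^ n := by
        rw [← Real.rpow_natCast, ← Real.rpow_natCast, ← Real.rpow_neg hg.le, ← Real.rpow_neg hg.le,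
          ← Real.rpow_mul hg.le, ← Real.rpow_mul hg.le, ← Real.rpow_add hg, hrn, hrn,
          ← Real.rpow_add hg, Nat.cast_sub hn.le]
        congr 1
        ring
      calc _ = ((2 * K) ^ (1 / 3 : ℝ) * (2 * K) ^ (1 - 1 / 3 : ℝ)) * ‖p‖ ^ (1 / 3 : ℝ) *
            ((((γ : ℝ) ^ (h - n))⁻¹) ^ (1 / 3 : ℝ) * (((γ : ℝ) ^ n)⁻¹) ^ (1 - 1 / 3 : ℝ)) := by ring
        _ = _ := by rw [e1, e2]; ring
    rw [e] at x3
    linarith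
  have hsum : |∏ n ∈ Finset.range h, ‖A h n p‖ ^ 2 -
      ∏ n ∈ Finset.range h, ‖A (h + 1) (n + 1) p‖ ^ 2| ≤
      4 * K * r ^ h * ‖p‖ ^ (1 / 3 : ℝ) * (1 - r)⁻¹ := by
    refine (abs_prod_sub_prod_le h m1 m2).trans ((Finset.sum_le_sum term).trans ?_)
    rw [← Finset.mul_sum]
    gcongr
    exact sum_geometric_le hr0.le hr1 h
  -- The factor n = 0 of F_{h+1} has no partner. It differs from 1 by O(|p|γ^{-h}) and by O(1), and
  -- the same interpolation applies.
  have hlast : |1 - ‖A (h + 1) 0 p‖ ^ 2| ≤ 2 * K * r ^ h * ‖p‖ ^ (1 / 3 : ℝ) := by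
    obtain ⟨b1, b2, -⟩ := hb (h + 1) 0 (by omega) p hp1
    have x1 := abs_sq_sub_sq_le (x := 1) (by simp) b1
    simp only [norm_one, one_pow, Nat.sub_zero] at x1 b2
    have x0 : |1 - ‖A (h + 1) 0 p‖ ^ 2| ≤ 2 * K := by
      have : ‖A (h + 1) 0 p‖ ^ 2 ≤ 1 := pow_le_one₀ (norm_nonneg _) b1
      rw [abs_of_nonneg (by linarith)]
      nlinarith [sq_nonneg ‖A (h + 1) 0 p‖]
    have x2 : |1 - ‖A (h + 1) 0 p‖ ^ 2| ≤ 2 * K * (‖p‖ * ((γ : ℝ) ^ h)⁻¹) := by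
      have : ((γ : ℝ) ^ (h + 1))⁻¹ ≤ ((γ : ℝ) ^ h)⁻¹ := by
        gcongr
        · exact_mod_cast hγ.le
        · omega
      calc _ ≤ 2 * (K * ‖p‖ * ((γ : ℝ) ^ (h + 1))⁻¹) := by linarith
        _ ≤ 2 * (K * ‖p‖ * ((γ : ℝ) ^ h)⁻¹) := by gcongr
        _ = _ := by ring
    have x3 := le_rpow_mul_rpow_of_le (abs_nonneg _) x2 x0 (θ := 1 / 3) (by norm_num) (by norm_num)
    refine x3.trans_eq ?_
    rw [Real.mul_rpow (x := 2 * K) (by positivity) (by positivity), Real.mul_rpow (x := ‖p‖)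
        (by positivity) (by positivity)]
    have e1 : (2 * K) ^ (1 / 3 : ℝ) * (2 * K) ^ (1 - 1 / 3 : ℝ) = 2 * K := by
      rw [← Real.rpow_add (by positivity)]; norm_num
    have e2 : (((γ : ℝ) ^ h)⁻¹) ^ (1 / 3 : ℝ) = r ^ h := by
      rw [← Real.rpow_natCast, ← Real.rpow_neg hg.le, ← Real.rpow_mul hg.le, hrn]
      ring_nf
    rw [e2]
    calc _ = ((2 * K) ^ (1 / 3 : ℝ) * (2 * K) ^ (1 - 1 / 3 : ℝ)) * (‖p‖ ^ (1 / 3 : ℝ) * r ^ h) := by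
          ring
      _ = _ := by rw [e1]; ring
  rw [cutoff, cutoff, Finset.prod_range_succ']
  set P := ∏ n ∈ Finset.range h, ‖A h n p‖ ^ 2
  set Q := ∏ n ∈ Finset.range h, ‖A (h + 1) (n + 1) p‖ ^ 2
  have hQ0 : 0 ≤ Q := Finset.prod_nonneg fun i _ => by positivity
  have hQ1 : Q ≤ 1 := Finset.prod_le_one (fun i _ => by positivity)
    (fun i hi => (m2 i (by simpa using hi)).2)
  calc |P - Q * ‖A (h + 1) 0 p‖ ^ 2| = |(P - Q) + Q * (1 - ‖A (h + 1) 0 p‖ ^ 2)| := by ring_nf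
    _ ≤ |P - Q| + Q * |1 - ‖A (h + 1) 0 p‖ ^ 2| := by
      refine (abs_add_le _ _).trans ?_
      rw [abs_mul, abs_of_nonneg hQ0]
    _ ≤ |P - Q| + 1 * |1 - ‖A (h + 1) 0 p‖ ^ 2| := by gcongr
    _ ≤ 4 * K * r ^ h * ‖p‖ ^ (1 / 3 : ℝ) * (1 - r)⁻¹ + 1 * (2 * K * r ^ h * ‖p‖ ^ (1 / 3 : ℝ)) := by
      gcongr
    _ = _ := by ring

theorem exists_cutoffEstimates (hγ : 1 < γ) (hA : IsFiniteRangeDecomposition γ A) :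
    ∃ u C, CutoffEstimates γ A u C := by
  obtain ⟨K, hK⟩ := hA.bounds
  have hg : (1 : ℝ) ≤ γ := by exact_mod_cast hγ.le
  have zero_mem : ∀ h, (0 : Plane) ∈ box γ h := fun h i => by
    simp; positivity
  have hK1 : 1 ≤ K := by
    obtain ⟨h0, h1⟩ := hK 1 0 one_pos
    have := (h1 0 (zero_mem 1)).2.2.1
    rw [h0] at this
    simpa using this
  have cont : ∀ h, ContinuousOn (cutoff A h) (box γ h) := fun h => by
    unfold cutoff
    refine continuousOn_finsetProd _ fun n hn => ?_
    exact ((hA.differentiableOn h n (by simpa using hn)).continuousOn.norm).pow 2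
  have le1 : ∀ h, ∀ p ∈ box γ h, cutoff A h p ≤ 1 := fun h p hp =>
    Finset.prod_le_one (fun i _ => by positivity) fun n hn =>
      pow_le_one₀ (norm_nonneg _) ((hK h n (by simpa using hn)).2 p hp).1
  obtain ⟨C₁, hC₁, step⟩ := exists_cutoff_step hγ hK1 fun h n hn p hp =>
    ⟨((hK h n hn).2 p hp).1, ((hK h n hn).2 p hp).2.1, ((hK h n hn).2 p hp).2.2.2⟩
  -- For h ≥ 1 the factor n = h - 1 alone, squared, gives the decay, and (1 + |p|²)² ≤ 2(1 + |p|⁴)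
  -- produces 4K². For h = 0 the cutoff is 1 on a box where |p| ≤ 5, and 1 + 5² ≤ 33.
  set C₂ : ℝ := 4 * K ^ 2 + 33 ^ 4 with hC₂
  have decay : ∀ h, ∀ p ∈ box γ h, cutoff A h p ≤ C₂ / (1 + ‖p‖ ^ 2) ^ 4 := by
    intro h p hp
    rcases Nat.eq_zero_or_pos h with rfl | hpos
    · have : ‖p‖ ≤ 5 := by simpa using norm_le_of_mem_box hp
      rw [le_div_iff₀ (by positivity)]
      calc cutoff A 0 p * (1 + ‖p‖ ^ 2) ^ 4 ≤ 1 * (1 + 5 ^ 2) ^ 4 := by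
            gcongr
            exact le1 0 p hp
        _ ≤ C₂ := by rw [hC₂]; nlinarith
    · obtain ⟨n, rfl⟩ : ∃ n, h = n + 1 := ⟨h - 1, by omega⟩
      rw [cutoff, Finset.prod_range_succ]
      have b := ((hK (n + 1) n (by omega)).2 p hp).2.2.1
      simp only [Nat.add_sub_cancel_left, Nat.sub_self, pow_zero, inv_one, one_mul] at b
      have hprod : ∏ i ∈ Finset.range n, ‖A (n + 1) i p‖ ^ 2 ≤ 1 :=
        Finset.prod_le_one (fun i _ => by positivity) fun i hi =>
          pow_le_one₀ (norm_nonneg _) ((hK (n + 1) i (by simp at hi; omega)).2 p hp).1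
      have hp0 : 0 ≤ ∏ i ∈ Finset.range n, ‖A (n + 1) i p‖ ^ 2 :=
        Finset.prod_nonneg fun i _ => by positivity
      calc _ ≤ 1 * (K / (1 + ‖p‖ ^ 4)) ^ 2 := by gcongr
        _ ≤ C₂ / (1 + ‖p‖ ^ 2) ^ 4 := by
          rw [one_mul, div_pow, div_le_div_iff₀ (by positivity) (by positivity)]
          have : (1 + ‖p‖ ^ 2) ^ 2 ≤ 2 * (1 + ‖p‖ ^ 4) := by nlinarith [sq_nonneg (‖p‖ ^ 2 - 1)]
          calc K ^ 2 * (1 + ‖p‖ ^ 2) ^ 4 = K ^ 2 * ((1 + ‖p‖ ^ 2) ^ 2) ^ 2 := by ring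
            _ ≤ K ^ 2 * (2 * (1 + ‖p‖ ^ 4)) ^ 2 := by gcongr
            _ = 4 * K ^ 2 * (1 + ‖p‖ ^ 4) ^ 2 := by ring
            _ ≤ C₂ * (1 + ‖p‖ ^ 4) ^ 2 := by gcongr; rw [hC₂]; linarith
  have hC₂1 : 1 ≤ C₂ := by rw [hC₂]; nlinarith
  have origin : ∀ h, ∀ p ∈ box γ h, |1 - cutoff A h p| ≤ 2 * K * ‖p‖ := by
    intro h p hp
    have := abs_prod_sub_prod_le (a := fun _ => 1) (b := fun n => ‖A h n p‖ ^ 2) h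
      (fun i _ => by simp) (fun n hn => ⟨by positivity,
        pow_le_one₀ (norm_nonneg _) ((hK h n hn).2 p hp).1⟩)
    simp only [Finset.prod_const_one] at this
    refine this.trans ?_
    calc _ ≤ ∑ n ∈ Finset.range h, 2 * K * ‖p‖ * ((γ : ℝ) ^ (h - n))⁻¹ := by
          refine Finset.sum_le_sum fun n hn => ?_
          obtain ⟨b1, b2, -⟩ := (hK h n (by simpa using hn)).2 p hp
          have x1 := abs_sq_sub_sq_le (x := 1) (by simp) b1
          simp only [norm_one, one_pow] at x1
          linarith
      _ ≤ 2 * K * ‖p‖ * 1 := by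
          rw [← Finset.mul_sum]
          gcongr
          exact sum_inv_pow_sub_le hγ h
      _ = _ := by ring
  -- Interpolation at θ = 3/4 between the step bound and the decay: γ^{-h/3} becomes γ^{-h/4},
  -- |p|^{1/3} becomes |p|^{1/4}, and (1 + |p|²)^{-4} becomes (1 + |p|²)^{-1}. The positive power of
  -- |p| keeps the error integrable after division by |p|².
  set C₃ : ℝ := C₁ ^ (3 / 4 : ℝ) * C₂ ^ (1 / 4 : ℝ) with hC₃
  have hC₃0 : 0 ≤ C₃ := by positivity
  have step' : ∀ h, ∀ p ∈ box γ h, |cutoff A h p - cutoff A (h + 1) p| ≤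
      C₃ * (‖p‖ ^ (1 / 4 : ℝ) / (1 + ‖p‖ ^ 2)) * rate γ ^ h := by
    intro h p hp
    have x1 : |cutoff A h p - cutoff A (h + 1) p| ≤ C₂ / (1 + ‖p‖ ^ 2) ^ 4 := by
      have a1 := decay h p hp
      have a2 := decay (h + 1) p (box_subset_succ hγ h hp)
      have a3 := cutoff_nonneg (A := A) h p
      have a4 := cutoff_nonneg (A := A) (h + 1) p
      rw [abs_le]; constructor <;> linarith
    refine (le_rpow_mul_rpow_of_le (abs_nonneg _) (step h p hp) x1 (θ := 3 / 4) (by norm_num)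
      (by norm_num)).trans_eq ?_
    rw [Real.mul_rpow (by positivity) (by positivity), Real.mul_rpow (by positivity)
        (by positivity), Real.div_rpow (by positivity) (by positivity), ← Real.rpow_mul
        (by positivity), ← Real.rpow_mul (by positivity), ← Real.rpow_natCast (1 + ‖p‖ ^ 2) 4,
        ← Real.rpow_mul (by positivity), rate_pow, hC₃]
    norm_num
    ring_nf
  have lim : ∀ p, ∃ v, Tendsto (fun h => cutoff A h p) atTop (𝓝 v) ∧ ∀ h, p ∈ box γ h →
      |cutoff A h p - v| ≤
        C₃ * (‖p‖ ^ (1 / 4 : ℝ) / (1 + ‖p‖ ^ 2)) * rate γ ^ h / (1 - rate γ) := by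
    intro p
    -- The bounds hold only from the first box that contains p, so the geometric Cauchy argument is
    -- run on the shifted sequence.
    have key : ∀ h, p ∈ box γ h → ∃ v, Tendsto (fun h => cutoff A h p) atTop (𝓝 v) ∧
      |cutoff A h p - v| ≤
        C₃ * (‖p‖ ^ (1 / 4 : ℝ) / (1 + ‖p‖ ^ 2)) * rate γ ^ h / (1 - rate γ) := by
      intro h hp
      have hs : ∀ n, Dist.dist (cutoff A (n + h) p) (cutoff A (n + 1 + h) p) ≤
          C₃ * (‖p‖ ^ (1 / 4 : ℝ) / (1 + ‖p‖ ^ 2)) * rate γ ^ h * rate γ ^ n := by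
        intro n
        have := step' (n + h) p (box_mono hγ (by omega) hp)
        rw [Real.dist_eq, show n + 1 + h = n + h + 1 by ring]
        refine this.trans_eq ?_
        rw [pow_add]; ring
      have hc := cauchySeq_of_le_geometric _ _ (rate_lt_one hγ) hs
      obtain ⟨v, hv⟩ := cauchySeq_tendsto_of_complete hc
      refine ⟨v, (tendsto_add_atTop_iff_nat h).1 hv, ?_⟩
      have := dist_le_of_le_geometric_of_tendsto₀ _ _ (rate_lt_one hγ) hs hv
      simpa [Real.dist_eq] using this
    obtain ⟨h, hp⟩ := exists_mem_box hγ p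
    obtain ⟨v, hv, -⟩ := key h hp
    refine ⟨v, hv, fun h' hp' => ?_⟩
    obtain ⟨v', hv', b⟩ := key h' hp'
    rwa [tendsto_nhds_unique hv hv']
  choose u hu hdist using lim
  have hev : ∀ p, ∀ᶠ h in atTop, p ∈ box γ h := fun p => by
    obtain ⟨h, hp⟩ := exists_mem_box hγ p
    exact eventually_atTop.2 ⟨h, fun n hn => box_mono hγ hn hp⟩
  have hr := rate_lt_one hγ
  have hr' : 0 < 1 - rate γ := by linarith
  set C : ℝ := C₂ + 2 * K + C₃ / (1 - rate γ) with hC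
  have hq : 0 ≤ C₃ / (1 - rate γ) := by positivity
  have c1 : C₂ ≤ C := by linarith
  have c2 : 2 * K ≤ C := by linarith
  have c3 : C₃ / (1 - rate γ) ≤ C := by linarith
  have decay' : ∀ h, ∀ p ∈ box γ h, cutoff A h p ≤ C / (1 + ‖p‖ ^ 2) ^ 4 := fun h p hp =>
    (decay h p hp).trans (by gcongr)
  have origin' : ∀ h, ∀ p ∈ box γ h, |1 - cutoff A h p| ≤ C * ‖p‖ := fun h p hp =>
    (origin h p hp).trans (by gcongr)
  refine ⟨u, C, ⟨by linarith, cont, cutoff_nonneg, le1, decay', origin', hu, ?_,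
    fun p => ge_of_tendsto' (hu p) fun h => cutoff_nonneg h p,
    fun p => le_of_tendsto (hu p) ((hev p).mono fun h hp => le1 h p hp),
    fun p => le_of_tendsto (hu p) ((hev p).mono fun h hp => decay' h p hp),
    fun p => le_of_tendsto (tendsto_const_nhds.sub (hu p)).abs
      ((hev p).mono fun h hp => origin' h p hp), fun h p hp => ?_⟩⟩
  -- F_h is known to be continuous on its box only; the limit is unchanged when F_h is cut off
  -- outside it.
  · refine measurable_of_tendsto_metrizable (f := fun h => (box γ h).indicator (cutoff A h))
      (fun h => ?_) (tendsto_pi_nhds.2 fun p => ?_)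
    · classical
      rw [← piecewise_eq_indicator]
      exact (cont h).measurable_piecewise continuousOn_const (measurableSet_box γ h)
    · exact (hu p).congr' ((hev p).mono fun h hp => (indicator_of_mem hp _).symm)
  · refine (hdist p h hp).trans ?_
    have := rate_pos hγ
    calc _ = C₃ / (1 - rate γ) * rate γ ^ h * (‖p‖ ^ (1 / 4 : ℝ) / (1 + ‖p‖ ^ 2)) := by ring
      _ ≤ _ := by gcongr

end

end CoulombGas

/-! ### The lattice Laplacian and the comparison of lattice and continuum kernels. -/

namespace CoulombGas

open MeasureTheory Filter Topology Set

/-- A lattice site as a point of the plane. -/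
noncomputable def toPlane (y : Site) : Plane := WithLp.toLp 2 fun i => (y i : ℝ)

@[simp] lemma toPlane_apply (y : Site) (i : Fin 2) : toPlane y i = y i := rfl

@[simp] lemma toPlane_zero : toPlane 0 = 0 := by ext i; simp

lemma pair_eq_inner (p : Plane) (y : Site) : pair p y = inner ℝ p (toPlane y) := by
  simp [pair, PiLp.inner_apply, mul_comm]

lemma sqLen_eq_norm_sq (y : Site) : sqLen y = ‖toPlane y‖ ^ 2 := by
  simp [sqLen, EuclideanSpace.norm_sq_eq]

lemma norm_sq_eq_add (p : Plane) : ‖p‖ ^ 2 = p 0 ^ 2 + p 1 ^ 2 := by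
  simp [EuclideanSpace.norm_sq_eq]

lemma continuous_lapSymbol : Continuous lapSymbol := by
  unfold lapSymbol; fun_prop

lemma lapSymbol_nonneg (p : Plane) : 0 ≤ lapSymbol p := by
  unfold lapSymbol
  have := fun i => Real.cos_le_one (p i)
  exact mul_nonneg two_pos.le (Finset.sum_nonneg fun i _ => by linarith [this i])

lemma lapSymbol_le (p : Plane) : lapSymbol p ≤ ‖p‖ ^ 2 := by
  rw [lapSymbol, norm_sq_eq_add, Fin.sum_univ_two]
  have h0 := Real.one_sub_sq_div_two_le_cos (x := p 0)
  have h1 := Real.one_sub_sq_div_two_le_cos (x := p 1)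
  linarith

/-- On the Brillouin zone 2(1 - cos t) ≥ 4t²/π², and π² ≤ 16. The bound needs |t| ≤ π. -/
lemma le_lapSymbol {γ : ℕ} {p : Plane} (hp : p ∈ box γ 0) : ‖p‖ ^ 2 / 4 ≤ lapSymbol p := by
  rw [lapSymbol, norm_sq_eq_add, Fin.sum_univ_two]
  have key : ∀ t : ℝ, |t| ≤ Real.pi → t ^ 2 / 4 ≤ 2 * (1 - Real.cos t) := by
    intro t ht
    have := Real.cos_le_one_sub_mul_cos_sq ht
    have hpi : (1 / 4 : ℝ) ≤ 4 / Real.pi ^ 2 := by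
      rw [div_le_div_iff₀ (by norm_num) (by positivity)]
      nlinarith [Real.pi_lt_four, Real.pi_pos]
    have e : 2 / Real.pi ^ 2 * t ^ 2 = 4 / Real.pi ^ 2 * t ^ 2 / 2 := by ring
    nlinarith [sq_nonneg t]
  have h0 := key (p 0) (by simpa using hp 0)
  have h1 := key (p 1) (by simpa using hp 1)
  linarith

lemma sub_lapSymbol_le (p : Plane) : ‖p‖ ^ 2 - lapSymbol p ≤ ‖p‖ ^ 4 := by
  have key : ∀ t : ℝ, t ^ 2 - 2 * (1 - Real.cos t) ≤ t ^ 4 := by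
    intro t
    by_cases ht : |t| ≤ 1
    · have := (abs_le.1 (Real.cos_bound ht)).2
      have e : |t| ^ 4 = t ^ 4 := by rw [show (4 : ℕ) = 2 * 2 by rfl, pow_mul, sq_abs, ← pow_mul]
      rw [e] at this
      nlinarith [sq_nonneg (t ^ 2)]
    · have h1 : 1 ≤ t ^ 2 := by
        rw [← sq_abs]; push Not at ht; nlinarith
      nlinarith [Real.cos_le_one t]
  have h0 := key (p 0)
  have h1 := key (p 1)
  have e : ‖p‖ ^ 4 = (p 0 ^ 2 + p 1 ^ 2) ^ 2 := by rw [← norm_sq_eq_add]; ring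
  rw [e, lapSymbol, norm_sq_eq_add, Fin.sum_univ_two]
  nlinarith [mul_nonneg (sq_nonneg (p 0)) (sq_nonneg (p 1))]

/-- The symbol of minus the Laplacian on the lattice of spacing `γ ^ (-h)`. -/
noncomputable def scaledLap (γ h : ℕ) (q : Plane) : ℝ :=
  ((γ : ℝ) ^ h) ^ 2 * lapSymbol (((γ : ℝ) ^ h)⁻¹ • q)

section

variable {γ : ℕ}

lemma continuous_scaledLap (γ h : ℕ) : Continuous (scaledLap γ h) := by
  have := continuous_lapSymbol
  unfold scaledLap; fun_prop

lemma norm_inv_smul (hγ : 1 < γ) (h : ℕ) (q : Plane) :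
    ‖((γ : ℝ) ^ h)⁻¹ • q‖ = ((γ : ℝ) ^ h)⁻¹ * ‖q‖ := by
  have : (0 : ℝ) < (γ : ℝ) ^ h := by positivity
  rw [norm_smul, Real.norm_of_nonneg (by positivity)]

lemma scaledLap_nonneg (γ h : ℕ) (q : Plane) : 0 ≤ scaledLap γ h q :=
  mul_nonneg (by positivity) (lapSymbol_nonneg _)

lemma scaledLap_le (hγ : 1 < γ) (h : ℕ) (q : Plane) : scaledLap γ h q ≤ ‖q‖ ^ 2 := by
  have : (0 : ℝ) < (γ : ℝ) ^ h := by positivity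
  have h1 := lapSymbol_le (((γ : ℝ) ^ h)⁻¹ • q)
  rw [norm_inv_smul hγ] at h1
  calc _ ≤ ((γ : ℝ) ^ h) ^ 2 * (((γ : ℝ) ^ h)⁻¹ * ‖q‖) ^ 2 := by unfold scaledLap; gcongr
    _ = _ := by field_simp

lemma le_scaledLap (hγ : 1 < γ) {h : ℕ} {q : Plane} (hq : q ∈ box γ h) :
    ‖q‖ ^ 2 / 4 ≤ scaledLap γ h q := by
  have : (0 : ℝ) < (γ : ℝ) ^ h := by positivity
  have h1 := le_lapSymbol ((inv_smul_mem_box_iff hγ).2 hq)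
  rw [norm_inv_smul hγ] at h1
  calc _ = ((γ : ℝ) ^ h) ^ 2 * ((((γ : ℝ) ^ h)⁻¹ * ‖q‖) ^ 2 / 4) := by field_simp
    _ ≤ _ := by unfold scaledLap; gcongr

lemma sub_scaledLap_le (hγ : 1 < γ) (h : ℕ) (q : Plane) :
    ‖q‖ ^ 2 - scaledLap γ h q ≤ (((γ : ℝ) ^ h) ^ 2)⁻¹ * ‖q‖ ^ 4 := by
  have : (0 : ℝ) < (γ : ℝ) ^ h := by positivity
  have h1 := sub_lapSymbol_le (((γ : ℝ) ^ h)⁻¹ • q)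
  rw [norm_inv_smul hγ] at h1
  unfold scaledLap
  calc _ = ((γ : ℝ) ^ h) ^ 2 * ((((γ : ℝ) ^ h)⁻¹ * ‖q‖) ^ 2 - lapSymbol (((γ : ℝ) ^ h)⁻¹ • q)) := by
        field_simp
    _ ≤ ((γ : ℝ) ^ h) ^ 2 * (((γ : ℝ) ^ h)⁻¹ * ‖q‖) ^ 4 := by gcongr
    _ = _ := by field_simp

lemma rate_pow_mul_rpow (hγ : 1 < γ) (h : ℕ) : rate γ ^ h * ((γ : ℝ) ^ h) ^ (1 / 4 : ℝ) = 1 := by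
  have hg : (0 : ℝ) < γ := by positivity
  rw [rate_pow, ← Real.rpow_natCast, ← Real.rpow_mul hg.le, ← Real.rpow_add hg]
  ring_nf
  simp

lemma one_le_rate_mul_of_notMem_box (hγ : 1 < γ) {h : ℕ} {q : Plane} (hq : q ∉ box γ h) :
    1 ≤ rate γ ^ h * ‖q‖ ^ (1 / 4 : ℝ) := by
  have := rate_pos hγ
  calc (1 : ℝ) = rate γ ^ h * ((γ : ℝ) ^ h) ^ (1 / 4 : ℝ) := (rate_pow_mul_rpow hγ h).symm
    _ ≤ _ := by gcongr; exact norm_le_of_notMem_box hq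

/-- A lattice kernel is compared with its continuum limit. -/
lemma abs_kernel_sub_le (hγ : 1 < γ) {h : ℕ} {X v : Plane → ℝ} {a : ℝ}
    (hX : ∀ q ∈ box γ h, |X q| ≤ a / (1 + ‖q‖ ^ 2)) (hv : ∀ q, |v q| ≤ a / (1 + ‖q‖ ^ 2))
    (hd : ∀ q ∈ box γ h, |X q - v q| ≤ a * rate γ ^ h * (‖q‖ ^ (1 / 4 : ℝ) / (1 + ‖q‖ ^ 2)))
    (q : Plane) :
    |(box γ h).indicator (fun q => X q / scaledLap γ h q) q - v q / ‖q‖ ^ 2|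
      ≤ 101 * a * rate γ ^ h * weight (-(7 / 4)) q := by
  have hr := rate_pos hγ
  have hg : (0 : ℝ) < (γ : ℝ) ^ h := by positivity
  have ha : 0 ≤ a := by
    have := (abs_nonneg _).trans (hv 0)
    simpa using this
  by_cases hq0 : q = 0
  · subst hq0
    have : (box γ h).indicator (fun q => X q / scaledLap γ h q) 0 = 0 := by
      have : scaledLap γ h 0 = 0 := by simp [scaledLap, lapSymbol]
      simp [indicator, this]
    rw [this]
    simp only [norm_zero, ne_eq, OfNat.ofNat_ne_zero, not_false_eq_true, zero_pow, div_zero,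
      sub_zero, abs_zero]
    have := weight_nonneg (-(7 / 4)) 0
    positivity
  have hn : 0 < ‖q‖ := norm_pos_iff.2 hq0
  have hw : ‖q‖ ^ (1 / 4 : ℝ) / (1 + ‖q‖ ^ 2) / ‖q‖ ^ 2 = weight (-(7 / 4)) q := by
    have : ‖q‖ ^ (-(7 / 4) : ℝ) = ‖q‖ ^ (1 / 4 : ℝ) / ‖q‖ ^ 2 := by
      rw [← Real.rpow_natCast, ← Real.rpow_sub hn]; norm_num
    rw [weight, this]; field_simp
  have hwn := weight_nonneg (-(7 / 4)) q
  by_cases hq : q ∈ box γ h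
  · rw [indicator_of_mem hq]
    have l1 := le_scaledLap hγ hq
    have l2 := scaledLap_le hγ h q
    have l3 := sub_scaledLap_le hγ h q
    set Λ := scaledLap γ h q
    have hΛ : 0 < Λ := lt_of_lt_of_le (by positivity) l1
    -- Two errors: the lattice symbol against |q|², and the numerator against its limit. They
    -- contribute 100 and 1 to the constant 101.
    have e : X q / Λ - v q / ‖q‖ ^ 2 =
        X q * ((‖q‖ ^ 2 - Λ) / (Λ * ‖q‖ ^ 2)) + (X q - v q) / ‖q‖ ^ 2 := by
      field_simp; ring
    have b1 : |X q * ((‖q‖ ^ 2 - Λ) / (Λ * ‖q‖ ^ 2))| ≤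
        100 * a * rate γ ^ h * weight (-(7 / 4)) q := by
      have d1 : (‖q‖ ^ 2 - Λ) / (Λ * ‖q‖ ^ 2) ≤ 4 * (((γ : ℝ) ^ h) ^ 2)⁻¹ := by
        rw [div_le_iff₀ (by positivity)]
        refine l3.trans ?_
        calc _ = 4 * (((γ : ℝ) ^ h) ^ 2)⁻¹ * (‖q‖ ^ 2 / 4 * ‖q‖ ^ 2) := by ring
          _ ≤ _ := by gcongr
      -- Inside the box |q| ≤ 5γ^h, so the discretization error γ^{-2h} can be traded for γ^{-h/4}
      -- |q|^{-7/4}, with 5^{7/4} ≤ 25.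
      have d2 : (((γ : ℝ) ^ h) ^ 2)⁻¹ ≤ 25 * rate γ ^ h * ‖q‖ ^ (-(7 / 4) : ℝ) := by
        have x1 : ‖q‖ ^ (7 / 4 : ℝ) ≤ 25 * ((γ : ℝ) ^ h) ^ (7 / 4 : ℝ) := by
          calc ‖q‖ ^ (7 / 4 : ℝ) ≤ (5 * (γ : ℝ) ^ h) ^ (7 / 4 : ℝ) := by
                gcongr; exact norm_le_of_mem_box hq
            _ = 5 ^ (7 / 4 : ℝ) * ((γ : ℝ) ^ h) ^ (7 / 4 : ℝ) :=
                Real.mul_rpow (by norm_num) hg.le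
            _ ≤ 5 ^ (2 : ℝ) * ((γ : ℝ) ^ h) ^ (7 / 4 : ℝ) := by
                gcongr <;> norm_num
            _ = _ := by norm_num
        rw [Real.rpow_neg hn.le, ← div_eq_mul_inv, le_div_iff₀ (by positivity)]
        calc _ ≤ (((γ : ℝ) ^ h) ^ 2)⁻¹ * (25 * ((γ : ℝ) ^ h) ^ (7 / 4 : ℝ)) := by gcongr
          _ = 25 * (((γ : ℝ) ^ h) ^ (7 / 4 : ℝ) / ((γ : ℝ) ^ h) ^ 2) := by ring
          _ = 25 * rate γ ^ h := by
            have : ((γ : ℝ) ^ h) ^ (7 / 4 : ℝ) / ((γ : ℝ) ^ h) ^ 2 = rate γ ^ h := by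
              rw [← Real.rpow_natCast ((γ : ℝ) ^ h) 2, ← Real.rpow_sub hg, rate_pow,
                ← Real.rpow_natCast, ← Real.rpow_mul (by positivity)]
              norm_num
              ring_nf
            rw [this]
      rw [abs_mul, abs_of_nonneg (div_nonneg (by linarith) (by positivity) :
        0 ≤ (‖q‖ ^ 2 - Λ) / (Λ * ‖q‖ ^ 2))]
      calc _ ≤ a / (1 + ‖q‖ ^ 2) * (4 * (25 * rate γ ^ h * ‖q‖ ^ (-(7 / 4) : ℝ))) := by
            gcongr
            · exact hX q hq
            · exact d1.trans (by gcongr)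
        _ = _ := by rw [weight]; ring
    have b2 : |(X q - v q) / ‖q‖ ^ 2| ≤ a * rate γ ^ h * weight (-(7 / 4)) q := by
      rw [abs_div, abs_of_pos (by positivity : 0 < ‖q‖ ^ 2), ← hw]
      calc _ ≤ a * rate γ ^ h * (‖q‖ ^ (1 / 4 : ℝ) / (1 + ‖q‖ ^ 2)) / ‖q‖ ^ 2 := by
            gcongr; exact hd q hq
        _ = _ := by ring
    rw [e]
    refine (abs_add_le _ _).trans ?_
    linarith
  · rw [indicator_of_notMem hq, zero_sub, abs_neg, abs_div, abs_of_pos (by positivity : 0 < ‖q‖ ^ 2)]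
    -- Outside the box only the continuum kernel is left; there |q| ≥ γ^h, so the factor
    -- γ^{-h/4}|q|^{1/4} ≥ 1 can be inserted for free.
    have o := one_le_rate_mul_of_notMem_box hγ hq
    calc |v q| / ‖q‖ ^ 2 ≤ a / (1 + ‖q‖ ^ 2) / ‖q‖ ^ 2 * 1 := by
          rw [mul_one]; gcongr; exact hv q
      _ ≤ a / (1 + ‖q‖ ^ 2) / ‖q‖ ^ 2 * (rate γ ^ h * ‖q‖ ^ (1 / 4 : ℝ)) := by gcongr
      _ = a * rate γ ^ h * weight (-(7 / 4)) q := by rw [← hw]; ring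
      _ ≤ _ := by
        have : 0 ≤ a * rate γ ^ h * weight (-(7 / 4)) q := by positivity
        linarith

end

namespace CutoffEstimates

variable {γ : ℕ} {A : ℕ → ℕ → Plane → ℂ} {u : Plane → ℝ} {C : ℝ}

lemma pos (H : CutoffEstimates γ A u C) : 0 < C := by linarith [H.one_le]

lemma norm_pow_smul (γ m : ℕ) (q : Plane) : ‖(γ : ℝ) ^ m • q‖ = (γ : ℝ) ^ m * ‖q‖ := by
  rw [norm_smul, Real.norm_of_nonneg (by positivity)]

lemma norm_le_smul (hγ : 1 < γ) (m : ℕ) (q : Plane) : ‖q‖ ≤ ‖(γ : ℝ) ^ m • q‖ := by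
  rw [norm_pow_smul]
  have : (1 : ℝ) ≤ (γ : ℝ) ^ m := one_le_pow₀ (by exact_mod_cast hγ.le)
  nlinarith [norm_nonneg q]

/-- The product γ^{-h/4}|q|^{1/4} is unchanged when h becomes h + m and q becomes γ^m q. Hence the
error bound is uniform in m, and no constant depends on the block size. -/
lemma dist_smul (H : CutoffEstimates γ A u C) (hγ : 1 < γ) {h : ℕ} (m : ℕ) {q : Plane}
    (hq : q ∈ box γ h) : |cutoff A (h + m) ((γ : ℝ) ^ m • q) - u ((γ : ℝ) ^ m • q)| ≤
      C * rate γ ^ h * (‖q‖ ^ (1 / 4 : ℝ) / (1 + ‖q‖ ^ 2)) := by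
  have hr := rate_pos hγ
  have hC := H.pos
  refine (H.dist (h + m) _ (smul_mem_box hq)).trans ?_
  have e : rate γ ^ (h + m) * ‖(γ : ℝ) ^ m • q‖ ^ (1 / 4 : ℝ) = rate γ ^ h * ‖q‖ ^ (1 / 4 : ℝ) := by
    rw [norm_pow_smul, Real.mul_rpow (by positivity) (by positivity), pow_add]
    have := rate_pow_mul_rpow hγ m
    linear_combination rate γ ^ h * ‖q‖ ^ (1 / 4 : ℝ) * this
  calc _ = C * (rate γ ^ (h + m) * ‖(γ : ℝ) ^ m • q‖ ^ (1 / 4 : ℝ)) /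
        (1 + ‖(γ : ℝ) ^ m • q‖ ^ 2) := by ring
    _ ≤ C * (rate γ ^ h * ‖q‖ ^ (1 / 4 : ℝ)) / (1 + ‖q‖ ^ 2) := by
      rw [e]; gcongr; exact norm_le_smul hγ m q
    _ = _ := by ring

lemma decay_smul (H : CutoffEstimates γ A u C) (hγ : 1 < γ) {h : ℕ} (m : ℕ) {q : Plane}
    (hq : q ∈ box γ h) : cutoff A (h + m) ((γ : ℝ) ^ m • q) ≤ C / (1 + ‖q‖ ^ 2) ^ 4 := by
  have hC := H.pos
  refine (H.decay (h + m) _ (smul_mem_box hq)).trans ?_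
  gcongr
  exact norm_le_smul hγ m q

lemma lim_decay_smul (H : CutoffEstimates γ A u C) (hγ : 1 < γ) (m : ℕ) (q : Plane) :
    u ((γ : ℝ) ^ m • q) ≤ C / (1 + ‖q‖ ^ 2) ^ 4 := by
  have hC := H.pos
  refine (H.lim_decay _).trans ?_
  gcongr
  exact norm_le_smul hγ m q

lemma div_pow_four_le (H : CutoffEstimates γ A u C) (q : Plane) :
    C / (1 + ‖q‖ ^ 2) ^ 4 ≤ C / (1 + ‖q‖ ^ 2) := by
  have hC := H.pos
  have h1 : 1 + ‖q‖ ^ 2 ≤ (1 + ‖q‖ ^ 2) ^ 4 := le_self_pow₀ (by nlinarith) (by norm_num)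
  gcongr

lemma div_pow_four_le_weight (H : CutoffEstimates γ A u C) {q : Plane} (hq : q ≠ 0) :
    C / (1 + ‖q‖ ^ 2) ^ 4 ≤ C * weight (-1) q := by
  have hC := H.pos
  have hn : 0 < ‖q‖ := norm_pos_iff.2 hq
  have h1 : (1 + ‖q‖ ^ 2) ^ 2 ≤ (1 + ‖q‖ ^ 2) ^ 4 :=
    pow_le_pow_right₀ (by nlinarith) (by norm_num)
  rw [weight, Real.rpow_neg_one, div_eq_mul_inv]
  gcongr
  rw [le_div_iff₀ (by positivity), ← div_eq_inv_mul, div_le_iff₀ (by positivity), ← div_eq_inv_mul,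
    le_div_iff₀ hn]
  nlinarith

/-- The function `F_h(q) - F_{h+m}(γ ^ m q)`. -/
noncomputable def increment (γ : ℕ) (A : ℕ → ℕ → Plane → ℂ) (h m : ℕ) (q : Plane) : ℝ :=
  cutoff A h q - cutoff A (h + m) ((γ : ℝ) ^ m • q)

lemma continuousOn_cutoff_smul (H : CutoffEstimates γ A u C) (h m : ℕ) :
    ContinuousOn (fun q => cutoff A (h + m) ((γ : ℝ) ^ m • q)) (box γ h) :=
  (H.continuousOn (h + m)).comp (by fun_prop) fun _ hq => smul_mem_box hq

lemma continuousOn_increment (H : CutoffEstimates γ A u C) (h m : ℕ) :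
    ContinuousOn (increment γ A h m) (box γ h) :=
  (H.continuousOn h).sub (H.continuousOn_cutoff_smul h m)

lemma abs_increment_le (H : CutoffEstimates γ A u C) (hγ : 1 < γ) {h : ℕ} (m : ℕ) {q : Plane}
    (hq : q ∈ box γ h) : |increment γ A h m q| ≤ C / (1 + ‖q‖ ^ 2) ^ 4 := by
  have h1 := H.decay h q hq
  have h2 := H.decay_smul hγ m hq
  have h3 := H.nonneg h q
  have h4 := H.nonneg (h + m) ((γ : ℝ) ^ m • q)
  rw [increment, abs_le]; constructor <;> linarith

lemma abs_lim_sub_le (H : CutoffEstimates γ A u C) (hγ : 1 < γ) (m : ℕ) (q : Plane) :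
    |u q - u ((γ : ℝ) ^ m • q)| ≤ C / (1 + ‖q‖ ^ 2) ^ 4 := by
  have h1 := H.lim_decay q
  have h2 := H.lim_decay_smul hγ m q
  have h3 := H.lim_nonneg q
  have h4 := H.lim_nonneg ((γ : ℝ) ^ m • q)
  rw [abs_le]; constructor <;> linarith

end CutoffEstimates

/-! ### Convergence of the rescaled slices. -/

/-- The Fourier transform of the rescaled slice. -/
noncomputable def sliceKernel (γ : ℕ) (A : ℕ → ℕ → Plane → ℂ) (h : ℕ) : Plane → ℝ :=
  (box γ h).indicator fun q => CutoffEstimates.increment γ A h 1 q / scaledLap γ h q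

/-- The Fourier transform of the limiting slice. -/
noncomputable def limitKernel (γ : ℕ) (u : Plane → ℝ) (q : Plane) : ℝ :=
  (u q - u ((γ : ℝ) • q)) / ‖q‖ ^ 2

/-- The covariance of the limiting slice. -/
noncomputable def limitCov (γ : ℕ) (u : Plane → ℝ) (x : Plane) : ℝ :=
  ((2 * Real.pi) ^ 2)⁻¹ * ∫ q, Real.cos (inner ℝ q x) * limitKernel γ u q

/-- The real part of the normalized continuum potential. -/
noncomputable def potential (u : Plane → ℝ) (x : Plane) : ℝ :=
  ((2 * Real.pi) ^ 2)⁻¹ * ∫ p, (Real.cos (inner ℝ p x) - 1) * (u p / ‖p‖ ^ 2)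

namespace CutoffEstimates

variable {γ : ℕ} {A : ℕ → ℕ → Plane → ℂ} {u : Plane → ℝ} {C : ℝ}

lemma abs_sliceKernel_sub_le (H : CutoffEstimates γ A u C) (hγ : 1 < γ) (h : ℕ) (q : Plane) :
    |sliceKernel γ A h q - limitKernel γ u q| ≤ 202 * C * rate γ ^ h * weight (-(7 / 4)) q := by
  have hC := H.pos
  have key := abs_kernel_sub_le hγ (h := h) (X := increment γ A h 1)
    (v := fun q => u q - u ((γ : ℝ) • q)) (a := 2 * C) (fun q hq => ?_) (fun q => ?_)
    (fun q hq => ?_) q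
  · refine key.trans_eq (by ring)
  · refine ((H.abs_increment_le hγ 1 hq).trans (H.div_pow_four_le q)).trans ?_
    gcongr; linarith
  · have := H.abs_lim_sub_le hγ 1 q
    rw [pow_one] at this
    refine (this.trans (H.div_pow_four_le q)).trans ?_
    gcongr; linarith
  · have h1 := H.dist h q hq
    have h2 := H.dist_smul hγ 1 hq
    rw [pow_one] at h2
    have e : increment γ A h 1 q - (u q - u ((γ : ℝ) • q)) =
        (cutoff A h q - u q) - (cutoff A (h + 1) ((γ : ℝ) • q) - u ((γ : ℝ) • q)) := by
      rw [increment, pow_one]; ring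
    rw [e]
    refine (abs_sub _ _).trans ?_
    linarith

lemma measurable_sliceKernel (H : CutoffEstimates γ A u C) (h : ℕ) :
    Measurable (sliceKernel γ A h) := by
  have e : sliceKernel γ A h = fun q =>
      (box γ h).indicator (increment γ A h 1) q / scaledLap γ h q := by
    ext q; by_cases hq : q ∈ box γ h <;> simp [sliceKernel, hq]
  rw [e]
  refine Measurable.div ?_ (continuous_scaledLap γ h).measurable
  classical
  rw [← piecewise_eq_indicator]
  exact (H.continuousOn_increment h 1).measurable_piecewise continuousOn_const
    (measurableSet_box γ h)

/-- Frullani for u, whose value at the origin is 1. This total mass is the source of the value ln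
γ/(2π) of the limiting slice at zero. -/
lemma limitKernel_spec (H : CutoffEstimates γ A u C) (hγ : 1 < γ) :
    Integrable (limitKernel γ u) ∧
      ∫ q, limitKernel γ u q = 2 * Real.pi * 1 * Real.log γ := by
  refine frullani (φ₀ := 1) (C := C) H.measurable (fun x => ?_) (fun x => ?_)
    (by exact_mod_cast hγ.le)
  · rw [abs_sub_comm]; exact H.lim_origin x
  · rw [abs_of_nonneg (H.lim_nonneg x)]
    exact (H.lim_decay x).trans (H.div_pow_four_le x)

lemma integrable_sliceKernel (H : CutoffEstimates γ A u C) (hγ : 1 < γ) (h : ℕ) :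
    Integrable (sliceKernel γ A h) := by
  have h1 : Integrable (fun q => sliceKernel γ A h q - limitKernel γ u q) :=
    Integrable.mono' ((integrable_weight (s := -(7 / 4)) (by norm_num) (by norm_num)).const_mul
      (202 * C * rate γ ^ h)) ((H.measurable_sliceKernel h).aestronglyMeasurable.sub
        (H.limitKernel_spec hγ).1.aestronglyMeasurable)
      (Eventually.of_forall fun q => H.abs_sliceKernel_sub_le hγ h q)
  exact (h1.add (H.limitKernel_spec hγ).1).congr (Eventually.of_forall fun q => by simp)

/-- In the box the lattice symbol is at least |q|²/4, so |q|² cancels the singularity and the decay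
of the numerator remains. This bounds the second moment needed for quadratic increments. -/
lemma abs_sliceKernel_mul_le (H : CutoffEstimates γ A u C) (hγ : 1 < γ) (h : ℕ) (q : Plane) :
    ‖q‖ ^ 2 * |sliceKernel γ A h q| ≤ 4 * C * weight (-1) q := by
  have hC := H.pos
  have hw := weight_nonneg (-1) q
  by_cases hq : q ∈ box γ h
  swap
  · rw [sliceKernel, indicator_of_notMem hq]; simp; positivity
  by_cases hq0 : q = 0
  · subst hq0; simp; positivity
  have hn : 0 < ‖q‖ := norm_pos_iff.2 hq0
  have h1 := (H.abs_increment_le hγ 1 hq).trans (H.div_pow_four_le_weight hq0)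
  have h2 := le_scaledLap hγ hq
  have h3 : 0 < scaledLap γ h q := lt_of_lt_of_le (by positivity) h2
  rw [sliceKernel, indicator_of_mem hq, abs_div, abs_of_pos h3, mul_div_assoc', div_le_iff₀ h3]
  calc _ ≤ ‖q‖ ^ 2 * (C * weight (-1) q) := by gcongr
    _ = 4 * C * weight (-1) q * (‖q‖ ^ 2 / 4) := by ring
    _ ≤ _ := by gcongr

lemma integrable_cos_mul {f : Plane → ℝ} (hf : Integrable f) (x : Plane) :
    Integrable fun q => Real.cos (inner ℝ q x) * f q :=
  hf.bdd_mul (c := 1) (Measurable.aestronglyMeasurable (by fun_prop))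
    (Eventually.of_forall fun q => by simpa using Real.abs_cos_le_one _)

/-- The momentum space representation of the slices on their own scale. -/
lemma sliceCov_re (H : CutoffEstimates γ A u C) (hγ : 1 < γ) (h : ℕ) (y : Site) :
    (sliceCov γ A h y).re = ((2 * Real.pi) ^ 2)⁻¹ *
      ∫ q, Real.cos (inner ℝ q (((γ : ℝ) ^ h)⁻¹ • toPlane y)) * sliceKernel γ A h q := by
  have hg : (0 : ℝ) < (γ : ℝ) ^ h := by positivity
  set f : Plane → ℝ := fun p => (cutoff A h ((γ : ℝ) ^ h • p) -
    cutoff A (h + 1) ((γ : ℝ) ^ (h + 1) • p)) / lapSymbol p with hf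
  -- Substitution q = γ^h p: the factor γ^{2h} turns the symbol into the one on spacing γ^{-h} and
  -- is also the two-dimensional Jacobian, so the covariance carries no power of the scale.
  have e1 : (box γ 0).indicator f = fun p => ((γ : ℝ) ^ h) ^ 2 * sliceKernel γ A h ((γ : ℝ) ^ h • p) := by
    ext p
    have hm : (γ : ℝ) ^ h • p ∈ box γ h ↔ p ∈ box γ 0 := by
      rw [← inv_smul_mem_box_iff hγ, inv_smul_smul₀ hg.ne']
    by_cases hp : p ∈ box γ 0
    · rw [indicator_of_mem hp, sliceKernel, indicator_of_mem (hm.2 hp), scaledLap,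
        inv_smul_smul₀ hg.ne', increment, hf, smul_smul, pow_one, ← pow_succ']
      field_simp
    · rw [indicator_of_notMem hp, sliceKernel, indicator_of_notMem (fun h' => hp (hm.1 h')), mul_zero]
  have hi : Integrable ((box γ 0).indicator f) := by
    rw [e1]
    exact ((H.integrable_sliceKernel hγ h).comp_smul hg.ne').const_mul _
  have hi' : IntegrableOn f (box γ 0) := (integrable_indicator_iff (measurableSet_box γ 0)).1 hi
  have hi2 : IntegrableOn (fun p => Complex.exp (Complex.I * (pair p y : ℂ)) * ((f p : ℝ) : ℂ))
      (box γ 0) := by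
    refine hi'.ofReal.bdd_mul (c := 1) ?_ (Eventually.of_forall fun q => ?_)
    · refine (Continuous.measurable ?_).aestronglyMeasurable
      unfold pair
      fun_prop
    · rw [mul_comm, Complex.norm_exp_ofReal_mul_I]
  have e2 : (sliceCov γ A h y).re = ((2 * Real.pi) ^ 2)⁻¹ *
      ∫ p in box γ 0, Real.cos (pair p y) * f p := by
    rw [sliceCov, ← Complex.ofReal_inv, Complex.re_ofReal_mul]
    congr 1
    have := integral_re hi2
    simp only [RCLike.re_to_complex] at this
    rw [← this]
    refine integral_congr_ae (Eventually.of_forall fun p => ?_)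
    simp only []
    rw [Complex.re_mul_ofReal, mul_comm Complex.I, Complex.exp_ofReal_mul_I_re]
  rw [e2]
  congr 1
  rw [← integral_indicator (measurableSet_box γ 0)]
  have e3 : ∀ p, (box γ 0).indicator (fun p => Real.cos (pair p y) * f p) p =
      ((γ : ℝ) ^ h) ^ 2 * ((fun q => Real.cos (inner ℝ q (((γ : ℝ) ^ h)⁻¹ • toPlane y)) *
        sliceKernel γ A h q) ((γ : ℝ) ^ h • p)) := by
    intro p
    have := congrFun e1 p
    simp only [] at this ⊢
    rw [indicator_mul_right (f := fun p => Real.cos (pair p y)), this, pair_eq_inner, real_inner_smul_left, real_inner_smul_right]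
    field_simp
  simp_rw [e3]
  rw [integral_const_mul, Measure.integral_comp_smul volume (fun q => Real.cos (inner ℝ q
    (((γ : ℝ) ^ h)⁻¹ • toPlane y)) * sliceKernel γ A h q), finrank_plane, abs_of_pos (by positivity),
    smul_eq_mul]
  field_simp

lemma abs_inner_smul_le (hγ : 1 < γ) (h : ℕ) (q x : Plane) :
    |inner ℝ q (((γ : ℝ) ^ h)⁻¹ • x)| ≤ ‖q‖ * (((γ : ℝ) ^ h)⁻¹ * ‖x‖) := by
  rw [← norm_inv_smul hγ]
  exact abs_real_inner_le_norm _ _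

lemma one_sub_cos_le_abs (t : ℝ) : 1 - Real.cos t ≤ |t| := by
  have := Real.one_sub_sq_div_two_le_cos (x := t)
  rcases le_or_gt |t| 2 with h | h
  · have : t ^ 2 ≤ 2 * |t| := by rw [← sq_abs]; nlinarith [abs_nonneg t]
    linarith
  · linarith [Real.neg_one_le_cos t]

lemma inv_four_pi_sq_le : ((2 * Real.pi) ^ 2)⁻¹ ≤ 1 :=
  inv_le_one_of_one_le₀ (by nlinarith [Real.pi_gt_three])

/-- Convergence of the slices. -/
lemma abs_sliceCov_sub_limitCov_le (H : CutoffEstimates γ A u C) (hγ : 1 < γ) (h : ℕ) (y : Site) :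
    |(sliceCov γ A h y).re - limitCov γ u (((γ : ℝ) ^ h)⁻¹ • toPlane y)| ≤
      (202 * C * ∫ q, weight (-(7 / 4)) q) * rate γ ^ h := by
  set x := ((γ : ℝ) ^ h)⁻¹ • toPlane y
  have hr := rate_pos hγ
  have hC := H.pos
  have i1 := integrable_cos_mul (H.integrable_sliceKernel hγ h) x
  have i2 := integrable_cos_mul (H.limitKernel_spec hγ).1 x
  rw [H.sliceCov_re hγ, limitCov, ← mul_sub, ← integral_sub i1 i2, abs_mul,
    abs_of_nonneg (by positivity)]
  have : |∫ q, (Real.cos (inner ℝ q x) * sliceKernel γ A h q - Real.cos (inner ℝ q x) *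
      limitKernel γ u q)| ≤ ∫ q, 202 * C * rate γ ^ h * weight (-(7 / 4)) q := by
    rw [← Real.norm_eq_abs]
    refine norm_integral_le_of_norm_le ((integrable_weight (s := -(7 / 4)) (by norm_num) (by norm_num)).const_mul _)
      (Eventually.of_forall fun q => ?_)
    rw [← mul_sub, norm_mul, ← one_mul (202 * C * rate γ ^ h * _)]
    gcongr
    · simpa using Real.abs_cos_le_one _
    · exact H.abs_sliceKernel_sub_le hγ h q
  rw [integral_const_mul] at this
  calc _ ≤ 1 * (202 * C * rate γ ^ h * ∫ q, weight (-(7 / 4)) q) := by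
        gcongr
        exact inv_four_pi_sq_le
    _ = _ := by ring

/-- Convergence of the increments of the slices. -/
lemma abs_sliceCov_increment_sub_le (H : CutoffEstimates γ A u C) (hγ : 1 < γ) (h : ℕ) (y : Site) :
    |((sliceCov γ A h 0).re - (sliceCov γ A h y).re) -
        (limitCov γ u 0 - limitCov γ u (((γ : ℝ) ^ h)⁻¹ • toPlane y))| ≤
      (202 * C * ∫ q, weight (-(3 / 4)) q) * rate γ ^ h * (((γ : ℝ) ^ h)⁻¹ * ‖toPlane y‖) := by
  set x := ((γ : ℝ) ^ h)⁻¹ • toPlane y with hx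
  have hr := rate_pos hγ
  have hC := H.pos
  have hg : (0 : ℝ) < (γ : ℝ) ^ h := by positivity
  have i1 := fun x => integrable_cos_mul (H.integrable_sliceKernel hγ h) x
  have i2 := fun x => integrable_cos_mul (H.limitKernel_spec hγ).1 x
  have e : ((sliceCov γ A h 0).re - (sliceCov γ A h y).re) - (limitCov γ u 0 - limitCov γ u x) =
      ((2 * Real.pi) ^ 2)⁻¹ * ∫ q, (1 - Real.cos (inner ℝ q x)) *
        (sliceKernel γ A h q - limitKernel γ u q) := by
    rw [H.sliceCov_re hγ, H.sliceCov_re hγ, limitCov, limitCov, ← hx, ← mul_sub, ← mul_sub,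
      ← mul_sub, ← integral_sub (i1 _) (i1 _), ← integral_sub (i2 _) (i2 _)]
    have j1 := (i1 (((γ : ℝ) ^ h)⁻¹ • toPlane 0)).sub (i1 x)
    have j2 := (i2 0).sub (i2 x)
    rw [← integral_sub (by exact j1) (by exact j2)]
    congr 1
    refine integral_congr_ae (Eventually.of_forall fun q => ?_)
    simp
    ring
  rw [e, abs_mul, abs_of_nonneg (by positivity)]
  have : |∫ q, (1 - Real.cos (inner ℝ q x)) * (sliceKernel γ A h q - limitKernel γ u q)| ≤
      ∫ q, 202 * C * rate γ ^ h * (((γ : ℝ) ^ h)⁻¹ * ‖toPlane y‖) * weight (-(3 / 4)) q := by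
    rw [← Real.norm_eq_abs]
    refine norm_integral_le_of_norm_le ((integrable_weight (s := -(3 / 4)) (by norm_num) (by norm_num)).const_mul _)
      (Eventually.of_forall fun q => ?_)
    rw [norm_mul]
    -- One power of |q| from 1 - cos lowers the singularity of the weight from -7/4 to -3/4, still
    -- inside the integrable range.
    have b1 : ‖1 - Real.cos (inner ℝ q x)‖ ≤ ‖q‖ * (((γ : ℝ) ^ h)⁻¹ * ‖toPlane y‖) := by
      rw [Real.norm_of_nonneg (by linarith [Real.cos_le_one (inner ℝ q x)])]
      exact (one_sub_cos_le_abs _).trans (abs_inner_smul_le hγ h q _)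
    have b2 := H.abs_sliceKernel_sub_le hγ h q
    calc _ ≤ (‖q‖ * (((γ : ℝ) ^ h)⁻¹ * ‖toPlane y‖)) * (202 * C * rate γ ^ h * weight (-(7 / 4)) q) := by
          gcongr; exact b2
      _ = 202 * C * rate γ ^ h * (((γ : ℝ) ^ h)⁻¹ * ‖toPlane y‖) * (‖q‖ * weight (-(7 / 4)) q) := by
          ring
      _ = _ := by
          by_cases hq : q = 0
          · subst hq; simp [weight]
          · have hn : 0 < ‖q‖ := norm_pos_iff.2 hq
            have : ‖q‖ * weight (-(7 / 4)) q = weight (-(3 / 4)) q := by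
              rw [weight, weight, mul_div_assoc']
              nth_rewrite 1 [← Real.rpow_one ‖q‖]
              rw [← Real.rpow_add hn]; norm_num
            rw [this]
  rw [integral_const_mul] at this
  calc _ ≤ 1 * (202 * C * rate γ ^ h * (((γ : ℝ) ^ h)⁻¹ * ‖toPlane y‖) * ∫ q, weight (-(3 / 4)) q) := by
        gcongr
        exact inv_four_pi_sq_le
    _ = _ := by ring

/-- Quadratic bound on the increments of the slices. -/
lemma abs_sliceCov_increment_le (H : CutoffEstimates γ A u C) (hγ : 1 < γ) (h : ℕ) (y : Site) :
    |(sliceCov γ A h 0).re - (sliceCov γ A h y).re| ≤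
      (4 * C * ∫ q, weight (-1) q) * (((γ : ℝ) ^ h)⁻¹ * ‖toPlane y‖) ^ 2 := by
  set x := ((γ : ℝ) ^ h)⁻¹ • toPlane y with hx
  have hC := H.pos
  have i1 := fun x => integrable_cos_mul (H.integrable_sliceKernel hγ h) x
  have e : (sliceCov γ A h 0).re - (sliceCov γ A h y).re =
      ((2 * Real.pi) ^ 2)⁻¹ * ∫ q, (1 - Real.cos (inner ℝ q x)) * sliceKernel γ A h q := by
    rw [H.sliceCov_re hγ, H.sliceCov_re hγ, ← hx, ← mul_sub, ← integral_sub (i1 _) (i1 _)]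
    congr 1
    refine integral_congr_ae (Eventually.of_forall fun q => ?_)
    simp
    ring
  rw [e, abs_mul, abs_of_nonneg (by positivity)]
  have : |∫ q, (1 - Real.cos (inner ℝ q x)) * sliceKernel γ A h q| ≤
      ∫ q, (((γ : ℝ) ^ h)⁻¹ * ‖toPlane y‖) ^ 2 * (4 * C) * weight (-1) q := by
    rw [← Real.norm_eq_abs]
    refine norm_integral_le_of_norm_le ((integrable_weight (s := -1) (by norm_num) (by norm_num)).const_mul _)
      (Eventually.of_forall fun q => ?_)
    rw [norm_mul]
    have b1 : ‖1 - Real.cos (inner ℝ q x)‖ ≤ (‖q‖ * (((γ : ℝ) ^ h)⁻¹ * ‖toPlane y‖)) ^ 2 := by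
      rw [Real.norm_of_nonneg (by linarith [Real.cos_le_one (inner ℝ q x)])]
      have := Real.one_sub_sq_div_two_le_cos (x := inner ℝ q x)
      have h2 := pow_le_pow_left₀ (abs_nonneg _) (abs_inner_smul_le hγ h q (toPlane y)) 2
      rw [sq_abs] at h2
      nlinarith [sq_nonneg (inner ℝ q x)]
    have b2 := H.abs_sliceKernel_mul_le hγ h q
    calc _ ≤ (‖q‖ * (((γ : ℝ) ^ h)⁻¹ * ‖toPlane y‖)) ^ 2 * |sliceKernel γ A h q| := by
          rw [Real.norm_eq_abs (sliceKernel γ A h q)]; gcongr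
      _ = (((γ : ℝ) ^ h)⁻¹ * ‖toPlane y‖) ^ 2 * (‖q‖ ^ 2 * |sliceKernel γ A h q|) := by
          ring
      _ ≤ (((γ : ℝ) ^ h)⁻¹ * ‖toPlane y‖) ^ 2 * (4 * C * weight (-1) q) := by gcongr
      _ = _ := by ring
  rw [integral_const_mul] at this
  calc _ ≤ 1 * ((((γ : ℝ) ^ h)⁻¹ * ‖toPlane y‖) ^ 2 * (4 * C) * ∫ q, weight (-1) q) := by
        gcongr
        exact inv_four_pi_sq_le
    _ = _ := by ring

end CutoffEstimates

end CoulombGas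

/-! ### The continuum potential and the limiting slice. -/

namespace CoulombGas

open MeasureTheory Filter Topology Set

namespace CutoffEstimates

variable {γ : ℕ} {A : ℕ → ℕ → Plane → ℂ} {u : Plane → ℝ} {C : ℝ}

lemma norm_mul_abs_div_le {f : Plane → ℝ} {C : ℝ} (hf : ∀ p, |f p| ≤ C / (1 + ‖p‖ ^ 2))
    (p : Plane) : ‖p‖ * |f p / ‖p‖ ^ 2| ≤ C * weight (-1) p := by
  by_cases hp : p = 0
  · subst hp; simp [weight]
  have hn : 0 < ‖p‖ := norm_pos_iff.2 hp
  rw [abs_div, abs_of_pos (by positivity : 0 < ‖p‖ ^ 2), weight, Real.rpow_neg_one]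
  calc _ = |f p| * ‖p‖⁻¹ := by field_simp
    _ ≤ C / (1 + ‖p‖ ^ 2) * ‖p‖⁻¹ := by gcongr; exact hf p
    _ = _ := by ring

lemma abs_lim_le (H : CutoffEstimates γ A u C) (p : Plane) : |u p| ≤ C / (1 + ‖p‖ ^ 2) := by
  rw [abs_of_nonneg (H.lim_nonneg p)]
  exact (H.lim_decay p).trans (H.div_pow_four_le p)

lemma integrable_potential (H : CutoffEstimates γ A u C) (x : Plane) :
    Integrable fun p => (Real.cos (inner ℝ p x) - 1) * (u p / ‖p‖ ^ 2) := by
  have hu := H.measurable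
  refine Integrable.mono' ((integrable_weight (s := -1) (by norm_num) (by norm_num)).const_mul
    (‖x‖ * C)) (Measurable.aestronglyMeasurable (by fun_prop)) (Eventually.of_forall fun p => ?_)
  rw [norm_mul, Real.norm_eq_abs, Real.norm_eq_abs, abs_sub_comm,
    abs_of_nonneg (by linarith [Real.cos_le_one (inner ℝ p x)])]
  have h1 := norm_mul_abs_div_le H.abs_lim_le p
  calc _ ≤ (‖p‖ * ‖x‖) * |u p / ‖p‖ ^ 2| := by
        gcongr
        exact (one_sub_cos_le_abs _).trans (abs_real_inner_le_norm p x)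
    _ = ‖x‖ * (‖p‖ * |u p / ‖p‖ ^ 2|) := by ring
    _ ≤ ‖x‖ * (C * weight (-1) p) := by gcongr
    _ = _ := by ring

lemma potential_nonpos (H : CutoffEstimates γ A u C) (x : Plane) : potential u x ≤ 0 := by
  refine mul_nonpos_of_nonneg_of_nonpos (by positivity) (integral_nonpos fun p => ?_)
  exact mul_nonpos_of_nonpos_of_nonneg (by linarith [Real.cos_le_one (inner ℝ p x)])
    (div_nonneg (H.lim_nonneg p) (by positivity))

lemma neg_potential_le (H : CutoffEstimates γ A u C) (x : Plane) :
    -potential u x ≤ (C * ∫ p, weight (-1) p) * ‖x‖ ^ 2 := by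
  have hC := H.pos
  rw [potential, ← mul_neg, ← integral_neg]
  have : ∫ p, -((Real.cos (inner ℝ p x) - 1) * (u p / ‖p‖ ^ 2)) ≤
      ∫ p, ‖x‖ ^ 2 * C * weight (-1) p := by
    refine integral_mono (H.integrable_potential x).neg ((integrable_weight (s := -1) (by norm_num)
      (by norm_num)).const_mul _) fun p => ?_
    simp only []
    by_cases hp : p = 0
    · subst hp
      have := weight_nonneg (-1) 0
      simp; positivity
    have hn : 0 < ‖p‖ := norm_pos_iff.2 hp
    have h1 := Real.one_sub_sq_div_two_le_cos (x := inner ℝ p x)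
    have h2 := pow_le_pow_left₀ (abs_nonneg _) (abs_real_inner_le_norm p x) 2
    rw [sq_abs] at h2
    have h3 := (H.lim_decay p).trans (H.div_pow_four_le_weight hp)
    have h4 : 0 ≤ u p / ‖p‖ ^ 2 := div_nonneg (H.lim_nonneg p) (by positivity)
    calc _ = (1 - Real.cos (inner ℝ p x)) * (u p / ‖p‖ ^ 2) := by ring
      _ ≤ (‖p‖ * ‖x‖) ^ 2 * (u p / ‖p‖ ^ 2) := by gcongr; nlinarith [sq_nonneg (inner ℝ p x)]
      _ = ‖x‖ ^ 2 * u p := by field_simp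
      _ ≤ ‖x‖ ^ 2 * (C * weight (-1) p) := by gcongr
      _ = _ := by ring
  rw [integral_const_mul] at this
  have h0 : 0 ≤ ∫ p, -((Real.cos (inner ℝ p x) - 1) * (u p / ‖p‖ ^ 2)) :=
    integral_nonneg fun p => by
      have : 0 ≤ u p / ‖p‖ ^ 2 := div_nonneg (H.lim_nonneg p) (by positivity)
      have := Real.cos_le_one (inner ℝ p x)
      simp only [Pi.zero_apply]
      nlinarith
  calc _ ≤ 1 * ∫ p, -((Real.cos (inner ℝ p x) - 1) * (u p / ‖p‖ ^ 2)) := by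
        gcongr; exact inv_four_pi_sq_le
    _ ≤ _ := by linarith

/-- The cosine is 1-Lipschitz, so the difference gains a factor |p|; then u(p)/|p| is integrable. -/
lemma abs_potential_sub_le (H : CutoffEstimates γ A u C) (x x' : Plane) :
    |potential u x - potential u x'| ≤ (C * ∫ p, weight (-1) p) * ‖x - x'‖ := by
  rw [potential, potential, ← mul_sub, ← integral_sub (H.integrable_potential x)
    (H.integrable_potential x'), abs_mul, abs_of_nonneg (by positivity)]
  have : |∫ p, ((Real.cos (inner ℝ p x) - 1) * (u p / ‖p‖ ^ 2) -
      (Real.cos (inner ℝ p x') - 1) * (u p / ‖p‖ ^ 2))| ≤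
      ∫ p, ‖x - x'‖ * C * weight (-1) p := by
    rw [← Real.norm_eq_abs]
    refine norm_integral_le_of_norm_le ((integrable_weight (s := -1) (by norm_num)
      (by norm_num)).const_mul _) (Eventually.of_forall fun p => ?_)
    have e : (Real.cos (inner ℝ p x) - 1) * (u p / ‖p‖ ^ 2) -
      (Real.cos (inner ℝ p x') - 1) * (u p / ‖p‖ ^ 2) =
      (Real.cos (inner ℝ p x) - Real.cos (inner ℝ p x')) * (u p / ‖p‖ ^ 2) := by ring
    rw [e, norm_mul, Real.norm_eq_abs, Real.norm_eq_abs]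
    have h1 : |Real.cos (inner ℝ p x) - Real.cos (inner ℝ p x')| ≤ ‖p‖ * ‖x - x'‖ := by
      refine (Real.abs_cos_sub_cos_le _ _).trans ?_
      rw [← inner_sub_right]
      exact abs_real_inner_le_norm _ _
    have h2 := norm_mul_abs_div_le H.abs_lim_le p
    calc _ ≤ (‖p‖ * ‖x - x'‖) * |u p / ‖p‖ ^ 2| := by gcongr
      _ = ‖x - x'‖ * (‖p‖ * |u p / ‖p‖ ^ 2|) := by ring
      _ ≤ ‖x - x'‖ * (C * weight (-1) p) := by gcongr
      _ = _ := by ring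
  rw [integral_const_mul] at this
  calc _ ≤ 1 * |∫ p, ((Real.cos (inner ℝ p x) - 1) * (u p / ‖p‖ ^ 2) -
      (Real.cos (inner ℝ p x') - 1) * (u p / ‖p‖ ^ 2))| := by
        gcongr; exact inv_four_pi_sq_le
    _ ≤ _ := by linarith

lemma limitCov_zero (H : CutoffEstimates γ A u C) (hγ : 1 < γ) :
    limitCov γ u 0 = Real.log γ / (2 * Real.pi) := by
  simp only [limitCov, inner_zero_right, Real.cos_zero, one_mul, (H.limitKernel_spec hγ).2]
  field_simp

/-- The limiting slice is the increment of the potential under a change of scale. -/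
lemma limitCov_eq (H : CutoffEstimates γ A u C) (hγ : 1 < γ) (x : Plane) :
    limitCov γ u x = potential u x - potential u ((γ : ℝ)⁻¹ • x) +
      Real.log γ / (2 * Real.pi) := by
  have hg : (0 : ℝ) < γ := by positivity
  -- Dilation invariance of dp/|p|² moves the scale from x into the cutoff. The two potentials then
  -- differ by an integral containing u(p) - u(γp).
  have e1 : potential u ((γ : ℝ)⁻¹ • x) = ((2 * Real.pi) ^ 2)⁻¹ *
      ∫ p, ((Real.cos (inner ℝ p x) - 1) * u ((γ : ℝ) • p)) / ‖p‖ ^ 2 := by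
    rw [potential]
    congr 1
    have := integral_dilation (fun p => (Real.cos (inner ℝ p ((γ : ℝ)⁻¹ • x)) - 1) * u p) hg
    simp only [mul_div_assoc'] at this ⊢
    rw [← this]
    refine integral_congr_ae (Eventually.of_forall fun p => ?_)
    simp only [real_inner_smul_left, real_inner_smul_right]
    rw [inv_mul_cancel_left₀ hg.ne']
  have i1 := integrable_dilation hg ((H.integrable_potential ((γ : ℝ)⁻¹ • x)).congr
    (Eventually.of_forall fun p => mul_div_assoc' _ _ _))
  simp only [real_inner_smul_left, real_inner_smul_right, inv_mul_cancel_left₀ hg.ne'] at i1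
  have i2 := integrable_cos_mul (H.limitKernel_spec hγ).1 x
  have i3 := (H.limitKernel_spec hγ).1
  have e2 : limitCov γ u x - limitCov γ u 0 = potential u x - potential u ((γ : ℝ)⁻¹ • x) := by
    rw [e1, potential, limitCov, limitCov, ← mul_sub, ← mul_sub, ← integral_sub i2
      (integrable_cos_mul i3 0), ← integral_sub (H.integrable_potential x) i1]
    congr 1
    refine integral_congr_ae (Eventually.of_forall fun p => ?_)
    simp [limitKernel]
    ring
  rw [H.limitCov_zero hγ] at e2
  linarith

lemma continuous_potential (H : CutoffEstimates γ A u C) : Continuous (potential u) := by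
  have : LipschitzWith (Real.toNNReal (C * ∫ p, weight (-1) p)) (potential u) := by
    refine LipschitzWith.of_dist_le_mul fun x y => ?_
    rw [Real.coe_toNNReal', Real.dist_eq, dist_eq_norm]
    exact (H.abs_potential_sub_le x y).trans (by gcongr; exact le_max_left _ _)
  exact this.continuous

lemma continuous_limitCov (H : CutoffEstimates γ A u C) (hγ : 1 < γ) :
    Continuous (limitCov γ u) := by
  have := H.continuous_potential
  rw [funext (H.limitCov_eq hγ)]
  fun_prop

/-- The limiting slice has finite range. -/
lemma limitCov_eq_zero (H : CutoffEstimates γ A u C) (hγ : 1 < γ)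
    (hfr : ∀ h x, (γ : ℝ) ^ (h + 1) / 2 < (maxLen x : ℝ) → sliceCov γ A h x = 0)
    {x : Plane} {i : Fin 2} (hx : (γ : ℝ) / 2 < |x i|) : limitCov γ u x = 0 := by
  have hg : (1 : ℝ) < γ := by exact_mod_cast hγ
  -- The sites nearest to γ^h x: after rescaling they converge to x, and eventually they lie beyond
  -- the range of the slice. The slice vanishes there while staying within O(γ^{-h/4}) of the limit.
  set y : ℕ → Site := fun h j => round ((γ : ℝ) ^ h * x j) with hy
  have hpow : Tendsto (fun h : ℕ => (γ : ℝ) ^ h) atTop atTop := tendsto_pow_atTop_atTop_of_one_lt hg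
  have hlim : Tendsto (fun h => ((γ : ℝ) ^ h)⁻¹ • toPlane (y h)) atTop (𝓝 x) := by
    have hc : ∀ j, Tendsto (fun h => ((γ : ℝ) ^ h)⁻¹ * (y h j : ℝ)) atTop (𝓝 (x j)) := by
      intro j
      rw [tendsto_iff_dist_tendsto_zero]
      refine squeeze_zero (fun _ => dist_nonneg) (fun h => ?_) (hpow.inv_tendsto_atTop)
      have hp : (0 : ℝ) < (γ : ℝ) ^ h := by positivity
      have h1 := abs_sub_round ((γ : ℝ) ^ h * x j)
      rw [Real.dist_eq, Pi.inv_apply]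
      have e : ((γ : ℝ) ^ h)⁻¹ * (y h j : ℝ) - x j =
          -(((γ : ℝ) ^ h)⁻¹ * ((γ : ℝ) ^ h * x j - (y h j : ℝ))) := by field_simp; ring
      rw [e, abs_neg, abs_mul, abs_of_pos (by positivity)]
      calc _ ≤ ((γ : ℝ) ^ h)⁻¹ * (1 / 2) := by gcongr
        _ ≤ _ := by
          have : 0 < ((γ : ℝ) ^ h)⁻¹ := by positivity
          linarith
    have h2 : Tendsto (fun h => (fun j => ((γ : ℝ) ^ h)⁻¹ * (y h j : ℝ))) atTop (𝓝 x.ofLp) :=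
      tendsto_pi_nhds.2 hc
    have h3 := ((PiLp.continuous_toLp 2 (fun _ : Fin 2 => ℝ)).tendsto x.ofLp).comp h2
    exact h3
  have hcov : Tendsto (fun h => limitCov γ u (((γ : ℝ) ^ h)⁻¹ • toPlane (y h))) atTop
      (𝓝 (limitCov γ u x)) := ((H.continuous_limitCov hγ).tendsto x).comp hlim
  refine tendsto_nhds_unique hcov ?_
  have hr0 := rate_pos hγ
  have hz : Tendsto (fun h => (202 * C * ∫ q, weight (-(7 / 4)) q) * rate γ ^ h) atTop (𝓝 0) := by
    simpa using (tendsto_pow_atTop_nhds_zero_of_lt_one hr0.le (rate_lt_one hγ)).const_mul _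
  refine squeeze_zero_norm' ?_ hz
  -- Once γ^h (|x_i| - γ/2) exceeds 1, the rounding error 1/2 cannot bring the site back into the
  -- range.
  filter_upwards [hpow.eventually_gt_atTop (1 / (|x i| - γ / 2))] with h hh
  have hd : 0 < |x i| - γ / 2 := by linarith
  have hp : (0 : ℝ) < (γ : ℝ) ^ h := by positivity
  have h1 := abs_sub_round ((γ : ℝ) ^ h * x i)
  rw [div_lt_iff₀ hd] at hh
  have hmax : (γ : ℝ) ^ (h + 1) / 2 < (maxLen (y h) : ℝ) := by
    have h2 : |(y h i : ℝ)| ≤ (maxLen (y h) : ℝ) := by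
      rw [maxLen, ← Int.cast_abs]
      fin_cases i <;> simp
    have h3 : |(γ : ℝ) ^ h * x i| ≤ |(y h i : ℝ)| + 1 / 2 := by
      have : (γ : ℝ) ^ h * x i = (y h i : ℝ) + ((γ : ℝ) ^ h * x i - (y h i : ℝ)) := by ring
      rw [this]
      exact (abs_add_le _ _).trans (by gcongr)
    rw [abs_mul, abs_of_pos hp] at h3
    rw [pow_succ]
    nlinarith
  have := H.abs_sliceCov_sub_limitCov_le hγ h (y h)
  rw [hfr h _ hmax] at this
  simpa using this

end CutoffEstimates

/-! ### Logarithmic asymptotics of the potential, by comparison with a Gaussian cutoff. -/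

lemma norm_potentialIntegrand_le {f : Plane → ℝ} {C : ℝ} (hf : ∀ p, |f p| ≤ C / (1 + ‖p‖ ^ 2))
    (x p : Plane) : ‖potentialIntegrand f x p‖ ≤ ‖x‖ * C * weight (-1) p := by
  rw [potentialIntegrand, norm_mul, Complex.norm_real, Real.norm_eq_abs]
  have h1 := CutoffEstimates.norm_mul_abs_div_le hf p
  calc _ ≤ (‖p‖ * ‖x‖) * |f p / ‖p‖ ^ 2| := by
        gcongr
        exact (Real.norm_exp_I_mul_ofReal_sub_one_le).trans (abs_real_inner_le_norm p x)
    _ = ‖x‖ * (‖p‖ * |f p / ‖p‖ ^ 2|) := by ring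
    _ ≤ ‖x‖ * (C * weight (-1) p) := by gcongr
    _ = _ := by ring

lemma integrable_potentialIntegrand {f : Plane → ℝ} {C : ℝ} (hm : Measurable f)
    (hf : ∀ p, |f p| ≤ C / (1 + ‖p‖ ^ 2)) (x : Plane) : Integrable (potentialIntegrand f x) :=
  Integrable.mono' ((integrable_weight (s := -1) (by norm_num) (by norm_num)).const_mul _)
    (Measurable.aestronglyMeasurable (by unfold potentialIntegrand; fun_prop))
    (Eventually.of_forall (norm_potentialIntegrand_le hf x))

/-- The Gaussian reference cutoff. -/
noncomputable def gaussianCutoff (p : Plane) : ℝ := Real.exp (-‖p‖ ^ 2)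

lemma gaussianCutoff_pos (p : Plane) : 0 < gaussianCutoff p := Real.exp_pos _

lemma abs_gaussianCutoff_le (p : Plane) : |gaussianCutoff p| ≤ 1 / (1 + ‖p‖ ^ 2) := by
  rw [gaussianCutoff, abs_of_pos (Real.exp_pos _), Real.exp_neg, one_div]
  gcongr
  linarith [Real.add_one_le_exp (‖p‖ ^ 2)]

lemma abs_one_sub_gaussianCutoff_le (p : Plane) : |1 - gaussianCutoff p| ≤ ‖p‖ := by
  have h1 : gaussianCutoff p ≤ 1 := Real.exp_le_one_iff.2 (by nlinarith)
  have h2 : 0 < gaussianCutoff p := Real.exp_pos _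
  have h3 := Real.add_one_le_exp (-‖p‖ ^ 2)
  rw [abs_of_nonneg (by linarith)]
  unfold gaussianCutoff at *
  rcases le_or_gt ‖p‖ 1 with h | h <;> nlinarith [norm_nonneg p]

/-- The Gaussian cutoff satisfies e^{-|p|²}/|p|² = ∫_1^∞ e^{-t|p|²} dt. At fixed t the momentum
integral is a difference of two Gaussian Fourier transforms. -/
lemma integral_gaussian_slice (x : Plane) {t : ℝ} (ht : 0 < t) :
    ∫ p : Plane, (Complex.exp (Complex.I * (inner ℝ p x : ℂ)) - 1) *
      ((Real.exp (-‖p‖ ^ 2 * t) : ℝ) : ℂ) =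
      (((-Real.pi) * ((1 - Real.exp (-(‖x‖ ^ 2 / 4) / t)) / t) : ℝ) : ℂ) := by
  have hb : 0 < (t : ℂ).re := by simpa
  have e : ∀ p : Plane, (Complex.exp (Complex.I * (inner ℝ p x : ℂ)) - 1) *
      ((Real.exp (-‖p‖ ^ 2 * t) : ℝ) : ℂ) = Complex.exp (-(t : ℂ) * ‖p‖ ^ 2 + Complex.I * inner ℝ x p)
        - Complex.exp (-(t : ℂ) * ‖p‖ ^ 2 + 0 * inner ℝ x p) := by
    intro p
    rw [Complex.exp_add, real_inner_comm]
    push_cast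
    ring_nf
  simp_rw [e]
  rw [integral_sub (GaussianFourier.integrable_cexp_neg_mul_sq_norm_add hb _ _)
    (GaussianFourier.integrable_cexp_neg_mul_sq_norm_add hb _ _),
    GaussianFourier.integral_cexp_neg_mul_sq_norm_add hb,
    GaussianFourier.integral_cexp_neg_mul_sq_norm_add hb, finrank_plane]
  simp only [Nat.cast_ofNat, ne_eq, OfNat.ofNat_ne_zero, not_false_eq_true, div_self,
    Complex.cpow_one, Complex.I_sq, zero_pow, zero_mul, zero_div, Complex.exp_zero]
  push_cast
  have : -1 * (‖x‖ : ℂ) ^ 2 / (4 * t) = -((‖x‖ : ℂ) ^ 2 / 4) / t := by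
    have : (t : ℂ) ≠ 0 := by exact_mod_cast ht.ne'
    field_simp
  rw [this]
  ring

lemma exp_inv_div_kernel_integrableOn {a : ℝ} (ha : 0 < a) :
    IntegrableOn (fun t : ℝ => (1 - Real.exp (-1 / t)) / t) (Ioi a) := by
  refine Integrable.mono' (integrableOn_Ioi_rpow_of_lt (a := -2) (by norm_num) ha)
    (Measurable.aestronglyMeasurable (by fun_prop)) ?_
  refine (ae_restrict_mem measurableSet_Ioi).mono fun t ht => ?_
  have ht0 : 0 < t := lt_trans ha ht
  have h1 := Real.add_one_le_exp (-1 / t)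
  have h2 : Real.exp (-1 / t) ≤ 1 := Real.exp_le_one_iff.2 (div_nonpos_of_nonpos_of_nonneg
    (by norm_num) ht0.le)
  rw [Real.norm_of_nonneg (div_nonneg (by linarith) ht0.le), Real.rpow_neg ht0.le]
  calc (1 - Real.exp (-1 / t)) / t ≤ (1 / t) / t := by
        gcongr
        have : -1 / t = -(1 / t) := by ring
        linarith
    _ = _ := by
      rw [show (2 : ℝ) = ((2 : ℕ) : ℝ) by norm_num, Real.rpow_natCast]; field_simp

/-- The logarithmic divergence of the Gaussian reference potential. -/
lemma exists_tendsto_gaussian_log :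
    ∃ c : ℝ, Tendsto (fun R : ℝ => (∫ t in Ioi (1 : ℝ), (1 - Real.exp (-R / t)) / t) - Real.log R)
      atTop (𝓝 c) := by
  set k : ℝ → ℝ := fun t => (1 - Real.exp (-1 / t)) / t with hk
  set m : ℝ → ℝ := fun t => Real.exp (-1 / t) / t with hm
  -- Near zero e^{-1/t} ≤ t, so e^{-1/t}/t is bounded and its integral from 1/R converges as R
  -- grows.
  have hmi : IntegrableOn m (uIcc 0 1) := by
    rw [uIcc_of_le zero_le_one, integrableOn_Icc_iff_integrableOn_Ioc]
    refine Measure.integrableOn_of_bounded (M := 1) (by simp)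
      (Measurable.aestronglyMeasurable (by fun_prop)) ?_
    refine (ae_restrict_mem measurableSet_Ioc).mono fun t ht => ?_
    have ht0 : 0 < t := ht.1
    have h1 := Real.add_one_le_exp (1 / t)
    have : -1 / t = -(1 / t) := by ring
    rw [hm, Real.norm_of_nonneg (by positivity)]
    simp only []
    rw [this, Real.exp_neg, div_le_one ht0]
    refine inv_le_of_inv_le₀ ht0 ?_
    rw [← one_div]; linarith
  have hcont := intervalIntegral.continuousOn_primitive_interval_left hmi
  refine ⟨(∫ t in Ioi (1 : ℝ), k t) - ∫ t in (0 : ℝ)..1, m t, ?_⟩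
  have hlim : Tendsto (fun R : ℝ => ∫ t in R⁻¹..1, m t) atTop (𝓝 (∫ t in (0 : ℝ)..1, m t)) := by
    have h0 := hcont 0 (by simp)
    refine h0.tendsto.comp (tendsto_nhdsWithin_iff.2 ⟨tendsto_inv_atTop_zero, ?_⟩)
    filter_upwards [eventually_ge_atTop 1] with R hR
    rw [uIcc_of_le zero_le_one]
    exact ⟨by positivity, inv_le_one_of_one_le₀ hR⟩
  refine (hlim.const_sub (∫ t in Ioi (1 : ℝ), k t)).congr' ?_
  filter_upwards [eventually_ge_atTop 1] with R hR
  have hR0 : 0 < R := by linarith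
  have hRi : R⁻¹ ≤ 1 := inv_le_one_of_one_le₀ hR
  -- Scaling t by R moves the lower limit to 1/R. On (1/R, 1) the integrand is 1/t minus a bounded
  -- function, and 1/t contributes ln R.
  have e1 : ∫ t in Ioi (1 : ℝ), (1 - Real.exp (-R / t)) / t = ∫ t in Ioi R⁻¹, k t := by
    have := integral_comp_mul_left_Ioi (fun t => (1 - Real.exp (-R / t)) / t) R⁻¹ hR0
    rw [mul_inv_cancel₀ hR0.ne', smul_eq_mul] at this
    have h2 : ∀ t, (1 - Real.exp (-R / (R * t))) / (R * t) = R⁻¹ * k t := by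
      intro t
      have : -R / (R * t) = -1 / t := by
        rw [neg_div, neg_div, div_mul_cancel_left₀ hR0.ne', one_div]
      rw [this, hk]
      simp only []
      rw [mul_comm R t, ← div_div]; ring
    simp_rw [h2] at this
    rw [integral_const_mul] at this
    exact (mul_left_cancel₀ (inv_ne_zero hR0.ne') this).symm
  have e2 := intervalIntegral.integral_Ioi_sub_Ioi
    (exp_inv_div_kernel_integrableOn (inv_pos.2 hR0)) hRi
  have hmi' : IntervalIntegrable m volume R⁻¹ 1 := by
    rw [intervalIntegrable_iff_integrableOn_Ioc_of_le hRi]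
    refine hmi.mono_set ?_
    rw [uIcc_of_le zero_le_one]
    exact fun t ht => ⟨(lt_trans (inv_pos.2 hR0) ht.1).le, ht.2⟩
  have hinv : IntervalIntegrable (fun t : ℝ => t⁻¹) volume R⁻¹ 1 := by
    apply intervalIntegral.intervalIntegrable_inv (f := fun r => r)
    · intro r hr
      rw [uIcc_of_le hRi] at hr
      exact (lt_of_lt_of_le (by positivity) hr.1).ne'
    · fun_prop
  have e3 : ∫ t in R⁻¹..1, k t = Real.log R - ∫ t in R⁻¹..1, m t := by
    have : ∀ t, k t = t⁻¹ - m t := fun t => by rw [hk, hm]; ring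
    simp_rw [this]
    rw [intervalIntegral.integral_sub hinv hmi', integral_inv_of_pos (by positivity) one_pos]
    simp
  rw [e1]
  linarith

/-- The Gaussian reference potential in closed form. -/
lemma integral_potentialIntegrand_gaussian (x : Plane) :
    ∫ p, potentialIntegrand gaussianCutoff x p =
      (((-Real.pi) * ∫ t in Ioi (1 : ℝ), (1 - Real.exp (-(‖x‖ ^ 2 / 4) / t)) / t : ℝ) : ℂ) := by
  -- The integrand before integration over t. Fubini applies because integrating its modulus over t
  -- gives the modulus of the potential integrand.
  set F : Plane → ℝ → ℂ := fun p t => (Complex.exp (Complex.I * (inner ℝ p x : ℂ)) - 1) *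
      ((Real.exp (-‖p‖ ^ 2 * t) : ℝ) : ℂ) with hF
  have hexp : ∀ p : Plane, p ≠ 0 → ∫ t in Ioi (1 : ℝ), Real.exp (-‖p‖ ^ 2 * t) =
      gaussianCutoff p / ‖p‖ ^ 2 := by
    intro p hp
    have : 0 < ‖p‖ := norm_pos_iff.2 hp
    rw [integral_exp_mul_Ioi (by nlinarith), gaussianCutoff, mul_one, neg_div_neg_eq]
  have hne : ∀ᵐ p : Plane, p ≠ 0 := by
    simp [ae_iff, measure_singleton]
  have hinner : ∀ᵐ p : Plane, ∫ t in Ioi (1 : ℝ), F p t = potentialIntegrand gaussianCutoff x p := by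
    filter_upwards [hne] with p hp
    rw [hF]
    simp only []
    rw [integral_const_mul, integral_complex_ofReal, hexp p hp, potentialIntegrand]
  have hFm : Measurable (Function.uncurry F) := by
    rw [hF]; unfold Function.uncurry; fun_prop
  have hint : Integrable (Function.uncurry F) (volume.prod (volume.restrict (Ioi (1 : ℝ)))) := by
    rw [integrable_prod_iff hFm.aestronglyMeasurable]
    constructor
    · filter_upwards [hne] with p hp
      have : 0 < ‖p‖ := norm_pos_iff.2 hp
      have hi := (integrableOn_exp_mul_Ioi (a := -‖p‖ ^ 2) (by nlinarith) 1).ofReal (𝕜 := ℂ)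
      exact hi.const_mul (Complex.exp (Complex.I * (inner ℝ p x : ℂ)) - 1)
    · refine (integrable_potentialIntegrand (f := gaussianCutoff)
        (by unfold gaussianCutoff; fun_prop) abs_gaussianCutoff_le x).norm.congr ?_
      filter_upwards [hne] with p hp
      simp only [Function.uncurry, hF, norm_mul, Complex.norm_real, Real.norm_eq_abs, Real.abs_exp]
      rw [integral_const_mul, hexp p hp, potentialIntegrand, norm_mul, Complex.norm_real,
        Real.norm_of_nonneg (div_nonneg (gaussianCutoff_pos p).le (by positivity))]
  calc _ = ∫ p, ∫ t in Ioi (1 : ℝ), F p t := (integral_congr_ae hinner).symm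
    _ = ∫ t in Ioi (1 : ℝ), ∫ p, F p t := integral_integral_swap hint
    _ = ∫ t in Ioi (1 : ℝ), (((-Real.pi) * ((1 - Real.exp (-(‖x‖ ^ 2 / 4) / t)) / t) : ℝ) : ℂ) :=
      setIntegral_congr_fun measurableSet_Ioi fun t ht =>
        integral_gaussian_slice x (lt_trans one_pos ht)
    _ = _ := by rw [integral_complex_ofReal, integral_const_mul]

/-- The normalized potential has a constant. -/
theorem exists_isPotentialConstant {u : Plane → ℝ} {C : ℝ} (hm : Measurable u)
    (h0 : ∀ p, |1 - u p| ≤ C * ‖p‖) (h1 : ∀ p, |u p| ≤ C / (1 + ‖p‖ ^ 2)) :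
    ∃ c, IsPotentialConstant u c := by
  have hC : 0 ≤ C := by
    have := (abs_nonneg _).trans (h1 0)
    simpa using this
  set e := gaussianCutoff with he
  have hem : Measurable e := by rw [he]; unfold gaussianCutoff; fun_prop
  -- Both cutoffs are 1 + O(|p|) at the origin, so their difference over |p|² is integrable. Its
  -- oscillating part tends to zero by Riemann–Lebesgue and -∫ d enters the constant.
  set d : Plane → ℝ := fun p => (u p - e p) / ‖p‖ ^ 2 with hd
  have hdm : Measurable d := by rw [hd]; fun_prop
  have hdi : Integrable d := by
    refine Integrable.mono' ((integrable_weight (s := -1) (by norm_num) (by norm_num)).const_mul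
      (2 * (C + 1))) hdm.aestronglyMeasurable (Eventually.of_forall fun p => ?_)
    by_cases hp : p = 0
    · subst hp; simp [weight, hd]
    have hn : 0 < ‖p‖ := norm_pos_iff.2 hp
    have a0 : |u p - e p| ≤ (C + 1) * ‖p‖ := by
      have := abs_one_sub_gaussianCutoff_le p
      have e' : u p - e p = (1 - e p) - (1 - u p) := by ring
      rw [e']
      exact (abs_sub _ _).trans (by linarith [h0 p])
    have a1 : |u p - e p| ≤ (C + 1) / (1 + ‖p‖ ^ 2) := by
      have := abs_gaussianCutoff_le p
      refine (abs_sub _ _).trans ?_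
      rw [add_div]
      exact add_le_add (h1 p) this
    rw [hd, Real.norm_eq_abs, abs_div, abs_of_pos (by positivity : 0 < ‖p‖ ^ 2), weight,
      Real.rpow_neg_one]
    have key : |u p - e p| ≤ 2 * (C + 1) * (‖p‖ / (1 + ‖p‖ ^ 2)) := by
      rcases le_or_gt ‖p‖ 1 with h | h
      · refine a0.trans ?_
        rw [mul_div_assoc', le_div_iff₀ (by positivity)]
        have : 0 ≤ (C + 1) * ‖p‖ := by positivity
        have : ‖p‖ ^ 2 ≤ 1 := pow_le_one₀ hn.le h
        nlinarith
      · refine a1.trans ?_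
        rw [mul_div_assoc']
        gcongr
        nlinarith
    calc |u p - e p| / ‖p‖ ^ 2 ≤ 2 * (C + 1) * (‖p‖ / (1 + ‖p‖ ^ 2)) / ‖p‖ ^ 2 := by gcongr
      _ = 2 * (C + 1) * (‖p‖⁻¹ / (1 + ‖p‖ ^ 2)) := by field_simp
  obtain ⟨c₁, hc₁⟩ := exists_tendsto_gaussian_log
  -- The Gaussian part has R = |x|²/4 and prefactor (2π)^{-2}(-π) = -1/(4π). Hence ln R gives
  -- -ln|x|/(2π) together with ln 4/(4π).
  refine ⟨(4 * Real.pi)⁻¹ * (Real.log 4 - c₁) - ((2 * Real.pi) ^ 2)⁻¹ * ∫ p, d p,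
    integrable_potentialIntegrand hm h1, ?_⟩
  have rl : Tendsto (fun x : Plane => ∫ p, Complex.exp (Complex.I * (inner ℝ p x : ℂ)) * ((d p : ℝ) : ℂ))
      (cocompact Plane) (𝓝 0) := by
    have h := tendsto_integral_exp_inner_smul_cocompact (fun p : Plane => ((d p : ℝ) : ℂ))
    -- `Real.fourierChar` carries 2π in its phase and the transform carries a minus sign, so x is
    -- rescaled by -1/(2π).
    have hne : (-(2 * Real.pi)⁻¹ : ℝ) ≠ 0 := by
      have := Real.pi_pos
      simp [Real.pi_ne_zero]
    have hs : Tendsto (fun x : Plane => (-(2 * Real.pi)⁻¹ : ℝ) • x) (cocompact Plane)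
        (cocompact Plane) := (Homeomorph.smulOfNeZero _ hne).isClosedEmbedding.tendsto_cocompact
    refine (h.comp hs).congr fun x => integral_congr_ae (Eventually.of_forall fun p => ?_)
    simp only [Circle.smul_def, Real.fourierChar_apply, smul_eq_mul, real_inner_smul_right]
    congr 2
    push_cast
    have : (Real.pi : ℂ) ≠ 0 := by exact_mod_cast Real.pi_ne_zero
    field_simp
  have key : ∀ x, ∫ p, potentialIntegrand u x p = (∫ p, potentialIntegrand e x p) +
      ((∫ p, Complex.exp (Complex.I * (inner ℝ p x : ℂ)) * ((d p : ℝ) : ℂ)) - ((∫ p, d p : ℝ) : ℂ)) := by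
    intro x
    have i1 : Integrable fun p => Complex.exp (Complex.I * (inner ℝ p x : ℂ)) * ((d p : ℝ) : ℂ) := by
      refine hdi.ofReal.bdd_mul (c := 1) (Measurable.aestronglyMeasurable (by fun_prop))
        (Eventually.of_forall fun q => ?_)
      rw [mul_comm, Complex.norm_exp_ofReal_mul_I]
    have i2 := integrable_potentialIntegrand hem abs_gaussianCutoff_le x
    have i3 : Integrable fun p => ((d p : ℝ) : ℂ) := hdi.ofReal
    have i4 := i1.sub i3
    rw [← integral_complex_ofReal, ← integral_sub i1 i3, ← integral_add i2 (by exact i4)]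
    refine integral_congr_ae (Eventually.of_forall fun p => ?_)
    simp only [potentialIntegrand, hd]
    push_cast
    ring
  have hnorm : Tendsto (fun x : Plane => ‖x‖ ^ 2 / 4) (cocompact Plane) atTop :=
    ((tendsto_pow_atTop two_ne_zero).comp (tendsto_norm_cocompact_atTop)).atTop_div_const (by norm_num)
  have g1 := (hc₁.comp hnorm).const_mul (-(4 * Real.pi)⁻¹)
  have g2 : Tendsto (fun x : Plane => ((-(4 * Real.pi)⁻¹ * (((∫ t in Ioi (1 : ℝ),
      (1 - Real.exp (-(‖x‖ ^ 2 / 4) / t)) / t)) - Real.log (‖x‖ ^ 2 / 4)) + (4 * Real.pi)⁻¹ * Real.log 4 : ℝ) : ℂ))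
      (cocompact Plane) (𝓝 ((-(4 * Real.pi)⁻¹ * c₁ + (4 * Real.pi)⁻¹ * Real.log 4 : ℝ) : ℂ)) :=
    (Complex.continuous_ofReal.tendsto _).comp (g1.add_const _)
  have g3 := g2.add ((rl.sub_const ((∫ p, d p : ℝ) : ℂ)).const_mul ((((2 * Real.pi) ^ 2 : ℝ) : ℂ)⁻¹))
  refine (g3.congr' ?_).trans_eq ?_
  · have hne : ∀ᶠ x : Plane in cocompact Plane, 0 < ‖x‖ :=
      tendsto_norm_cocompact_atTop.eventually_gt_atTop 0
    filter_upwards [hne] with x hx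
    rw [key, he, integral_potentialIntegrand_gaussian, mul_add, add_right_comm]
    congr 1
    rw [Real.log_div (by positivity) (by norm_num), Real.log_pow]
    rw [← Complex.ofReal_inv, ← Complex.ofReal_mul, ← Complex.ofReal_add]
    congr 1
    push_cast
    field_simp
    ring
  · congr 1
    push_cast
    ring

end CoulombGas

/-! ### Scale profiles: blocks of slices, exact logarithm and neutral profile. -/

namespace CoulombGas

open MeasureTheory Filter Topology Set

/-- The continuum slice attached to a potential `V` and the scale factor `γ`. -/
noncomputable def sliceProfile (γ : ℕ) (V : Plane → ℝ) (x : Plane) : ℝ :=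
  V x - V ((γ : ℝ)⁻¹ • x) + Real.log γ / (2 * Real.pi)

/-- A sequence of lattice covariances on the scales `γ ^ h`, asymptotic to the increments of a
continuum logarithmic potential `V` with constant `κ`. -/
structure ScaleProfile (γ : ℕ) (c : ℕ → Site → ℝ) (V : Plane → ℝ) (κ K : ℝ) : Prop where
  nonneg : 0 ≤ K
  range : ∀ h y, (∃ i, (γ : ℝ) ^ (h + 1) / 2 < |(y i : ℝ)|) → c h y = 0
  approx : ∀ h y, |c h y - sliceProfile γ V (((γ : ℝ) ^ h)⁻¹ • toPlane y)| ≤ K * rate γ ^ h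
  approx_incr : ∀ h y, |(c h 0 - c h y) - (sliceProfile γ V 0 -
    sliceProfile γ V (((γ : ℝ) ^ h)⁻¹ • toPlane y))| ≤
      K * rate γ ^ h * (((γ : ℝ) ^ h)⁻¹ * ‖toPlane y‖)
  quad : ∀ h y, |c h 0 - c h y| ≤ K * (((γ : ℝ) ^ h)⁻¹ * ‖toPlane y‖) ^ 2
  pot_zero : V 0 = 0
  pot_nonpos : ∀ x, V x ≤ 0
  pot_quad : ∀ x, -V x ≤ K * ‖x‖ ^ 2
  pot_lipschitz : ∀ x x', |V x - V x'| ≤ K * ‖x - x'‖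
  profile_range : ∀ x : Plane, (∃ i, (γ : ℝ) / 2 < |x i|) → sliceProfile γ V x = 0
  pot_log : Tendsto (fun x => V x + Real.log ‖x‖ / (2 * Real.pi)) (cocompact Plane) (𝓝 κ)

lemma rate_pow_cast (γ M : ℕ) : rate (γ ^ M) = rate γ ^ M := by
  rw [rate_pow, rate, Nat.cast_pow, ← Real.rpow_natCast, ← Real.rpow_mul (by positivity)]
  ring_nf

/-- The sum of `M` consecutive slices. -/
noncomputable def blockSum (M : ℕ) (c : ℕ → Site → ℝ) (j : ℕ) (y : Site) : ℝ :=
  ∑ m ∈ Finset.range M, c (j * M + m) y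

/-- The potentials at consecutive scales telescope, and the M constants ln γ add up to ln γ^M. -/
lemma sum_sliceProfile {γ : ℕ} (hγ : 1 < γ) (V : Plane → ℝ) (x : Plane) (M : ℕ) :
    ∑ m ∈ Finset.range M, sliceProfile γ V (((γ : ℝ) ^ m)⁻¹ • x) = sliceProfile (γ ^ M) V x := by
  have hg : (0 : ℝ) < γ := by positivity
  have : ∀ m, sliceProfile γ V (((γ : ℝ) ^ m)⁻¹ • x) =
      (V (((γ : ℝ) ^ m)⁻¹ • x) - V (((γ : ℝ) ^ (m + 1))⁻¹ • x)) + Real.log γ / (2 * Real.pi) := by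
    intro m
    rw [sliceProfile, smul_smul, pow_succ', mul_inv]
  simp_rw [this]
  rw [Finset.sum_add_distrib, Finset.sum_range_sub', sliceProfile]
  simp [Real.log_pow]
  ring

lemma sum_le_geometric {f : ℕ → ℝ} {a r : ℝ} (h0 : 0 ≤ r) (h1 : r < 1) (ha : 0 ≤ a) (n : ℕ)
    (hf : ∀ m < n, |f m| ≤ a * r ^ m) : |∑ m ∈ Finset.range n, f m| ≤ a * (1 - r)⁻¹ := by
  refine (Finset.abs_sum_le_sum_abs _ _).trans ((Finset.sum_le_sum fun m hm =>
    hf m (by simpa using hm)).trans ?_)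
  rw [← Finset.mul_sum]
  gcongr
  exact sum_geometric_le h0 h1 n

namespace ScaleProfile

variable {γ : ℕ} {c : ℕ → Site → ℝ} {V : Plane → ℝ} {κ K : ℝ}

/-- Blocks of slices form a scale profile with a constant which does not depend on the block
size. -/
lemma block (P : ScaleProfile γ c V κ K) (hγ : 1 < γ) (M : ℕ) :
    ScaleProfile (γ ^ M) (blockSum M c) V κ (K * (1 - rate γ)⁻¹) := by
  have hg : (1 : ℝ) < γ := by exact_mod_cast hγ
  have hg0 : (0 : ℝ) < γ := by linarith
  have hK := P.nonneg
  have hr0 := rate_pos hγ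
  have hr1 := rate_lt_one hγ
  have hr : 0 < 1 - rate γ := by linarith
  have h1 : 1 ≤ (1 - rate γ)⁻¹ := by
    rw [one_le_inv₀ hr]; linarith
  have hKK : K ≤ K * (1 - rate γ)⁻¹ := le_mul_of_one_le_right hK h1
  have hp : ∀ j m : ℕ, (((γ : ℝ) ^ (j * M + m))⁻¹ : ℝ) = ((γ : ℝ) ^ m)⁻¹ * (((γ ^ M : ℕ) : ℝ) ^ j)⁻¹ := by
    intro j m
    push_cast
    rw [← mul_inv, ← pow_mul, ← pow_add, mul_comm j M, add_comm]
  -- The error of slice m in a block is that of the block times the m-th power of the rate of γ. The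
  -- sum over m is at most (1 - rate γ)⁻¹ for every M.
  have hrate : ∀ j m : ℕ, rate γ ^ (j * M + m) = rate (γ ^ M) ^ j * rate γ ^ m := by
    intro j m
    rw [rate_pow_cast, ← pow_mul, ← pow_add, mul_comm j M]
  have hsmall : ∀ j m : ℕ, ((γ : ℝ) ^ (j * M + m))⁻¹ ≤ (((γ ^ M : ℕ) : ℝ) ^ j)⁻¹ := by
    intro j m
    rw [hp]
    refine mul_le_of_le_one_left (by positivity) (inv_le_one_of_one_le₀ (one_le_pow₀ hg.le))
  refine ⟨by positivity, ?_, ?_, ?_, ?_, P.pot_zero, P.pot_nonpos, ?_, ?_, ?_, P.pot_log⟩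
  · rintro j y ⟨i, hi⟩
    refine Finset.sum_eq_zero fun m hm => P.range _ _ ⟨i, lt_of_le_of_lt ?_ hi⟩
    push_cast
    rw [← pow_mul]
    gcongr
    · exact hg.le
    · have : m < M := by simpa using hm
      nlinarith
  · intro j y
    rw [blockSum, ← sum_sliceProfile hγ, ← Finset.sum_sub_distrib]
    refine (sum_le_geometric (a := K * rate (γ ^ M) ^ j) hr0.le hr1 ?_ M fun m _ => ?_).trans_eq (by ring)
    · rw [rate_pow_cast]; positivity
    · rw [smul_smul, ← hp]
      exact (P.approx _ _).trans_eq (by rw [hrate]; ring)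
  · intro j y
    rw [blockSum, blockSum, ← sum_sliceProfile hγ, ← sum_sliceProfile hγ, ← Finset.sum_sub_distrib,
      ← Finset.sum_sub_distrib, ← Finset.sum_sub_distrib]
    refine (sum_le_geometric (a := K * rate (γ ^ M) ^ j * ((((γ ^ M : ℕ) : ℝ) ^ j)⁻¹ * ‖toPlane y‖))
      hr0.le hr1 ?_ M fun m _ => ?_).trans_eq (by ring)
    · rw [rate_pow_cast]; positivity
    · rw [smul_smul, ← hp, smul_zero]
      refine (P.approx_incr _ _).trans ?_
      rw [hrate, rate_pow_cast]
      have := hsmall j m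
      calc _ ≤ K * ((rate γ ^ M) ^ j * rate γ ^ m) * ((((γ ^ M : ℕ) : ℝ) ^ j)⁻¹ * ‖toPlane y‖) := by
            gcongr
        _ = _ := by ring
  · intro j y
    rw [blockSum, blockSum, ← Finset.sum_sub_distrib]
    refine (sum_le_geometric (a := K * ((((γ ^ M : ℕ) : ℝ) ^ j)⁻¹ * ‖toPlane y‖) ^ 2)
      hr0.le hr1 (by positivity) M fun m _ => ?_).trans_eq (by ring)
    refine (P.quad _ _).trans ?_
    -- The quadratic bound decays like γ^{-2m}, better than needed; it is weakened so that the same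
    -- geometric series serves.
    have e : ((γ : ℝ) ^ m)⁻¹ ≤ rate γ ^ m := by
      rw [← inv_pow, ← rate_pow_four]
      gcongr
      exact pow_le_of_le_one hr0.le hr1.le (by norm_num)
    have e2 : (((γ : ℝ) ^ m)⁻¹) ^ 2 ≤ rate γ ^ m := by
      refine (pow_le_of_le_one (by positivity) (inv_le_one_of_one_le₀ (one_le_pow₀ hg.le))
        (by norm_num)).trans e
    rw [hp]
    calc _ = K * ((((γ ^ M : ℕ) : ℝ) ^ j)⁻¹ * ‖toPlane y‖) ^ 2 * (((γ : ℝ) ^ m)⁻¹) ^ 2 := by ring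
      _ ≤ _ := by gcongr
  · exact fun x => (P.pot_quad x).trans (by gcongr)
  · exact fun x x' => (P.pot_lipschitz x x').trans (by gcongr)
  · rintro x ⟨i, hi⟩
    rw [← sum_sliceProfile hγ]
    refine Finset.sum_eq_zero fun m hm => P.profile_range _ ⟨i, ?_⟩
    have hm' : m + 1 ≤ M := by simpa using hm
    rw [PiLp.smul_apply, smul_eq_mul, abs_mul, abs_of_pos (by positivity), ← div_eq_inv_mul,
      lt_div_iff₀ (by positivity)]
    refine lt_of_le_of_lt ?_ hi
    push_cast
    calc (γ : ℝ) / 2 * (γ : ℝ) ^ m = (γ : ℝ) ^ (m + 1) / 2 := by rw [pow_succ]; ring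
      _ ≤ _ := by gcongr; exact hg.le

lemma sliceProfile_zero (γ : ℕ) (V : Plane → ℝ) :
    sliceProfile γ V 0 = Real.log γ / (2 * Real.pi) := by
  simp [sliceProfile]

lemma abs_exp_sub_one_le (t : ℝ) : |Real.exp t - 1| ≤ |t| * Real.exp |t| := by
  rcases le_total 0 t with h | h
  · rw [abs_of_nonneg h, abs_of_nonneg (by linarith [Real.add_one_le_exp t])]
    have h1 := Real.add_one_le_exp (-t)
    have h2 : Real.exp (-t) * Real.exp t = 1 := by rw [← Real.exp_add]; simp
    nlinarith [Real.exp_pos t]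
  · rw [abs_of_nonpos h, abs_of_nonpos (by linarith [Real.exp_le_one_iff.2 h])]
    have h1 := Real.add_one_le_exp t
    have h3 := Real.one_le_exp (neg_nonneg.2 h)
    nlinarith

lemma abs_exp_sub_exp_le {a b B : ℝ} (ha : a ≤ B) (hb : b ≤ B) :
    |Real.exp a - Real.exp b| ≤ Real.exp B * |a - b| := by
  wlog hab : b ≤ a generalizing a b
  · rw [abs_sub_comm, abs_sub_comm a]
    exact this hb ha (le_of_not_ge hab)
  rw [abs_of_nonneg (by linarith [Real.exp_le_exp.2 hab]), abs_of_nonneg (by linarith)]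
  have h1 := Real.add_one_le_exp (b - a)
  have h2 : Real.exp (b - a) * Real.exp a = Real.exp b := by rw [← Real.exp_add]; simp
  have h3 := Real.exp_le_exp.2 ha
  nlinarith [Real.exp_pos a]

/-- The scaling factor of the activity. -/
lemma abs_sq_mul_exp_sub_one_le (P : ScaleProfile γ c V κ K) (hγ : 1 < γ) (j : ℕ) :
    |(γ : ℝ) ^ 2 * Real.exp (-(4 * Real.pi) * c j 0) - 1| ≤
      4 * Real.pi * K * Real.exp (4 * Real.pi * K) * rate γ ^ j := by
  have hg : (0 : ℝ) < γ := by positivity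
  have hK := P.nonneg
  have hr0 := rate_pos hγ
  have hr1 := rate_lt_one hγ
  have h1 := P.approx j 0
  rw [toPlane_zero, smul_zero, sliceProfile_zero] at h1
  set t := c j 0 - Real.log γ / (2 * Real.pi) with ht
  -- Since 4π · ln γ/(2π) = 2 ln γ, the factor γ² cancels the limit of the slice at zero, and only
  -- the approximation error stays in the exponent.
  have e : (γ : ℝ) ^ 2 * Real.exp (-(4 * Real.pi) * c j 0) = Real.exp (-(4 * Real.pi) * t) := by
    have : -(4 * Real.pi) * t = 2 * Real.log γ + -(4 * Real.pi) * c j 0 := by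
      rw [ht]; field_simp; ring
    rw [this, Real.exp_add, mul_comm 2, Real.exp_mul (Real.log γ), Real.exp_log hg]
    norm_num
  have h3 : |-(4 * Real.pi) * t| ≤ 4 * Real.pi * K * rate γ ^ j := by
    rw [abs_mul, abs_neg, abs_of_pos (by positivity)]
    calc _ ≤ 4 * Real.pi * (K * rate γ ^ j) := by gcongr
      _ = _ := by ring
  have h4 : 4 * Real.pi * K * rate γ ^ j ≤ 4 * Real.pi * K :=
    mul_le_of_le_one_right (by positivity) (pow_le_one₀ hr0.le hr1.le)
  rw [e]
  refine (abs_exp_sub_one_le _).trans ?_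
  calc _ ≤ (4 * Real.pi * K * rate γ ^ j) * Real.exp (4 * Real.pi * K) := by
        gcongr
        exact h3.trans h4
    _ = _ := by ring

/-- Beyond the range of the first slice, the potential is exactly logarithmic. -/
lemma pot_eq_log (P : ScaleProfile γ c V κ K) (hγ : 1 < γ) {x : Plane} {i : Fin 2}
    (hx : 1 / 2 < |x i|) : V x = κ - Real.log ‖x‖ / (2 * Real.pi) := by
  have hg : (1 : ℝ) < γ := by exact_mod_cast hγ
  have hg0 : (0 : ℝ) < γ := by linarith
  have hx0 : 0 < ‖x‖ := lt_of_lt_of_le (lt_trans one_half_pos hx) (PiLp.norm_apply_le x i)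
  -- At γ^{n+1} x the limiting slice vanishes because |x_i| > 1/2, so V + ln|·|/(2π) takes the same
  -- value at γ^n x and γ^{n+1} x. Going to infinity along this sequence identifies that value with
  -- κ.
  have step : ∀ n : ℕ, V ((γ : ℝ) ^ n • x) + Real.log ‖(γ : ℝ) ^ n • x‖ / (2 * Real.pi) =
      V x + Real.log ‖x‖ / (2 * Real.pi) := by
    intro n
    induction n with
    | zero => simp
    | succ n ih =>
      rw [← ih]
      have h1 : sliceProfile γ V ((γ : ℝ) ^ (n + 1) • x) = 0 := by
        refine P.profile_range _ ⟨i, ?_⟩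
        rw [PiLp.smul_apply, smul_eq_mul, abs_mul, abs_of_pos (by positivity), pow_succ]
        have : (1 : ℝ) ≤ (γ : ℝ) ^ n := one_le_pow₀ hg.le
        have h2 : (γ : ℝ) ≤ (γ : ℝ) ^ n * γ := by nlinarith
        nlinarith
      rw [sliceProfile, smul_smul, pow_succ', inv_mul_cancel_left₀ hg0.ne'] at h1
      rw [pow_succ', mul_smul, norm_smul (γ : ℝ), Real.log_mul (norm_pos_iff.2 hg0.ne').ne'
        (norm_pos_iff.2 (smul_ne_zero (by positivity) (norm_pos_iff.1 hx0))).ne',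
        Real.norm_of_nonneg hg0.le, ← mul_smul]
      rw [add_div]
      linarith
  have hlim : Tendsto (fun n : ℕ => (γ : ℝ) ^ n • x) atTop (cocompact Plane) := by
    rw [← Metric.cobounded_eq_cocompact, ← tendsto_norm_atTop_iff_cobounded]
    simp_rw [CutoffEstimates.norm_pow_smul]
    exact (tendsto_pow_atTop_atTop_of_one_lt hg).atTop_mul_const hx0
  have := P.pot_log.comp hlim
  have h2 : Tendsto (fun _ : ℕ => V x + Real.log ‖x‖ / (2 * Real.pi)) atTop (𝓝 κ) :=
    this.congr step
  have h3 := tendsto_nhds_unique h2 tendsto_const_nhds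
  linarith

/-- The function `e^{8π(κ - V)}`. -/
noncomputable def expPot (V : Plane → ℝ) (κ : ℝ) (x : Plane) : ℝ :=
  Real.exp (8 * Real.pi * (κ - V x))

/-- The short distance profile `e^{8π(κ - V(x))} - |x|⁴` of the neutral kernel. -/
noncomputable def neutralProfile (V : Plane → ℝ) (κ : ℝ) (x : Plane) : ℝ :=
  expPot V κ x - ‖x‖ ^ 4

/-- Where V is exactly logarithmic, 8π/(2π) = 4 makes the exponential equal to |x|⁴. Thus the
profile has compact support, which makes lattice sums finite and Frullani applicable. -/
lemma neutralProfile_eq_zero (P : ScaleProfile γ c V κ K) (hγ : 1 < γ) {x : Plane} {i : Fin 2}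
    (hx : 1 / 2 < |x i|) : neutralProfile V κ x = 0 := by
  have hx0 : 0 < ‖x‖ := lt_of_lt_of_le (lt_trans one_half_pos hx) (PiLp.norm_apply_le x i)
  rw [neutralProfile, expPot, P.pot_eq_log hγ hx]
  have : 8 * Real.pi * (κ - (κ - Real.log ‖x‖ / (2 * Real.pi))) = Real.log ‖x‖ * 4 := by
    field_simp; ring
  rw [this, Real.exp_mul, Real.exp_log hx0]
  norm_num

lemma neutralProfile_eq_zero_of_norm (P : ScaleProfile γ c V κ K) (hγ : 1 < γ) {x : Plane}
    (hx : 1 < ‖x‖) : neutralProfile V κ x = 0 := by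
  by_contra hne
  have h : ∀ i, |x i| ≤ 1 / 2 := fun i => by
    by_contra hi
    exact hne (P.neutralProfile_eq_zero hγ (not_le.1 hi))
  have h0 := abs_le.1 (h 0)
  have h1 := abs_le.1 (h 1)
  have := norm_sq_eq_add x
  nlinarith

lemma neutralProfile_zero (P : ScaleProfile γ c V κ K) :
    neutralProfile V κ 0 = Real.exp (8 * Real.pi * κ) := by
  simp [neutralProfile, expPot, P.pot_zero]

/-- A Lipschitz constant for the neutral profile. -/
lemma exists_neutralProfile_bound (P : ScaleProfile γ c V κ K) (hγ : 1 < γ) :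
    ∃ B, 0 ≤ B ∧ (∀ x, |neutralProfile V κ x| ≤ B) ∧
      ∀ x x', |neutralProfile V κ x - neutralProfile V κ x'| ≤ B * ‖x - x'‖ := by
  have hK := P.nonneg
  -- Bounds the exponential on the disc of radius 2, where -V ≤ 4K.
  set T : ℝ := Real.exp (8 * Real.pi * (|κ| + 4 * K)) with hT
  have hT0 : 0 < T := Real.exp_pos _
  have hexp : ∀ x : Plane, ‖x‖ ≤ 2 → 8 * Real.pi * (κ - V x) ≤ 8 * Real.pi * (|κ| + 4 * K) := by
    intro x hx
    have h1 := P.pot_quad x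
    have h2 : K * ‖x‖ ^ 2 ≤ K * 2 ^ 2 := by gcongr
    have h3 := le_abs_self κ
    gcongr
    linarith
  have hlip : ∀ x x' : Plane, ‖x‖ ≤ 2 → ‖x'‖ ≤ 2 →
      |neutralProfile V κ x - neutralProfile V κ x'| ≤ (T * (8 * Real.pi * K) + 32) * ‖x - x'‖ := by
    intro x x' hx hx'
    have h1 := abs_exp_sub_exp_le (hexp x hx) (hexp x' hx')
    have h2 : |8 * Real.pi * (κ - V x) - 8 * Real.pi * (κ - V x')| ≤ 8 * Real.pi * K * ‖x - x'‖ := by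
      have : 8 * Real.pi * (κ - V x) - 8 * Real.pi * (κ - V x') = 8 * Real.pi * (V x' - V x) := by ring
      rw [this, abs_mul, abs_of_pos (by positivity), abs_sub_comm]
      have := P.pot_lipschitz x x'
      calc _ ≤ 8 * Real.pi * (K * ‖x - x'‖) := by gcongr
        _ = _ := by ring
    have h3 : |‖x‖ ^ 4 - ‖x'‖ ^ 4| ≤ 32 * ‖x - x'‖ := by
      have e : ‖x‖ ^ 4 - ‖x'‖ ^ 4 = (‖x‖ - ‖x'‖) * ((‖x‖ + ‖x'‖) * (‖x‖ ^ 2 + ‖x'‖ ^ 2)) := by ring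
      have b : (‖x‖ + ‖x'‖) * (‖x‖ ^ 2 + ‖x'‖ ^ 2) ≤ (2 + 2) * (2 ^ 2 + 2 ^ 2) := by gcongr
      rw [e, abs_mul, abs_of_nonneg (by positivity : 0 ≤ (‖x‖ + ‖x'‖) * (‖x‖ ^ 2 + ‖x'‖ ^ 2)), mul_comm]
      have := abs_norm_sub_norm_le x x'
      calc _ ≤ ((2 + 2) * (2 ^ 2 + 2 ^ 2)) * ‖x - x'‖ := by gcongr
        _ = _ := by norm_num
    have e : neutralProfile V κ x - neutralProfile V κ x' =
        (expPot V κ x - expPot V κ x') - (‖x‖ ^ 4 - ‖x'‖ ^ 4) := by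
      simp only [neutralProfile]; ring
    rw [e]
    refine (abs_sub _ _).trans ?_
    have : |expPot V κ x - expPot V κ x'| ≤ T * (8 * Real.pi * K * ‖x - x'‖) :=
      h1.trans (by gcongr)
    linarith
  set B₁ := T * (8 * Real.pi * K) + 32 with hB₁
  have hB₁0 : 0 ≤ B₁ := by positivity
  have hbd : ∀ x, |neutralProfile V κ x| ≤ T + 16 := by
    intro x
    rcases le_or_gt ‖x‖ 2 with h | h
    · have h1 : expPot V κ x ≤ T := Real.exp_le_exp.2 (hexp x h)
      have h2 : 0 < expPot V κ x := Real.exp_pos _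
      have h3 : ‖x‖ ^ 4 ≤ 2 ^ 4 := by gcongr
      have h4 : 0 ≤ ‖x‖ ^ 4 := by positivity
      rw [neutralProfile, abs_le]
      constructor <;> linarith
    · rw [P.neutralProfile_eq_zero_of_norm hγ (by linarith), abs_zero]
      positivity
  -- The support lies in the unit disc. A point outside radius 2 is at distance at least 1 from it,
  -- so there boundedness already gives the Lipschitz estimate.
  have hfar : ∀ x x' : Plane, 2 < ‖x'‖ →
      |neutralProfile V κ x - neutralProfile V κ x'| ≤ (T + 16) * ‖x - x'‖ := by
    intro x x' hx'
    rw [P.neutralProfile_eq_zero_of_norm hγ (by linarith : 1 < ‖x'‖), sub_zero]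
    rcases le_or_gt ‖x‖ 1 with h | h
    · have : 1 ≤ ‖x - x'‖ := by
        have := norm_sub_norm_le x' x
        rw [norm_sub_rev] at this
        linarith
      exact (hbd x).trans (le_mul_of_one_le_right (by positivity) this)
    · rw [P.neutralProfile_eq_zero_of_norm hγ h, abs_zero]
      positivity
  refine ⟨B₁ + (T + 16), by positivity, fun x => (hbd x).trans (by linarith), fun x x' => ?_⟩
  have hn := norm_nonneg (x - x')
  rcases le_or_gt ‖x‖ 2 with h | h
  · rcases le_or_gt ‖x'‖ 2 with h' | h'
    · exact (hlip x x' h h').trans (mul_le_mul_of_nonneg_right (by linarith) hn)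
    · exact (hfar x x' h').trans (mul_le_mul_of_nonneg_right (by linarith) hn)
  · rw [abs_sub_comm, norm_sub_rev]
    exact (hfar x' x h).trans (mul_le_mul_of_nonneg_right (by linarith) (norm_nonneg _))

end ScaleProfile

namespace CutoffEstimates

variable {γ : ℕ} {A : ℕ → ℕ → Plane → ℂ} {u : Plane → ℝ} {C : ℝ}

/-- The slices of a finite range decomposition form a scale profile. -/
lemma exists_scaleProfile (H : CutoffEstimates γ A u C) (hγ : 1 < γ)
    (hfr : ∀ h x, (γ : ℝ) ^ (h + 1) / 2 < (maxLen x : ℝ) → sliceCov γ A h x = 0)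
    {κ : ℝ} (hκ : IsPotentialConstant u κ) :
    ∃ K, ScaleProfile γ (fun h y => (sliceCov γ A h y).re) (potential u) κ K := by
  have hC := H.pos
  have hlim : ∀ x, sliceProfile γ (potential u) x = limitCov γ u x := fun x =>
    (H.limitCov_eq hγ x).symm
  have w1 : 0 ≤ ∫ q, weight (-(7 / 4)) q := integral_nonneg fun q => weight_nonneg _ q
  have w2 : 0 ≤ ∫ q, weight (-(3 / 4)) q := integral_nonneg fun q => weight_nonneg _ q
  have w3 : 0 ≤ ∫ q, weight (-1) q := integral_nonneg fun q => weight_nonneg _ q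
  have hr := rate_pos hγ
  set K : ℝ := 202 * C * (∫ q, weight (-(7 / 4)) q) + 202 * C * (∫ q, weight (-(3 / 4)) q) +
    4 * C * (∫ q, weight (-1) q) with hK
  have p1 : 0 ≤ 202 * C * (∫ q, weight (-(7 / 4)) q) := by positivity
  have p2 : 0 ≤ 202 * C * (∫ q, weight (-(3 / 4)) q) := by positivity
  have p3 : 0 ≤ C * (∫ q, weight (-1) q) := by positivity
  have b1 : 202 * C * (∫ q, weight (-(7 / 4)) q) ≤ K := by linarith
  have b2 : 202 * C * (∫ q, weight (-(3 / 4)) q) ≤ K := by linarith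
  have b3 : 4 * C * (∫ q, weight (-1) q) ≤ K := by linarith
  have b4 : C * (∫ q, weight (-1) q) ≤ K := by linarith
  refine ⟨K, by positivity, ?_, fun h y => ?_, fun h y => ?_, fun h y => ?_, by simp [potential],
    H.potential_nonpos, fun x => ?_, fun x x' => ?_, ?_, ?_⟩
  · rintro h y ⟨i, hi⟩
    rw [hfr h y, Complex.zero_re]
    refine lt_of_lt_of_le hi ?_
    rw [maxLen, ← Int.cast_abs]
    fin_cases i <;> simp
  · rw [hlim]
    exact (H.abs_sliceCov_sub_limitCov_le hγ h y).trans (by gcongr)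
  · rw [hlim, hlim]
    exact (H.abs_sliceCov_increment_sub_le hγ h y).trans (by gcongr)
  · exact (H.abs_sliceCov_increment_le hγ h y).trans (by gcongr)
  · exact (H.neg_potential_le x).trans (by gcongr)
  · exact (H.abs_potential_sub_le x x').trans (by gcongr)
  · rintro x ⟨i, hi⟩
    rw [hlim]
    exact H.limitCov_eq_zero hγ hfr hi
  · have h1 := (Complex.continuous_re.tendsto _).comp hκ.2
    refine h1.congr fun x => ?_
    simp only [Function.comp]
    rw [Complex.add_re, ← Complex.ofReal_inv, Complex.re_ofReal_mul, Complex.ofReal_re, potential]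
    have := integral_re (hκ.1 x)
    simp only [RCLike.re_to_complex] at this
    rw [← this]
    congr 1
    · congr 1
      refine integral_congr_ae (Eventually.of_forall fun p => ?_)
      simp only [potentialIntegrand]
      rw [Complex.re_mul_ofReal, Complex.sub_re, mul_comm Complex.I, Complex.exp_ofReal_mul_I_re,
        Complex.one_re]
    · ring

end CutoffEstimates

end CoulombGas

/-! ### Lattice sums as integrals, and the limiting sum for a_j. -/

namespace CoulombGas

open MeasureTheory Filter Topology Set

/-- The lattice site nearest to a point of the plane. -/
noncomputable def nearestSite (x : Plane) : Site := fun i => round (x i)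

/-- The sites of maximum norm at most `N`. -/
noncomputable def boxSites (N : ℕ) : Finset Site := Fintype.piFinset fun _ => Finset.Icc (-(N : ℤ)) N

lemma mem_boxSites {N : ℕ} {y : Site} : y ∈ boxSites N ↔ ∀ i, |y i| ≤ N := by
  simp [boxSites, Fintype.mem_piFinset, abs_le]

lemma card_boxSites (N : ℕ) : (boxSites N).card = (2 * N + 1) ^ 2 := by
  simp only [boxSites, Fintype.card_piFinset, Int.card_Icc, Finset.prod_const, Finset.card_univ,
    Fintype.card_fin]
  congr 1
  omega

lemma norm_toPlane_le_of_mem {N : ℕ} {y : Site} (hy : y ∈ boxSites N) :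
    ‖toPlane y‖ ≤ 2 * N := by
  have h := mem_boxSites.1 hy
  have h0 : |(y 0 : ℝ)| ≤ N := by exact_mod_cast h 0
  have h1 : |(y 1 : ℝ)| ≤ N := by exact_mod_cast h 1
  refine le_of_sq_le_sq ?_ (by positivity)
  rw [norm_sq_eq_add, toPlane_apply, toPlane_apply, ← sq_abs (y 0 : ℝ), ← sq_abs (y 1 : ℝ)]
  nlinarith [abs_nonneg (y 0 : ℝ), abs_nonneg (y 1 : ℝ)]

lemma lt_norm_of_notMem {N : ℕ} {y : Site} (hy : y ∉ boxSites N) : (N : ℝ) < ‖toPlane y‖ := by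
  rw [mem_boxSites] at hy
  push Not at hy
  obtain ⟨i, hi⟩ := hy
  have h1 : (N : ℝ) < |(y i : ℝ)| := by exact_mod_cast hi
  exact lt_of_lt_of_le h1 (PiLp.norm_apply_le (toPlane y) i)

lemma boxSites_mono : Monotone boxSites := fun a b hab y hy => by
  rw [mem_boxSites] at hy ⊢
  exact fun i => (hy i).trans (by exact_mod_cast hab)

lemma one_le_norm_toPlane {y : Site} (hy : y ≠ 0) : 1 ≤ ‖toPlane y‖ := by
  obtain ⟨i, hi⟩ := Function.ne_iff.1 hy
  have : (1 : ℝ) ≤ |(y i : ℝ)| := by exact_mod_cast Int.one_le_abs hi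
  exact this.trans (PiLp.norm_apply_le (toPlane y) i)

/-- The square shell of radius N + 1 has 8(N + 1) sites of norm at least N + 1, so it contributes at
most 8. The origin contributes 0, its inverse norm being 0. -/
lemma sum_inv_norm_le (N : ℕ) : ∑ y ∈ boxSites N, ‖toPlane y‖⁻¹ ≤ 8 * N := by
  induction N with
  | zero =>
    have : boxSites 0 = {0} := by
      ext y; simp [mem_boxSites, funext_iff]
    simp [this]
  | succ N ih =>
    have hsub : boxSites N ⊆ boxSites (N + 1) := boxSites_mono (by omega)
    rw [← Finset.sum_sdiff hsub]
    have h1 : ∑ y ∈ boxSites (N + 1) \ boxSites N, ‖toPlane y‖⁻¹ ≤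
        ∑ y ∈ boxSites (N + 1) \ boxSites N, ((N : ℝ) + 1)⁻¹ := by
      refine Finset.sum_le_sum fun y hy => ?_
      rw [Finset.mem_sdiff, mem_boxSites (N := N)] at hy
      have hy2 := hy.2
      push Not at hy2
      obtain ⟨i, hi⟩ := hy2
      have h1 : ((N : ℝ) + 1) ≤ |(y i : ℝ)| := by exact_mod_cast hi
      gcongr
      exact h1.trans (PiLp.norm_apply_le (toPlane y) i)
    rw [Finset.sum_const, Finset.card_sdiff_of_subset hsub, card_boxSites, card_boxSites] at h1
    have h2 : (2 * (N + 1) + 1) ^ 2 - (2 * N + 1) ^ 2 = 8 * (N + 1) := by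
      have : (2 * (N + 1) + 1) ^ 2 = (2 * N + 1) ^ 2 + 8 * (N + 1) := by ring
      omega
    rw [h2, nsmul_eq_mul] at h1
    push_cast at h1 ⊢
    have h3 : 8 * ((N : ℝ) + 1) * ((N : ℝ) + 1)⁻¹ = 8 := by field_simp
    linarith

lemma nearestSite_eq_iff {x : Plane} {y : Site} :
    nearestSite x = y ↔ x.ofLp ∈ pi univ fun i => Ico ((y i : ℝ) - 1 / 2) ((y i : ℝ) + 1 / 2) := by
  simp only [nearestSite, funext_iff, Set.mem_pi, Set.mem_univ, forall_true_left, mem_Ico, round_eq,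
    Int.floor_eq_iff]
  refine forall_congr' fun i => ?_
  constructor <;> rintro ⟨h1, h2⟩ <;> constructor <;> linarith

lemma norm_sub_nearestSite_le (x : Plane) : ‖x - toPlane (nearestSite x)‖ ≤ 3 / 4 := by
  have h0 := abs_sub_round (x 0)
  have h1 := abs_sub_round (x 1)
  refine le_of_sq_le_sq ?_ (by norm_num)
  rw [norm_sq_eq_add]
  simp only [PiLp.sub_apply, toPlane_apply, nearestSite]
  rw [← sq_abs (x 0 - _), ← sq_abs (x 1 - _)]
  nlinarith [abs_nonneg (x 0 - (round (x 0) : ℝ)), abs_nonneg (x 1 - (round (x 1) : ℝ))]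

lemma measurableSet_cell (y : Site) : MeasurableSet {x : Plane | nearestSite x = y} := by
  simp only [nearestSite_eq_iff]
  exact (MeasurableSet.univ_pi fun i => measurableSet_Ico).preimage
    (PiLp.continuous_ofLp 2 _).measurable

lemma volume_cell (y : Site) : volume {x : Plane | nearestSite x = y} = 1 := by
  have h := PiLp.volume_preserving_ofLp (Fin 2)
  have : {x : Plane | nearestSite x = y} = (WithLp.ofLp : Plane → Fin 2 → ℝ) ⁻¹'
      (pi univ fun i => Ico ((y i : ℝ) - 1 / 2) ((y i : ℝ) + 1 / 2)) := by
    ext x; exact nearestSite_eq_iff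
  rw [this, h.measure_preimage (MeasurableSet.univ_pi fun i => measurableSet_Ico).nullMeasurableSet,
    Real.volume_pi_Ico]
  norm_num

/-- A lattice sum as the integral of a step function. -/
lemma integral_comp_nearestSite (F : Site → ℝ) (s : Finset Site) (hF : ∀ y ∉ s, F y = 0) :
    Integrable (fun x => F (nearestSite x)) ∧ ∫ x, F (nearestSite x) = ∑ y ∈ s, F y := by
  have e : (fun x => F (nearestSite x)) =
      fun x => ∑ y ∈ s, {x : Plane | nearestSite x = y}.indicator (fun _ => F y) x := by
    ext x
    simp only [indicator, mem_ofPred_eq]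
    rw [Finset.sum_ite_eq]
    split_ifs with h
    · rfl
    · exact hF _ h
  have hi : ∀ y ∈ s, Integrable ({x : Plane | nearestSite x = y}.indicator (fun _ => F y)) := by
    intro y _
    rw [integrable_indicator_iff (measurableSet_cell y)]
    exact integrableOn_const (by rw [volume_cell]; simp)
  rw [e]
  refine ⟨integrable_finsetSum _ hi, ?_⟩
  rw [integral_finsetSum _ hi]
  refine Finset.sum_congr rfl fun y _ => ?_
  rw [integral_indicator (measurableSet_cell y), setIntegral_const, Measure.real, volume_cell]
  simp

namespace ScaleProfile

variable {γ : ℕ} {c : ℕ → Site → ℝ} {V : Plane → ℝ} {κ K : ℝ}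

/-- The limiting summand of the coefficient `a_j`. -/
noncomputable def limitSummand (γ : ℕ) (V : Plane → ℝ) (κ : ℝ) (j : ℕ) (x : Plane) : ℝ :=
  (neutralProfile V κ (((γ : ℝ) ^ (j + 1))⁻¹ • x) - neutralProfile V κ (((γ : ℝ) ^ j)⁻¹ • x)) /
    ‖x‖ ^ 2

lemma measurable_neutralProfile (P : ScaleProfile γ c V κ K) : Measurable (neutralProfile V κ) := by
  have hV : Continuous V := by
    have : LipschitzWith (Real.toNNReal K) V := by
      refine LipschitzWith.of_dist_le_mul fun x y => ?_
      rw [Real.coe_toNNReal', Real.dist_eq, dist_eq_norm]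
      exact (P.pot_lipschitz x y).trans (by gcongr; exact le_max_left _ _)
    exact this.continuous
  have : Continuous (neutralProfile V κ) := by
    unfold neutralProfile expPot; fun_prop
  exact this.measurable

/-- Frullani for a dilate of the neutral profile, whose value e^{8πκ} at the origin does not see the
dilation; hence the same integral for every j. -/
lemma limitSummand_integral (P : ScaleProfile γ c V κ K) (hγ : 1 < γ) (j : ℕ) :
    Integrable (limitSummand γ V κ j) ∧
      ∫ x, limitSummand γ V κ j x = 2 * Real.pi * Real.exp (8 * Real.pi * κ) * Real.log γ := by
  have hg : (1 : ℝ) < γ := by exact_mod_cast hγ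
  have hg0 : (0 : ℝ) < γ := by linarith
  obtain ⟨B, hB, hb, hl⟩ := P.exists_neutralProfile_bound hγ
  have hm := P.measurable_neutralProfile
  set s : ℝ := (γ : ℝ) ^ (j + 1) with hs
  have hs1 : 1 ≤ s := one_le_pow₀ hg.le
  have hs0 : 0 < s := by linarith
  -- The constant B(1 + s²) depends on j, which is harmless because the value of the Frullani
  -- integral does not involve it.
  have key := frullani (φ := fun x => neutralProfile V κ (s⁻¹ • x))
    (φ₀ := neutralProfile V κ 0) (C := B * (1 + s ^ 2)) (L := γ) (by fun_prop) (fun x => ?_)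
    (fun x => ?_) hg.le
  · have e : ∀ x : Plane, s⁻¹ • (γ : ℝ) • x = ((γ : ℝ) ^ j)⁻¹ • x := by
      intro x
      rw [smul_smul, hs, pow_succ, mul_inv, mul_assoc, inv_mul_cancel₀ hg0.ne', mul_one]
    simp only [e, P.neutralProfile_zero] at key
    exact key
  · have h1 := hl (s⁻¹ • x) 0
    rw [sub_zero, norm_smul, Real.norm_of_nonneg (by positivity)] at h1
    refine h1.trans ?_
    have : s⁻¹ ≤ 1 + s ^ 2 := (inv_le_one_of_one_le₀ hs1).trans (by nlinarith)
    calc _ = B * s⁻¹ * ‖x‖ := by ring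
      _ ≤ _ := by gcongr
  · by_cases h : ‖s⁻¹ • x‖ ≤ 1
    · rw [norm_smul, Real.norm_of_nonneg (by positivity), inv_mul_le_iff₀ hs0, mul_one] at h
      rw [le_div_iff₀ (by positivity)]
      have := hb (s⁻¹ • x)
      calc _ ≤ B * (1 + s ^ 2) := by gcongr
        _ = _ := by ring
    · rw [P.neutralProfile_eq_zero_of_norm hγ (not_le.1 h), abs_zero]
      positivity

/-- The numerator has Lipschitz constant O(γ^{-j}) and vanishes at the origin. Moving x to its
nearest site costs γ^{-j}/|x|² away from the origin, and γ^{-j}/|x| in the cell of the origin, where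
the site term is zero. The exponent -3/2 dominates both and is integrable. -/
lemma exists_limitSummand_step (P : ScaleProfile γ c V κ K) (hγ : 1 < γ) :
    ∃ B, 0 ≤ B ∧ ∀ j x, |limitSummand γ V κ j (toPlane (nearestSite x)) - limitSummand γ V κ j x| ≤
      (Metric.closedBall (0 : Plane) (2 * (γ : ℝ) ^ (j + 1))).indicator
        (fun x => B * ((γ : ℝ) ^ j)⁻¹ * ‖x‖ ^ (-(3 / 2) : ℝ)) x := by
  have hg : (1 : ℝ) < γ := by exact_mod_cast hγ
  have hg0 : (0 : ℝ) < γ := by linarith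
  obtain ⟨B, hB, hb, hl⟩ := P.exists_neutralProfile_bound hγ
  -- The cell of the origin needs 2B and the other cells 12B.
  refine ⟨16 * B, by positivity, fun j x => ?_⟩
  set y := nearestSite x with hy
  set s : ℝ := (γ : ℝ) ^ j with hs
  have hs1 : 1 ≤ s := one_le_pow₀ hg.le
  have hs0 : 0 < s := by linarith
  have hss : (γ : ℝ) ^ (j + 1) = γ * s := by rw [pow_succ']
  set a : Plane → ℝ := fun x => neutralProfile V κ ((γ * s)⁻¹ • x) - neutralProfile V κ (s⁻¹ • x)
    with ha
  have hf : ∀ x, limitSummand γ V κ j x = a x / ‖x‖ ^ 2 := fun x => by rw [limitSummand, hss]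
  have hsl : (γ * s)⁻¹ ≤ s⁻¹ := by gcongr; nlinarith
  have hasub : ∀ z z' : Plane, |a z - a z'| ≤ 2 * B * s⁻¹ * ‖z - z'‖ := by
    intro z z'
    have h1 := hl ((γ * s)⁻¹ • z) ((γ * s)⁻¹ • z')
    have h2 := hl (s⁻¹ • z) (s⁻¹ • z')
    rw [← smul_sub, norm_smul, Real.norm_of_nonneg (by positivity)] at h1 h2
    have h3 : B * ((γ * s)⁻¹ * ‖z - z'‖) ≤ B * (s⁻¹ * ‖z - z'‖) := by gcongr
    have e : a z - a z' = (neutralProfile V κ ((γ * s)⁻¹ • z) - neutralProfile V κ ((γ * s)⁻¹ • z'))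
      - (neutralProfile V κ (s⁻¹ • z) - neutralProfile V κ (s⁻¹ • z')) := by simp only [ha]; ring
    rw [e]
    refine (abs_sub _ _).trans ?_
    linarith
  have ha0 : ∀ z, |a z| ≤ 2 * B * s⁻¹ * ‖z‖ := by
    intro z
    have := hasub z 0
    have h0 : a 0 = 0 := by simp [ha]
    rwa [h0, sub_zero, sub_zero] at this
  have hxy : ‖x - toPlane y‖ ≤ 3 / 4 := norm_sub_nearestSite_le x
  have hxy1 : ‖x‖ ≤ ‖toPlane y‖ + 3 / 4 := by
    have := norm_le_norm_add_norm_sub' x (toPlane y)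
    linarith
  have hxy2 : ‖toPlane y‖ ≤ ‖x‖ + 3 / 4 := by
    have := norm_le_norm_add_norm_sub' (toPlane y) x
    rw [norm_sub_rev] at this
    linarith
  by_cases hx : x ∈ Metric.closedBall (0 : Plane) (2 * (γ : ℝ) ^ (j + 1))
  swap
  · rw [indicator_of_notMem hx]
    rw [mem_closedBall_zero_iff, not_le, hss] at hx
    have hfar : ∀ z : Plane, γ * s < ‖z‖ → a z = 0 := by
      intro z hz
      have h1 : 1 < ‖(γ * s)⁻¹ • z‖ := by
        rw [norm_smul, Real.norm_of_nonneg (by positivity), lt_inv_mul_iff₀ (by positivity), mul_one]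
        exact hz
      have h2 : 1 < ‖s⁻¹ • z‖ := by
        refine h1.trans_le ?_
        rw [norm_smul, norm_smul, Real.norm_of_nonneg (by positivity),
          Real.norm_of_nonneg (by positivity)]
        gcongr
      simp only [ha, P.neutralProfile_eq_zero_of_norm hγ h1, P.neutralProfile_eq_zero_of_norm hγ h2,
        sub_zero]
    have hgs : 1 ≤ γ * s := by nlinarith
    rw [hf, hf, hfar x (by linarith), hfar (toPlane y) (by linarith)]
    simp
  rw [indicator_of_mem hx, hf, hf]
  by_cases hx0 : x = 0
  · have : y = 0 := by rw [hy, hx0]; ext i; simp [nearestSite]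
    rw [this, hx0, toPlane_zero, sub_self, abs_zero]
    positivity
  have hn : 0 < ‖x‖ := norm_pos_iff.2 hx0
  by_cases hy0 : y = 0
  · rw [hy0, toPlane_zero] at hxy ⊢
    rw [sub_zero] at hxy
    rw [norm_zero, zero_pow two_ne_zero, div_zero, zero_sub, abs_neg, abs_div,
      abs_of_pos (by positivity : 0 < ‖x‖ ^ 2)]
    have h1 : ‖x‖ ^ (-1 : ℝ) ≤ ‖x‖ ^ (-(3 / 2) : ℝ) :=
      Real.rpow_le_rpow_of_exponent_ge hn (by linarith) (by norm_num)
    rw [Real.rpow_neg_one] at h1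
    calc |a x| / ‖x‖ ^ 2 ≤ 2 * B * s⁻¹ * ‖x‖ / ‖x‖ ^ 2 := by gcongr; exact ha0 x
      _ = 2 * B * s⁻¹ * ‖x‖⁻¹ := by field_simp
      _ ≤ 2 * B * s⁻¹ * ‖x‖ ^ (-(3 / 2) : ℝ) := by gcongr
      _ ≤ _ := by gcongr; norm_num
  · have hy1 := one_le_norm_toPlane hy0
    set t := ‖toPlane y‖ with ht
    have hx4 : 1 / 4 ≤ ‖x‖ := by linarith
    have e : a (toPlane y) / t ^ 2 - a x / ‖x‖ ^ 2 = (a (toPlane y) - a x) / ‖x‖ ^ 2 +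
        a (toPlane y) * ((‖x‖ - t) * (‖x‖ + t)) / (t ^ 2 * ‖x‖ ^ 2) := by
      field_simp; ring
    have b1 : |(a (toPlane y) - a x) / ‖x‖ ^ 2| ≤ 2 * B * s⁻¹ * (3 / 4) / ‖x‖ ^ 2 := by
      rw [abs_div, abs_of_pos (by positivity : 0 < ‖x‖ ^ 2)]
      gcongr
      refine (hasub _ _).trans ?_
      rw [norm_sub_rev]
      gcongr
    have b2 : |a (toPlane y) * ((‖x‖ - t) * (‖x‖ + t)) / (t ^ 2 * ‖x‖ ^ 2)| ≤
        2 * B * s⁻¹ * (9 / 4) / ‖x‖ ^ 2 := by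
      have h3 : |‖x‖ - t| ≤ 3 / 4 := (abs_norm_sub_norm_le _ _).trans hxy
      have h4 : ‖x‖ + t ≤ 3 * t := by linarith
      rw [abs_div, abs_mul, abs_mul, abs_of_pos (by positivity : 0 < t ^ 2 * ‖x‖ ^ 2),
        abs_of_pos (by positivity : 0 < ‖x‖ + t)]
      calc _ ≤ 2 * B * s⁻¹ * t * (3 / 4 * (3 * t)) / (t ^ 2 * ‖x‖ ^ 2) := by
            gcongr
            exact ha0 _
        _ = _ := by field_simp; ring
    have h5 : (‖x‖ ^ 2)⁻¹ ≤ 2 * ‖x‖ ^ (-(3 / 2) : ℝ) := by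
      have h6 : ‖x‖ ^ (-(1 / 2) : ℝ) ≤ (1 / 4) ^ (-(1 / 2) : ℝ) :=
        Real.rpow_le_rpow_of_nonpos (by norm_num) hx4 (by norm_num)
      have h7 : ((1 / 4 : ℝ)) ^ (-(1 / 2) : ℝ) = 2 := by
        rw [show (1 / 4 : ℝ) = 2 ^ (-2 : ℝ) by norm_num, ← Real.rpow_mul (by norm_num)]
        norm_num
      rw [h7] at h6
      have h8 : (‖x‖ ^ 2)⁻¹ = ‖x‖ ^ (-(1 / 2) : ℝ) * ‖x‖ ^ (-(3 / 2) : ℝ) := by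
        rw [← Real.rpow_add hn]
        norm_num
      rw [h8]
      gcongr
    rw [e]
    refine (abs_add_le _ _).trans ?_
    calc _ ≤ 2 * B * s⁻¹ * (3 / 4) / ‖x‖ ^ 2 + 2 * B * s⁻¹ * (9 / 4) / ‖x‖ ^ 2 := add_le_add b1 b2
      _ = 6 * B * s⁻¹ * (‖x‖ ^ 2)⁻¹ := by ring
      _ ≤ 6 * B * s⁻¹ * (2 * ‖x‖ ^ (-(3 / 2) : ℝ)) := by gcongr
      _ = 12 * B * s⁻¹ * ‖x‖ ^ (-(3 / 2) : ℝ) := by ring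
      _ ≤ _ := by gcongr; norm_num

/-- The lattice sum of the limiting summand. -/
lemma exists_sum_limitSummand (P : ScaleProfile γ c V κ K) (hγ : 1 < γ) :
    ∃ B, 0 ≤ B ∧ ∀ j, |∑ y ∈ boxSites (γ ^ (j + 1)), limitSummand γ V κ j (toPlane y) -
      2 * Real.pi * Real.exp (8 * Real.pi * κ) * Real.log γ| ≤ B * rate γ ^ j := by
  have hg : (1 : ℝ) < γ := by exact_mod_cast hγ
  have hg0 : (0 : ℝ) < γ := by linarith
  have hr0 := rate_pos hγ
  have hr1 := rate_lt_one hγ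
  obtain ⟨B, hB, hb⟩ := P.exists_limitSummand_step hγ
  refine ⟨B * (2 * Real.pi * (2 * (2 * γ : ℝ) ^ (1 / 2 : ℝ))), by positivity, fun j => ?_⟩
  obtain ⟨i1, i2⟩ := P.limitSummand_integral hγ j
  obtain ⟨j1, j2⟩ := integral_comp_nearestSite (fun y => limitSummand γ V κ j (toPlane y))
    (boxSites (γ ^ (j + 1))) (fun y hy => by
      have h1 := lt_norm_of_notMem hy
      push_cast at h1
      have h2 : 1 < ‖((γ : ℝ) ^ (j + 1))⁻¹ • toPlane y‖ := by
        rw [norm_inv_smul hγ, lt_inv_mul_iff₀ (by positivity), mul_one]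
        exact h1
      have h3 : 1 < ‖((γ : ℝ) ^ j)⁻¹ • toPlane y‖ := by
        rw [norm_inv_smul hγ, lt_inv_mul_iff₀ (by positivity), mul_one]
        refine lt_of_le_of_lt ?_ h1
        exact pow_le_pow_right₀ hg.le (by omega)
      rw [limitSummand, P.neutralProfile_eq_zero_of_norm hγ h2,
        P.neutralProfile_eq_zero_of_norm hγ h3]
      simp)
  have hR : (0 : ℝ) ≤ 2 * (γ : ℝ) ^ (j + 1) := by positivity
  obtain ⟨k1, k2⟩ := integrableOn_norm_rpow (s := -(3 / 2)) (by norm_num) hR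
  rw [← j2, ← i2, ← integral_sub j1 i1, ← Real.norm_eq_abs]
  have hmeas : MeasurableSet (Metric.closedBall (0 : Plane) (2 * (γ : ℝ) ^ (j + 1))) :=
    Metric.isClosed_closedBall.measurableSet
  refine (norm_integral_le_of_norm_le (((integrable_indicator_iff hmeas).2
    (k1.const_mul (B * ((γ : ℝ) ^ j)⁻¹)))) (Eventually.of_forall (hb j))).trans ?_
  rw [integral_indicator hmeas, integral_const_mul, k2]
  -- Over a disc of radius 2γ^{j+1} the integral of |x|^{-3/2} grows like γ^{j/2}. Against γ^{-j}
  -- this leaves γ^{-j/2}, better than the rate claimed.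
  have e1 : (2 * (γ : ℝ) ^ (j + 1)) ^ (-(3 / 2) + 2 : ℝ) =
      (2 * γ : ℝ) ^ (1 / 2 : ℝ) * ((γ : ℝ) ^ j) ^ (1 / 2 : ℝ) := by
    rw [pow_succ', ← mul_assoc, Real.mul_rpow (by positivity) (by positivity)]
    norm_num
  have e2 : ((γ : ℝ) ^ j)⁻¹ * ((γ : ℝ) ^ j) ^ (1 / 2 : ℝ) = (rate γ ^ j) ^ 2 := by
    rw [← Real.rpow_neg_one, ← Real.rpow_add (by positivity), rate_pow, ← Real.rpow_natCast,
      ← Real.rpow_natCast, ← Real.rpow_mul hg0.le, ← Real.rpow_mul hg0.le]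
    norm_num
    ring_nf
  have e3 : (rate γ ^ j) ^ 2 ≤ rate γ ^ j :=
    pow_le_of_le_one (by positivity) (pow_le_one₀ hr0.le hr1.le) two_ne_zero
  rw [e1]
  calc _ = B * (2 * Real.pi * (2 * (2 * γ : ℝ) ^ (1 / 2 : ℝ))) *
        (((γ : ℝ) ^ j)⁻¹ * ((γ : ℝ) ^ j) ^ (1 / 2 : ℝ)) := by ring
    _ ≤ _ := by rw [e2]; gcongr

end ScaleProfile

end CoulombGas

/-! ### Limit of the neutral kernel. -/

namespace CoulombGas

open MeasureTheory Filter Topology Set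

namespace ScaleProfile

variable {γ : ℕ} {c : ℕ → Site → ℝ} {V : Plane → ℝ} {κ K : ℝ}

/-- The factor `e^{-8π (S(0) - S(y))}` of the slices `S = c_n + ⋯ + c_{j-1}`. -/
noncomputable def latticeFactor (c : ℕ → Site → ℝ) (j n : ℕ) (y : Site) : ℝ :=
  Real.exp (-(8 * Real.pi) * (sumCov c n j 0 - sumCov c n j y))

/-- The continuum counterpart of `latticeFactor`. -/
noncomputable def continuumFactor (γ : ℕ) (V : Plane → ℝ) (j n : ℕ) (x : Plane) : ℝ :=
  Real.exp (8 * Real.pi * (V (((γ : ℝ) ^ n)⁻¹ • x) - V (((γ : ℝ) ^ j)⁻¹ • x)))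

lemma continuumFactor_self (j : ℕ) (x : Plane) : continuumFactor γ V j j x = 1 := by
  simp [continuumFactor]

lemma latticeFactor_eq {j n : ℕ} (hn : n < j) (y : Site) : latticeFactor c j n y =
    latticeFactor c j (n + 1) y * Real.exp (-(8 * Real.pi) * (c n 0 - c n y)) := by
  rw [latticeFactor, latticeFactor, ← Real.exp_add]
  simp only [sumCov, Finset.sum_eq_sum_Ico_succ_bot hn]
  ring_nf

lemma continuumFactor_eq (j n : ℕ) (x : Plane) : continuumFactor γ V j n x =
    continuumFactor γ V j (n + 1) x * Real.exp (-(8 * Real.pi) *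
      (sliceProfile γ V 0 - sliceProfile γ V (((γ : ℝ) ^ n)⁻¹ • x))) := by
  rw [continuumFactor, continuumFactor, ← Real.exp_add, sliceProfile, sliceProfile, smul_smul,
    pow_succ', mul_inv]
  congr 1
  simp only [smul_zero]
  ring

lemma continuumFactor_succ (j n : ℕ) (x : Plane) : continuumFactor γ V (j + 1) n x =
    continuumFactor γ V j n x * Real.exp (-(8 * Real.pi) *
      (sliceProfile γ V 0 - sliceProfile γ V (((γ : ℝ) ^ j)⁻¹ • x))) := by
  rw [continuumFactor, continuumFactor, ← Real.exp_add, sliceProfile, sliceProfile, smul_smul,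
    pow_succ', mul_inv]
  congr 1
  simp only [smul_zero]
  ring

lemma exp_sliceProfile_zero (hγ : 1 < γ) (V : Plane → ℝ) :
    Real.exp (-(8 * Real.pi) * sliceProfile γ V 0) = ((γ : ℝ) ^ 4)⁻¹ := by
  have hg : (0 : ℝ) < γ := by positivity
  have : -(8 * Real.pi) * sliceProfile γ V 0 = -(Real.log γ * 4) := by
    rw [sliceProfile_zero]; field_simp; ring
  rw [this, Real.exp_neg, Real.exp_mul, Real.exp_log hg]
  norm_num

/-- Expanding e^{8πc_n(y)} - 1 exhibits each term as a difference of the factors at n and n + 1. The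
sum telescopes once e^{-8πc_n(0)} is replaced by its limit γ^{-4}. -/
lemma neutralKernel_eq {α : ℝ} (hα : α ^ 2 = 8 * Real.pi) (j : ℕ) (y : Site) :
    neutralKernel α γ c j y = ∑ n ∈ Finset.range j, (latticeFactor c j n y -
      Real.exp (-(8 * Real.pi) * c n 0) * latticeFactor c j (n + 1) y) * ((γ : ℝ) ^ (4 * n))⁻¹ := by
  refine Finset.sum_congr rfl fun n hn => ?_
  rw [latticeFactor_eq (by simpa using hn), hα, latticeFactor]
  have : Real.exp (-(8 * Real.pi) * (c n 0 - c n y)) =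
      Real.exp (-(8 * Real.pi) * c n 0) * Real.exp (8 * Real.pi * c n y) := by
    rw [← Real.exp_add]; ring_nf
  rw [this]
  ring

/-- The limit of the neutral kernel. -/
lemma sum_continuumFactor (j : ℕ) (x : Plane) :
    ∑ n ∈ Finset.range j, (continuumFactor γ V j n x -
      ((γ : ℝ) ^ 4)⁻¹ * continuumFactor γ V j (n + 1) x) * ((γ : ℝ) ^ (4 * n))⁻¹ =
    continuumFactor γ V j 0 x - ((γ : ℝ) ^ (4 * j))⁻¹ := by
  have : ∀ n, (continuumFactor γ V j n x -
      ((γ : ℝ) ^ 4)⁻¹ * continuumFactor γ V j (n + 1) x) * ((γ : ℝ) ^ (4 * n))⁻¹ =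
      ((γ : ℝ) ^ (4 * n))⁻¹ * continuumFactor γ V j n x -
      ((γ : ℝ) ^ (4 * (n + 1)))⁻¹ * continuumFactor γ V j (n + 1) x := by
    intro n
    rw [mul_add, pow_add, mul_inv]
    ring
  simp_rw [this]
  rw [Finset.sum_range_sub', continuumFactor_self]
  simp

/-- A nonzero site has a coordinate of modulus at least 1 > 1/2, so V(y) is exactly logarithmic and
e^{8πV(y)} = e^{8πκ}|y|^{-4}. No error arises at short distances. -/
lemma continuumFactor_zero_sub (P : ScaleProfile γ c V κ K) (hγ : 1 < γ) {y : Site} (hy : y ≠ 0)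
    (j : ℕ) : continuumFactor γ V j 0 (toPlane y) - ((γ : ℝ) ^ (4 * j))⁻¹ =
      neutralProfile V κ (((γ : ℝ) ^ j)⁻¹ • toPlane y) / ‖toPlane y‖ ^ 4 := by
  have hg : (0 : ℝ) < γ := by positivity
  obtain ⟨i, hi⟩ := Function.ne_iff.1 hy
  have h1 : (1 : ℝ) ≤ |(y i : ℝ)| := by exact_mod_cast Int.one_le_abs hi
  have hz : 0 < ‖toPlane y‖ := by linarith [one_le_norm_toPlane hy]
  have hV := P.pot_eq_log hγ (x := toPlane y) (i := i) (by rw [toPlane_apply]; linarith)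
  rw [continuumFactor, pow_zero, inv_one, one_smul, hV, neutralProfile, expPot, sub_div,
    norm_inv_smul hγ]
  congr 1
  · rw [eq_div_iff (by positivity)]
    have : ‖toPlane y‖ ^ 4 = Real.exp (Real.log ‖toPlane y‖ * 4) := by
      rw [Real.exp_mul, Real.exp_log hz]; norm_num
    rw [this, ← Real.exp_add]
    congr 1
    field_simp
    ring
  · rw [pow_mul' (γ : ℝ)]
    field_simp

lemma abs_exp_slice_sub_le (P : ScaleProfile γ c V κ K) (hγ : 1 < γ) (n : ℕ) :
    |Real.exp (-(8 * Real.pi) * c n 0) - ((γ : ℝ) ^ 4)⁻¹| ≤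
      8 * Real.pi * K * Real.exp (8 * Real.pi * K) * rate γ ^ n := by
  have hg : (1 : ℝ) ≤ γ := by exact_mod_cast hγ.le
  have hK := P.nonneg
  have hr0 := rate_pos hγ
  have hr1 := rate_lt_one hγ
  have hp : (0 : ℝ) < 8 * Real.pi := by positivity
  have h1 := P.approx n 0
  rw [toPlane_zero, smul_zero] at h1
  have h2 : K * rate γ ^ n ≤ K := mul_le_of_le_one_right hK (pow_le_one₀ hr0.le hr1.le)
  have h3 : 0 ≤ sliceProfile γ V 0 := by
    rw [sliceProfile_zero]
    have := Real.log_nonneg hg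
    positivity
  have h4 := (abs_le.1 h1).1
  rw [← exp_sliceProfile_zero hγ V]
  refine (abs_exp_sub_exp_le (B := 8 * Real.pi * K) (by nlinarith) (by nlinarith)).trans ?_
  rw [← mul_sub, abs_mul, abs_neg, abs_of_pos hp]
  calc _ ≤ Real.exp (8 * Real.pi * K) * (8 * Real.pi * (K * rate γ ^ n)) := by gcongr
    _ = _ := by ring

lemma sum_Ico_rate_le (hγ : 1 < γ) (n j : ℕ) :
    ∑ k ∈ Finset.Ico n j, rate γ ^ k ≤ rate γ ^ n * (1 - rate γ)⁻¹ := by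
  rw [Finset.sum_Ico_eq_sum_range]
  simp_rw [pow_add]
  rw [← Finset.mul_sum]
  have := rate_pos hγ
  gcongr
  exact sum_geometric_le this.le (rate_lt_one hγ) _

/-- The errors of the slices n, …, j - 1 form a geometric series dominated by its first term,
uniformly in j. -/
lemma sumCov_approx (P : ScaleProfile γ c V κ K) (hγ : 1 < γ) {n j : ℕ} (hn : n ≤ j) (y : Site) :
    |(sumCov c n j 0 - sumCov c n j y) -
      (V (((γ : ℝ) ^ j)⁻¹ • toPlane y) - V (((γ : ℝ) ^ n)⁻¹ • toPlane y))| ≤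
        2 * K * (1 - rate γ)⁻¹ * rate γ ^ n := by
  have hK := P.nonneg
  have e : V (((γ : ℝ) ^ j)⁻¹ • toPlane y) - V (((γ : ℝ) ^ n)⁻¹ • toPlane y) =
      ∑ k ∈ Finset.Ico n j, (sliceProfile γ V 0 -
        sliceProfile γ V (((γ : ℝ) ^ k)⁻¹ • toPlane y)) := by
    have : ∀ k, sliceProfile γ V 0 - sliceProfile γ V (((γ : ℝ) ^ k)⁻¹ • toPlane y) =
        V (((γ : ℝ) ^ (k + 1))⁻¹ • toPlane y) - V (((γ : ℝ) ^ k)⁻¹ • toPlane y) := by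
      intro k
      rw [sliceProfile, sliceProfile, smul_smul, pow_succ', mul_inv]
      simp only [smul_zero]
      ring
    simp_rw [this]
    rw [Finset.sum_Ico_sub (fun k => V (((γ : ℝ) ^ k)⁻¹ • toPlane y)) hn]
  rw [e, sumCov, sumCov, ← Finset.sum_sub_distrib, ← Finset.sum_sub_distrib]
  refine (Finset.abs_sum_le_sum_abs _ _).trans ?_
  calc _ ≤ ∑ k ∈ Finset.Ico n j, 2 * K * rate γ ^ k := by
        refine Finset.sum_le_sum fun k _ => ?_
        have h1 := P.approx k 0
        have h2 := P.approx k y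
        rw [toPlane_zero, smul_zero] at h1
        rw [abs_le] at h1 h2 ⊢
        constructor <;> linarith
    _ ≤ 2 * K * (rate γ ^ n * (1 - rate γ)⁻¹) := by
        rw [← Finset.mul_sum]
        gcongr
        exact sum_Ico_rate_le hγ n j
    _ = _ := by ring

/-- Comparison of the lattice and continuum factors. -/
lemma exists_factor_bound (P : ScaleProfile γ c V κ K) (hγ : 1 < γ) :
    ∃ B, 0 ≤ B ∧ ∀ j n, n ≤ j → ∀ y ∈ boxSites (γ ^ (j + 1)),
      |continuumFactor γ V j n (toPlane y)| ≤ B ∧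
      |latticeFactor c j n y - continuumFactor γ V j n (toPlane y)| ≤ B * rate γ ^ n := by
  have hg : (1 : ℝ) < γ := by exact_mod_cast hγ
  have hK := P.nonneg
  have hr0 := rate_pos hγ
  have hr1 := rate_lt_one hγ
  have hr : 0 < 1 - rate γ := by linarith
  have hp : (0 : ℝ) < 8 * Real.pi := by positivity
  set D := 2 * K * (1 - rate γ)⁻¹ with hD
  have hD0 : 0 ≤ D := by positivity
  -- Only upper bounds on the exponents are needed. On the box |y|/γ^j ≤ 2γ, so -V at scale j is at
  -- most K(2γ)², while V at scale n is nonpositive; D covers the slice errors.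
  set T := 8 * Real.pi * (K * (2 * γ) ^ 2 + D) with hT
  refine ⟨Real.exp T * (1 + 8 * Real.pi * D), by positivity, fun j n hn y hy => ?_⟩
  have hz := norm_toPlane_le_of_mem hy
  push_cast at hz
  have hV : -V (((γ : ℝ) ^ j)⁻¹ • toPlane y) ≤ K * (2 * γ) ^ 2 := by
    refine (P.pot_quad _).trans ?_
    gcongr
    rw [norm_inv_smul hγ, inv_mul_le_iff₀ (by positivity)]
    exact hz.trans_eq (by rw [pow_succ]; ring)
  have hV' := P.pot_nonpos (((γ : ℝ) ^ n)⁻¹ • toPlane y)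
  have hap := P.sumCov_approx hγ hn y
  have hrn : D * rate γ ^ n ≤ D := mul_le_of_le_one_right hD0 (pow_le_one₀ hr0.le hr1.le)
  have b1 : 8 * Real.pi * (V (((γ : ℝ) ^ n)⁻¹ • toPlane y) - V (((γ : ℝ) ^ j)⁻¹ • toPlane y)) ≤ T := by
    rw [hT]; gcongr; linarith
  have b2 : -(8 * Real.pi) * (sumCov c n j 0 - sumCov c n j y) ≤ T := by
    have := (abs_le.1 hap).1
    rw [hT, neg_mul, ← mul_neg]
    gcongr
    linarith
  constructor
  · rw [continuumFactor, abs_of_pos (Real.exp_pos _)]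
    refine (Real.exp_le_exp.2 b1).trans (le_mul_of_one_le_right (Real.exp_pos _).le ?_)
    have : 0 ≤ 8 * Real.pi * D := by positivity
    linarith
  · rw [latticeFactor, continuumFactor]
    refine (abs_exp_sub_exp_le b2 b1).trans ?_
    have e : -(8 * Real.pi) * (sumCov c n j 0 - sumCov c n j y) - 8 * Real.pi *
        (V (((γ : ℝ) ^ n)⁻¹ • toPlane y) - V (((γ : ℝ) ^ j)⁻¹ • toPlane y)) =
        -(8 * Real.pi) * ((sumCov c n j 0 - sumCov c n j y) -
          (V (((γ : ℝ) ^ j)⁻¹ • toPlane y) - V (((γ : ℝ) ^ n)⁻¹ • toPlane y))) := by ring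
    rw [e, abs_mul, abs_neg, abs_of_pos hp]
    calc _ ≤ Real.exp T * (8 * Real.pi * (D * rate γ ^ n)) := by gcongr
      _ = Real.exp T * (8 * Real.pi * D) * rate γ ^ n := by ring
      _ ≤ _ := by gcongr; linarith

lemma lt_abs_of_notMem (hγ : 1 < γ) {n : ℕ} {y : Site} (hy : y ∉ boxSites (γ ^ (n + 1))) :
    ∃ i, ∀ k ≤ n, (γ : ℝ) ^ (k + 1) / 2 < |(y i : ℝ)| := by
  rw [mem_boxSites] at hy
  push Not at hy
  obtain ⟨i, hi⟩ := hy
  refine ⟨i, fun k hk => ?_⟩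
  have hg : (1 : ℝ) ≤ γ := by exact_mod_cast hγ.le
  have h1 : (γ : ℝ) ^ (n + 1) < |(y i : ℝ)| := by exact_mod_cast hi
  have h2 : (γ : ℝ) ^ (k + 1) ≤ (γ : ℝ) ^ (n + 1) := pow_le_pow_right₀ hg (by omega)
  have h3 : 0 < (γ : ℝ) ^ (k + 1) := by positivity
  linarith

/-- Comparison of the neutral kernel with its limit. -/
lemma exists_neutralKernel_bound (P : ScaleProfile γ c V κ K) (hγ : 1 < γ) {α : ℝ}
    (hα : α ^ 2 = 8 * Real.pi) : ∃ B, 0 ≤ B ∧ ∀ j, ∀ y ∈ boxSites (γ ^ (j + 1)),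
      |neutralKernel α γ c j y -
        (continuumFactor γ V j 0 (toPlane y) - ((γ : ℝ) ^ (4 * j))⁻¹)| ≤
      ∑ n ∈ Finset.range j, if y ∈ boxSites (γ ^ (n + 1)) then
        B * rate γ ^ n * ((γ : ℝ) ^ (4 * n))⁻¹ else 0 := by
  have hg : (1 : ℝ) < γ := by exact_mod_cast hγ
  have hg0 : (0 : ℝ) < γ := by linarith
  have hK := P.nonneg
  have hr0 := rate_pos hγ
  have hr1 := rate_lt_one hγ
  obtain ⟨B, hB, hF⟩ := P.exists_factor_bound hγ
  set D := 8 * Real.pi * K * Real.exp (8 * Real.pi * K) with hD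
  have hD0 : 0 ≤ D := by positivity
  refine ⟨B + (D * (2 * B) + B), by positivity, fun j y hy => ?_⟩
  rw [neutralKernel_eq hα, ← sum_continuumFactor, ← Finset.sum_sub_distrib]
  refine (Finset.abs_sum_le_sum_abs _ _).trans (Finset.sum_le_sum fun n hn => ?_)
  have hn' : n < j := by simpa using hn
  split_ifs with h
  · rw [← sub_mul, abs_mul, abs_of_pos (by positivity : 0 < ((γ : ℝ) ^ (4 * n))⁻¹)]
    gcongr
    obtain ⟨-, h1⟩ := hF j n hn'.le y hy
    obtain ⟨h2, h3⟩ := hF j (n + 1) hn' y hy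
    have h4 := P.abs_exp_slice_sub_le hγ n
    rw [← hD] at h4
    set x1 := latticeFactor c j n y
    set x2 := latticeFactor c j (n + 1) y
    set y1 := continuumFactor γ V j n (toPlane y)
    set y2 := continuumFactor γ V j (n + 1) (toPlane y)
    set e := Real.exp (-(8 * Real.pi) * c n 0)
    have h5 : rate γ ^ (n + 1) ≤ rate γ ^ n := pow_le_pow_of_le_one hr0.le hr1.le (by omega)
    have h6 : |x2| ≤ 2 * B := by
      have h7 : B * rate γ ^ (n + 1) ≤ B :=
        mul_le_of_le_one_right hB (pow_le_one₀ hr0.le hr1.le)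
      have := abs_sub_abs_le_abs_sub x2 y2
      linarith
    have h8 : ((γ : ℝ) ^ 4)⁻¹ ≤ 1 := inv_le_one_of_one_le₀ (one_le_pow₀ hg.le)
    have e1 : x1 - e * x2 - (y1 - ((γ : ℝ) ^ 4)⁻¹ * y2) =
        (x1 - y1) - ((e - ((γ : ℝ) ^ 4)⁻¹) * x2 + ((γ : ℝ) ^ 4)⁻¹ * (x2 - y2)) := by ring
    rw [e1]
    refine (abs_sub _ _).trans ((add_le_add_right (abs_add_le _ _) _).trans ?_)
    rw [abs_mul, abs_mul, abs_of_pos (by positivity : 0 < ((γ : ℝ) ^ 4)⁻¹)]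
    calc _ ≤ B * rate γ ^ n + ((D * rate γ ^ n) * (2 * B) + 1 * (B * rate γ ^ n)) := by
          gcongr
          exact h3.trans (by gcongr)
      _ = _ := by ring
  -- Beyond the range of slice n both the lattice term and its limit vanish exactly. This
  -- restriction to the box of scale n is what makes the error summable against |y|⁴.
  · obtain ⟨i, hi⟩ := lt_abs_of_notMem hγ h
    have h1 : c n y = 0 := P.range n y ⟨i, hi n le_rfl⟩
    have h2 : sliceProfile γ V (((γ : ℝ) ^ n)⁻¹ • toPlane y) = 0 := by
      refine P.profile_range _ ⟨i, ?_⟩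
      rw [PiLp.smul_apply, smul_eq_mul, toPlane_apply, abs_mul, abs_of_pos (by positivity),
        lt_inv_mul_iff₀ (by positivity)]
      refine lt_of_eq_of_lt ?_ (hi n le_rfl)
      rw [pow_succ]; ring
    rw [latticeFactor_eq hn', h1, continuumFactor_eq j n, h2, sub_zero, sub_zero,
      exp_sliceProfile_zero hγ]
    refine le_of_eq ?_
    rw [abs_eq_zero]
    ring

end ScaleProfile

end CoulombGas

/-! ### Convergence of a_j. -/

namespace CoulombGas

open MeasureTheory Filter Topology Set

namespace ScaleProfile

variable {γ : ℕ} {c : ℕ → Site → ℝ} {V : Plane → ℝ} {κ K : ℝ}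

/-- The growth of the last slice over its range. -/
lemma exists_last_bound (P : ScaleProfile γ c V κ K) (hγ : 1 < γ) :
    ∃ B, 0 ≤ B ∧ ∀ j, ∀ y ∈ boxSites (γ ^ (j + 1)),
      |Real.exp (-(8 * Real.pi) * (c j 0 - c j y)) - 1| ≤
        B * (((γ : ℝ) ^ j)⁻¹ * ‖toPlane y‖) ^ 2 ∧
      |Real.exp (-(8 * Real.pi) * (c j 0 - c j y)) - Real.exp (-(8 * Real.pi) *
        (sliceProfile γ V 0 - sliceProfile γ V (((γ : ℝ) ^ j)⁻¹ • toPlane y)))| ≤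
        B * rate γ ^ j * (((γ : ℝ) ^ j)⁻¹ * ‖toPlane y‖) := by
  have hg : (1 : ℝ) < γ := by exact_mod_cast hγ
  have hK := P.nonneg
  have hr0 := rate_pos hγ
  have hr1 := rate_lt_one hγ
  have hp : (0 : ℝ) < 8 * Real.pi := by positivity
  -- On the box the rescaled length is at most 2γ: the first term bounds the lattice increment, the
  -- second its distance from the continuum increment.
  set T := 8 * Real.pi * (K * (2 * γ) ^ 2 + K * (2 * γ)) with hT
  refine ⟨8 * Real.pi * K * Real.exp T, by positivity, fun j y hy => ?_⟩
  have hz := norm_toPlane_le_of_mem hy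
  push_cast at hz
  set t := ((γ : ℝ) ^ j)⁻¹ * ‖toPlane y‖ with ht
  have ht0 : 0 ≤ t := by positivity
  have ht1 : t ≤ 2 * γ := by
    rw [ht, inv_mul_le_iff₀ (by positivity)]
    exact hz.trans_eq (by rw [pow_succ]; ring)
  have hq := P.quad j y
  have hi := P.approx_incr j y
  rw [← ht] at hq hi
  have hq' : K * t ^ 2 ≤ K * (2 * γ) ^ 2 := by gcongr
  have hi' : K * rate γ ^ j * t ≤ K * (2 * γ) := by
    have : K * rate γ ^ j ≤ K := mul_le_of_le_one_right hK (pow_le_one₀ hr0.le hr1.le)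
    gcongr
  have hpos : 0 ≤ K * (2 * γ) := by positivity
  set d := c j 0 - c j y
  set d' := sliceProfile γ V 0 - sliceProfile γ V (((γ : ℝ) ^ j)⁻¹ • toPlane y)
  have b1 : -(8 * Real.pi) * d ≤ T := by
    have := (abs_le.1 hq).1
    rw [hT, neg_mul, ← mul_neg]
    gcongr
    linarith
  have b2 : -(8 * Real.pi) * d' ≤ T := by
    have := (abs_le.1 hq).1
    have := (abs_le.1 hi).2
    rw [hT, neg_mul, ← mul_neg]
    gcongr
    linarith
  have b3 : |-(8 * Real.pi) * d| ≤ 8 * Real.pi * (K * t ^ 2) := by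
    rw [abs_mul, abs_neg, abs_of_pos hp]
    gcongr
  constructor
  · refine (abs_exp_sub_one_le _).trans ?_
    have : |-(8 * Real.pi) * d| ≤ T := b3.trans (by rw [hT]; gcongr; linarith)
    calc _ ≤ 8 * Real.pi * (K * t ^ 2) * Real.exp T := by gcongr
      _ = _ := by ring
  · refine (abs_exp_sub_exp_le b1 b2).trans ?_
    rw [← mul_sub, abs_mul, abs_neg, abs_of_pos hp]
    calc _ ≤ Real.exp T * (8 * Real.pi * (K * rate γ ^ j * t)) := by gcongr
      _ = _ := by ring

/-- The summand of `a_j`. -/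
noncomputable def aSummand (α : ℝ) (γ : ℕ) (c : ℕ → Site → ℝ) (j : ℕ) (y : Site) : ℝ :=
  sqLen y * (neutralKernel α γ c j y * (Real.exp (-α ^ 2 * (c j 0 - c j y)) - 1) +
    Real.exp (-α ^ 2 * c j 0) * (Real.exp (α ^ 2 * c j y) - 1) * ((γ : ℝ) ^ (4 * j))⁻¹)

lemma aSummand_eq {α : ℝ} (hα : α ^ 2 = 8 * Real.pi) (j : ℕ) (y : Site) : aSummand α γ c j y =
    ‖toPlane y‖ ^ 2 * (neutralKernel α γ c j y * (Real.exp (-(8 * Real.pi) * (c j 0 - c j y)) - 1) +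
      (Real.exp (-(8 * Real.pi) * (c j 0 - c j y)) - Real.exp (-(8 * Real.pi) * c j 0)) *
        ((γ : ℝ) ^ (4 * j))⁻¹) := by
  rw [aSummand, sqLen_eq_norm_sq, hα]
  have : Real.exp (-(8 * Real.pi) * (c j 0 - c j y)) =
      Real.exp (-(8 * Real.pi) * c j 0) * Real.exp (8 * Real.pi * c j y) := by
    rw [← Real.exp_add]; ring_nf
  rw [this]
  ring

lemma aSummand_eq_zero (P : ScaleProfile γ c V κ K) (hγ : 1 < γ) {α : ℝ}
    {j : ℕ} {y : Site} (hy : y ∉ boxSites (γ ^ (j + 1))) :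
    aSummand α γ c j y = 0 := by
  obtain ⟨i, hi⟩ := lt_abs_of_notMem hγ hy
  have h0 : ∀ k ≤ j, c k y = 0 := fun k hk => P.range k y ⟨i, hi k hk⟩
  have : neutralKernel α γ c j y = 0 := by
    refine Finset.sum_eq_zero fun n hn => ?_
    rw [h0 n (by have := Finset.mem_range.1 hn; omega)]
    simp
  rw [aSummand, this, h0 j le_rfl]
  simp

/-- With w_j = f_j - γ^{-4j} and f_{j+1} = f_j q, one has w_j (q - 1) + (q - γ^{-4}) γ^{-4j} =
w_{j+1} - w_j. The two terms of a_j are together the increment of the limiting neutral kernel. -/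
lemma limitSummand_eq (P : ScaleProfile γ c V κ K) (hγ : 1 < γ) {y : Site} (hy : y ≠ 0) (j : ℕ) :
    limitSummand γ V κ j (toPlane y) = ‖toPlane y‖ ^ 2 *
      (neutralProfile V κ (((γ : ℝ) ^ j)⁻¹ • toPlane y) / ‖toPlane y‖ ^ 4 *
        (Real.exp (-(8 * Real.pi) *
          (sliceProfile γ V 0 - sliceProfile γ V (((γ : ℝ) ^ j)⁻¹ • toPlane y))) - 1) +
      (Real.exp (-(8 * Real.pi) *
          (sliceProfile γ V 0 - sliceProfile γ V (((γ : ℝ) ^ j)⁻¹ • toPlane y))) - ((γ : ℝ) ^ 4)⁻¹) *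
        ((γ : ℝ) ^ (4 * j))⁻¹) := by
  have hz : 0 < ‖toPlane y‖ := by linarith [one_le_norm_toPlane hy]
  have h0 := P.continuumFactor_zero_sub hγ hy j
  have h1 := P.continuumFactor_zero_sub hγ hy (j + 1)
  rw [continuumFactor_succ] at h1
  set q := Real.exp (-(8 * Real.pi) *
    (sliceProfile γ V 0 - sliceProfile γ V (((γ : ℝ) ^ j)⁻¹ • toPlane y)))
  have e : limitSummand γ V κ j (toPlane y) = ‖toPlane y‖ ^ 2 *
      (neutralProfile V κ (((γ : ℝ) ^ (j + 1))⁻¹ • toPlane y) / ‖toPlane y‖ ^ 4 -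
        neutralProfile V κ (((γ : ℝ) ^ j)⁻¹ • toPlane y) / ‖toPlane y‖ ^ 4) := by
    rw [limitSummand]; field_simp
  rw [e, ← h0, ← h1, mul_add 4, pow_add, mul_inv]
  ring

lemma sum_boxSites_norm_pow_le (hγ : 1 < γ) (n : ℕ) :
    ∑ y ∈ boxSites (γ ^ (n + 1)), ‖toPlane y‖ ^ 4 ≤ 144 * (γ : ℝ) ^ (6 * (n + 1)) := by
  have hg : (1 : ℝ) ≤ γ := by exact_mod_cast hγ.le
  have h1 : (1 : ℝ) ≤ (γ : ℝ) ^ (n + 1) := one_le_pow₀ hg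
  calc _ ≤ ∑ y ∈ boxSites (γ ^ (n + 1)), (2 * (γ : ℝ) ^ (n + 1)) ^ 4 := by
        refine Finset.sum_le_sum fun y hy => ?_
        have := norm_toPlane_le_of_mem hy
        push_cast at this
        gcongr
    _ = (2 * (γ : ℝ) ^ (n + 1) + 1) ^ 2 * (2 * (γ : ℝ) ^ (n + 1)) ^ 4 := by
        rw [Finset.sum_const, card_boxSites, nsmul_eq_mul]
        push_cast
        ring
    _ ≤ (3 * (γ : ℝ) ^ (n + 1)) ^ 2 * (2 * (γ : ℝ) ^ (n + 1)) ^ 4 := by gcongr; linarith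
    _ = _ := by rw [pow_mul' (γ : ℝ)]; ring

/-- Since γ⁻¹ is the fourth power of the rate, the decay in j - n is faster than the loss in passing
from n to j, and a summable power is left over. -/
lemma sum_rate_mul_le (hγ : 1 < γ) (j : ℕ) :
    ∑ n ∈ Finset.range j, rate γ ^ n * ((γ : ℝ) ^ (j - n))⁻¹ ≤ rate γ ^ j * (1 - rate γ)⁻¹ := by
  have hr0 := rate_pos hγ
  have hr1 := rate_lt_one hγ
  calc _ ≤ ∑ n ∈ Finset.range j, rate γ ^ j * rate γ ^ (j - 1 - n) := by
        refine Finset.sum_le_sum fun n hn => ?_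
        have hn' : n < j := by simpa using hn
        have e : ((γ : ℝ) ^ (j - n))⁻¹ = rate γ ^ (4 * (j - n)) := by
          rw [pow_mul, rate_pow_four, inv_pow]
        rw [e, ← pow_add, ← pow_add]
        exact pow_le_pow_of_le_one hr0.le hr1.le (by omega)
    _ = rate γ ^ j * ∑ n ∈ Finset.range j, rate γ ^ n := by
        rw [← Finset.mul_sum, Finset.sum_range_reflect (fun n => rate γ ^ n)]
    _ ≤ _ := by
        gcongr
        exact sum_geometric_le hr0.le hr1 _

/-- The error in the neutral kernel contributes little to `a_j`. -/
lemma sum_kernel_error_le (hγ : 1 < γ) (j : ℕ) :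
    ∑ y ∈ boxSites (γ ^ (j + 1)), (∑ n ∈ Finset.range j, if y ∈ boxSites (γ ^ (n + 1)) then
        rate γ ^ n * ((γ : ℝ) ^ (4 * n))⁻¹ else 0) * (((γ : ℝ) ^ j)⁻¹ * ‖toPlane y‖ ^ 2) ^ 2 ≤
      144 * (γ : ℝ) ^ 6 * (1 - rate γ)⁻¹ * rate γ ^ j := by
  have hg : (1 : ℝ) ≤ γ := by exact_mod_cast hγ.le
  have hg0 : (0 : ℝ) < γ := by linarith
  have hr0 := rate_pos hγ
  have hr1 := rate_lt_one hγ
  simp_rw [Finset.sum_mul]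
  -- For fixed n only the sites of box n + 1 count, and their sum of |y|⁴ is O(γ^{6(n+1)}). With
  -- γ^{-4n} γ^{-2j} this leaves γ^{-2(j-n)}, up to γ⁶.
  rw [Finset.sum_comm]
  calc _ ≤ ∑ n ∈ Finset.range j, 144 * (γ : ℝ) ^ 6 * (rate γ ^ n * ((γ : ℝ) ^ (j - n))⁻¹) := by
        refine Finset.sum_le_sum fun n hn => ?_
        have hn' : n < j := by simpa using hn
        have hsub : boxSites (γ ^ (n + 1)) ⊆ boxSites (γ ^ (j + 1)) :=
          boxSites_mono (Nat.pow_le_pow_right (by omega) (by omega))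
        rw [← Finset.sum_subset hsub (fun y _ hy => by rw [if_neg hy, zero_mul])]
        calc _ = ∑ y ∈ boxSites (γ ^ (n + 1)),
              rate γ ^ n * ((γ : ℝ) ^ (4 * n))⁻¹ * (((γ : ℝ) ^ j)⁻¹) ^ 2 * ‖toPlane y‖ ^ 4 := by
              refine Finset.sum_congr rfl fun y hy => ?_
              rw [if_pos hy]; ring
          _ ≤ rate γ ^ n * ((γ : ℝ) ^ (4 * n))⁻¹ * (((γ : ℝ) ^ j)⁻¹) ^ 2 *
              (144 * (γ : ℝ) ^ (6 * (n + 1))) := by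
              rw [← Finset.mul_sum]
              gcongr
              exact sum_boxSites_norm_pow_le hγ n
          _ = 144 * (γ : ℝ) ^ 6 * (rate γ ^ n * (((γ : ℝ) ^ (j - n))⁻¹) ^ 2) := by
              obtain ⟨k, rfl⟩ := Nat.exists_eq_add_of_lt hn'
              rw [show n + k + 1 - n = k + 1 by omega]
              field_simp
              ring
          _ ≤ _ := by
              gcongr
              exact pow_le_of_le_one (by positivity)
                (inv_le_one_of_one_le₀ (one_le_pow₀ hg)) two_ne_zero
    _ ≤ 144 * (γ : ℝ) ^ 6 * (rate γ ^ j * (1 - rate γ)⁻¹) := by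
        rw [← Finset.mul_sum]
        gcongr
        exact sum_rate_mul_le hγ j
    _ = _ := by ring

/-- The convergence of `a_j`. -/
lemma exists_aCoeff_bound (P : ScaleProfile γ c V κ K) (hγ : 1 < γ) {α : ℝ}
    (hα : α ^ 2 = 8 * Real.pi) : ∃ B, ∀ j, |aCoeff α γ c j -
      8 * Real.pi ^ 2 * Real.exp (8 * Real.pi * κ) * Real.log γ| ≤ B * rate γ ^ j := by
  have hg : (1 : ℝ) < γ := by exact_mod_cast hγ
  have hg0 : (0 : ℝ) < γ := by linarith
  have hK := P.nonneg
  have hr0 := rate_pos hγ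
  have hr1 := rate_lt_one hγ
  obtain ⟨B₁, hB₁, hw⟩ := P.exists_neutralKernel_bound hγ hα
  obtain ⟨B₂, hB₂, hl⟩ := P.exists_last_bound hγ
  obtain ⟨B₃, hB₃, hb, -⟩ := P.exists_neutralProfile_bound hγ
  obtain ⟨B₄, hB₄, hs⟩ := P.exists_sum_limitSummand hγ
  set D := 8 * Real.pi * K * Real.exp (8 * Real.pi * K) with hD
  have hD0 : 0 ≤ D := by positivity
  -- Three errors, in this order: the neutral kernel against its limit, times the growth of the last
  -- slice; the last slice against its continuum form, times the limiting kernel; the explicit last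
  -- term against its limit.
  have key : ∀ j, ∀ y ∈ boxSites (γ ^ (j + 1)),
      |aSummand α γ c j y - limitSummand γ V κ j (toPlane y)| ≤
      B₁ * B₂ * ((∑ n ∈ Finset.range j, if y ∈ boxSites (γ ^ (n + 1)) then
        rate γ ^ n * ((γ : ℝ) ^ (4 * n))⁻¹ else 0) * (((γ : ℝ) ^ j)⁻¹ * ‖toPlane y‖ ^ 2) ^ 2) +
      B₃ * B₂ * rate γ ^ j * ((γ : ℝ) ^ j)⁻¹ * ‖toPlane y‖⁻¹ +
      4 * γ ^ 2 * ((B₂ * (2 * γ) + D) * rate γ ^ j) * (((γ : ℝ) ^ j)⁻¹) ^ 2 := by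
    intro j y hy
    have hz := norm_toPlane_le_of_mem hy
    push_cast at hz
    obtain ⟨h1, h2⟩ := hl j y hy
    have h3 := hw j y hy
    have h4 := P.abs_exp_slice_sub_le hγ j
    rw [← hD] at h4
    set E := ∑ n ∈ Finset.range j, if y ∈ boxSites (γ ^ (n + 1)) then
      rate γ ^ n * ((γ : ℝ) ^ (4 * n))⁻¹ else 0 with hE
    have hE0 : 0 ≤ E := Finset.sum_nonneg fun n _ => by split_ifs <;> positivity
    have hE1 : (∑ n ∈ Finset.range j, if y ∈ boxSites (γ ^ (n + 1)) then
        B₁ * rate γ ^ n * ((γ : ℝ) ^ (4 * n))⁻¹ else 0) = B₁ * E := by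
      rw [hE, Finset.mul_sum]
      refine Finset.sum_congr rfl fun n _ => ?_
      split_ifs <;> ring
    rw [hE1] at h3
    by_cases hy0 : y = 0
    · have e1 : aSummand α γ c j y = 0 := by simp [aSummand, sqLen, hy0]
      have e2 : limitSummand γ V κ j (toPlane y) = 0 := by simp [limitSummand, hy0, toPlane_zero]
      rw [e1, e2, sub_zero, abs_zero]
      positivity
    rw [P.continuumFactor_zero_sub hγ hy0] at h3
    have hz1 := one_le_norm_toPlane hy0
    rw [aSummand_eq hα, P.limitSummand_eq hγ hy0]
    set z := ‖toPlane y‖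
    set Q := Real.exp (-(8 * Real.pi) * (c j 0 - c j y))
    set q := Real.exp (-(8 * Real.pi) *
      (sliceProfile γ V 0 - sliceProfile γ V (((γ : ℝ) ^ j)⁻¹ • toPlane y)))
    set w := neutralKernel α γ c j y
    set N := neutralProfile V κ (((γ : ℝ) ^ j)⁻¹ • toPlane y) with hN
    set e := Real.exp (-(8 * Real.pi) * c j 0)
    have hNb : |N| ≤ B₃ := hb _
    have e1 : z ^ 2 * (w * (Q - 1) + (Q - e) * ((γ : ℝ) ^ (4 * j))⁻¹) -
        z ^ 2 * (N / z ^ 4 * (q - 1) + (q - ((γ : ℝ) ^ 4)⁻¹) * ((γ : ℝ) ^ (4 * j))⁻¹) =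
        z ^ 2 * ((w - N / z ^ 4) * (Q - 1)) + z ^ 2 * (N / z ^ 4 * (Q - q)) +
        z ^ 2 * (((Q - q) - (e - ((γ : ℝ) ^ 4)⁻¹)) * ((γ : ℝ) ^ (4 * j))⁻¹) := by ring
    have hs0 : 0 < ((γ : ℝ) ^ j)⁻¹ := by positivity
    have hz2 : ((γ : ℝ) ^ j)⁻¹ * z ≤ 2 * γ := by
      rw [inv_mul_le_iff₀ (by positivity)]
      exact hz.trans_eq (by rw [pow_succ]; ring)
    have e4 : ((γ : ℝ) ^ (4 * j))⁻¹ = (((γ : ℝ) ^ j)⁻¹) ^ 4 := by rw [pow_mul', inv_pow]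
    rw [e1]
    refine (abs_add_three _ _ _).trans (add_le_add_three ?_ ?_ ?_)
    · rw [abs_mul, abs_mul, abs_of_nonneg (by positivity : 0 ≤ z ^ 2)]
      calc _ ≤ z ^ 2 * (B₁ * E * (B₂ * (((γ : ℝ) ^ j)⁻¹ * z) ^ 2)) := by gcongr
        _ = _ := by ring
    · rw [abs_mul, abs_mul, abs_div, abs_of_nonneg (by positivity : 0 ≤ z ^ 2),
        abs_of_nonneg (by positivity : 0 ≤ z ^ 4)]
      calc _ ≤ z ^ 2 * (B₃ / z ^ 4 * (B₂ * rate γ ^ j * (((γ : ℝ) ^ j)⁻¹ * z))) := by gcongr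
        _ = _ := by field_simp
    · rw [abs_mul, abs_mul, abs_of_nonneg (by positivity : 0 ≤ z ^ 2),
        abs_of_nonneg (by positivity : 0 ≤ ((γ : ℝ) ^ (4 * j))⁻¹), e4]
      have h5 : |Q - q - (e - ((γ : ℝ) ^ 4)⁻¹)| ≤ (B₂ * (2 * γ) + D) * rate γ ^ j := by
        refine (abs_sub _ _).trans ((add_le_add h2 h4).trans ?_)
        calc _ ≤ B₂ * rate γ ^ j * (2 * γ) + D * rate γ ^ j := by gcongr
          _ = _ := by ring
      calc _ ≤ z ^ 2 * ((B₂ * (2 * γ) + D) * rate γ ^ j * (((γ : ℝ) ^ j)⁻¹) ^ 4) := by gcongr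
        _ = (((γ : ℝ) ^ j)⁻¹ * z) ^ 2 * ((B₂ * (2 * γ) + D) * rate γ ^ j) * (((γ : ℝ) ^ j)⁻¹) ^ 2 := by
            ring
        _ ≤ (2 * γ) ^ 2 * ((B₂ * (2 * γ) + D) * rate γ ^ j) * (((γ : ℝ) ^ j)⁻¹) ^ 2 := by gcongr
        _ = _ := by ring
  -- The prefactor is α²/2. The factor 8γ comes from the sum of inverse norms and 9γ² from the
  -- number of sites relative to γ^{2j}; B₄ is the error of replacing the sum by the integral.
  refine ⟨4 * Real.pi * (B₁ * B₂ * (144 * (γ : ℝ) ^ 6 * (1 - rate γ)⁻¹) + B₃ * B₂ * (8 * γ) +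
    4 * γ ^ 2 * (B₂ * (2 * γ) + D) * (9 * γ ^ 2) + B₄), fun j => ?_⟩
  have ea : aCoeff α γ c j = 4 * Real.pi * ∑ y ∈ boxSites (γ ^ (j + 1)), aSummand α γ c j y := by
    rw [aCoeff, ← tsum_eq_sum (L := SummationFilter.unconditional _)
      (fun y hy => P.aSummand_eq_zero hγ hy), hα]
    simp only [aSummand, hα]
    ring
  set S₁ := ∑ y ∈ boxSites (γ ^ (j + 1)), aSummand α γ c j y
  set S₂ := ∑ y ∈ boxSites (γ ^ (j + 1)), limitSummand γ V κ j (toPlane y) with hS₂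
  have hdiff : |S₁ - S₂| ≤ (B₁ * B₂ * (144 * (γ : ℝ) ^ 6 * (1 - rate γ)⁻¹) + B₃ * B₂ * (8 * γ) +
      4 * γ ^ 2 * (B₂ * (2 * γ) + D) * (9 * γ ^ 2)) * rate γ ^ j := by
    rw [← Finset.sum_sub_distrib]
    refine (Finset.abs_sum_le_sum_abs _ _).trans ((Finset.sum_le_sum (key j)).trans ?_)
    rw [Finset.sum_add_distrib, Finset.sum_add_distrib, ← Finset.mul_sum, ← Finset.mul_sum,
      Finset.sum_const, card_boxSites, nsmul_eq_mul]
    have hgj : (1 : ℝ) ≤ (γ : ℝ) ^ j := one_le_pow₀ hg.le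
    refine (add_le_add (add_le_add
      (b := B₁ * B₂ * (144 * (γ : ℝ) ^ 6 * (1 - rate γ)⁻¹ * rate γ ^ j))
      (d := B₃ * B₂ * (8 * γ) * rate γ ^ j) ?_ ?_)
      (d := 4 * γ ^ 2 * (B₂ * (2 * γ) + D) * (9 * γ ^ 2) * rate γ ^ j) ?_).trans_eq (by ring)
    · gcongr
      exact sum_kernel_error_le hγ j
    · have := sum_inv_norm_le (γ ^ (j + 1))
      push_cast at this
      calc _ ≤ B₃ * B₂ * rate γ ^ j * ((γ : ℝ) ^ j)⁻¹ * (8 * (γ : ℝ) ^ (j + 1)) := by gcongr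
        _ = _ := by rw [pow_succ]; field_simp
    · push_cast
      have h3 : 2 * (γ : ℝ) ^ (j + 1) + 1 ≤ 3 * (γ * γ ^ j) := by
        rw [pow_succ']
        nlinarith
      calc _ ≤ (3 * (γ * (γ : ℝ) ^ j)) ^ 2 * (4 * γ ^ 2 * ((B₂ * (2 * γ) + D) * rate γ ^ j) *
            (((γ : ℝ) ^ j)⁻¹) ^ 2) := by gcongr
        _ = _ := by field_simp; ring
  have hs' := hs j
  rw [← hS₂] at hs'
  have e : aCoeff α γ c j - 8 * Real.pi ^ 2 * Real.exp (8 * Real.pi * κ) * Real.log γ =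
      4 * Real.pi * ((S₁ - S₂) +
        (S₂ - 2 * Real.pi * Real.exp (8 * Real.pi * κ) * Real.log γ)) := by rw [ea]; ring
  rw [e, abs_mul, abs_of_pos (by positivity : (0 : ℝ) < 4 * Real.pi), mul_assoc (4 * Real.pi)]
  gcongr
  refine (abs_add_le _ _).trans ((add_le_add hdiff hs').trans_eq (by ring))

end ScaleProfile

end CoulombGas

/-! ### Fourier series on the Brillouin zone and Parseval's identity. -/

namespace CoulombGas

open MeasureTheory Filter Topology Set
open scoped ComplexConjugate

/-- The normalized Haar measure of the circle. -/
noncomputable local instance : MeasureSpace UnitAddCircle := ⟨AddCircle.haarAddCircle⟩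

local instance : IsProbabilityMeasure (volume : Measure UnitAddCircle) :=
  inferInstanceAs (IsProbabilityMeasure AddCircle.haarAddCircle)

/-- The representative of a point of the torus in the Brillouin zone. -/
noncomputable def torusRep (t : UnitAddTorus (Fin 2)) : Plane :=
  WithLp.toLp 2 fun i => 2 * Real.pi *
    (UnitAddTorus.measurableEquivPiIoc (fun _ : Fin 2 => (-(1 / 2) : ℝ)) t).1 i

lemma measurable_torusRep : Measurable torusRep := by
  refine (WithLp.measurable_toLp 2 _).comp (measurable_pi_lambda _ fun i => ?_)
  exact ((measurable_pi_apply i).comp (measurable_subtype_coe.comp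
    (UnitAddTorus.measurableEquivPiIoc _).measurable)).const_mul _

lemma torusRep_coe {x : Fin 2 → ℝ} (hx : ∀ i, x i ∈ Ioc (-(1 / 2) : ℝ) (-(1 / 2) + 1)) :
    torusRep (fun i => (x i : UnitAddCircle)) = (2 * Real.pi) • WithLp.toLp 2 x := by
  ext i
  simp only [torusRep, UnitAddTorus.coe_measurableEquivPiIoc_apply, PiLp.smul_apply, smul_eq_mul]
  rw [AddCircle.equivIoc_coe_of_mem (hx i)]

lemma coe_torusRep (t : UnitAddTorus (Fin 2)) (i : Fin 2) :
    ((torusRep t i / (2 * Real.pi) : ℝ) : UnitAddCircle) = t i := by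
  simp only [torusRep, UnitAddTorus.coe_measurableEquivPiIoc_apply]
  rw [mul_div_cancel_left₀ _ (by positivity), AddCircle.coe_equivIoc]

lemma mFourier_eq_exp (t : UnitAddTorus (Fin 2)) (y : Site) :
    UnitAddTorus.mFourier y t = Complex.exp (Complex.I * (pair (torusRep t) y : ℂ)) := by
  have h : ∀ i, fourier (y i) (t i) = Complex.exp (Complex.I * ((torusRep t i * y i : ℝ) : ℂ)) := by
    intro i
    rw [← coe_torusRep t i, fourier_coe_apply]
    congr 1
    push_cast
    have : (Real.pi : ℂ) ≠ 0 := by exact_mod_cast Real.pi_ne_zero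
    field_simp
  simp only [UnitAddTorus.mFourier, ContinuousMap.coe_mk, Fin.prod_univ_two, h, ← Complex.exp_add,
    pair, Fin.sum_univ_two]
  push_cast
  ring_nf

/-- The Haar probability measure is Lebesgue measure on a unit cube, that is (2π)^{-2} times
Lebesgue measure on the zone. The half-open and closed cubes differ by a null set. -/
lemma integral_comp_torusRep (γ : ℕ) (F : Plane → ℂ) :
    ∫ t, F (torusRep t) = (((2 * Real.pi) ^ 2 : ℝ) : ℂ)⁻¹ * ∫ p in box γ 0, F p := by
  rw [UnitAddTorus.integral_preimage _ (fun _ => (-(1 / 2) : ℝ))]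
  have hS : {x : Fin 2 → ℝ | ∀ i, x i ∈ Ioc (-(1 / 2) : ℝ) (-(1 / 2) + 1)} =
      pi univ fun _ : Fin 2 => Ioc (-(1 / 2) : ℝ) (-(1 / 2) + 1) := by ext; simp
  have hm : MeasurableSet {x : Fin 2 → ℝ | ∀ i, x i ∈ Ioc (-(1 / 2) : ℝ) (-(1 / 2) + 1)} := by
    rw [hS]; exact MeasurableSet.univ_pi fun _ => measurableSet_Ioc
  rw [setIntegral_congr_fun (g := fun x => F ((2 * Real.pi) • WithLp.toLp 2 x)) hm
    (fun x hx => by simp only; rw [torusRep_coe hx]), hS]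
  have h1 : (pi univ fun _ : Fin 2 => Ioc (-(1 / 2) : ℝ) (-(1 / 2) + 1)) =ᵐ[volume]
      Icc (fun _ : Fin 2 => (-(1 / 2) : ℝ)) (fun _ => (-(1 / 2) + 1 : ℝ)) :=
    Measure.univ_pi_Ioc_ae_eq_Icc
  rw [setIntegral_congr_set h1]
  have h2 := (PiLp.volume_preserving_ofLp (Fin 2)).setIntegral_preimage_emb
    (MeasurableEquiv.toLp 2 (Fin 2 → ℝ)).symm.measurableEmbedding
    (fun x => F ((2 * Real.pi) • WithLp.toLp 2 x))
    (Icc (fun _ : Fin 2 => (-(1 / 2) : ℝ)) (fun _ => (-(1 / 2) + 1 : ℝ)))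
  rw [← h2]
  have h3 : (WithLp.ofLp : Plane → Fin 2 → ℝ) ⁻¹'
      (Icc (fun _ : Fin 2 => (-(1 / 2) : ℝ)) (fun _ => (-(1 / 2) + 1 : ℝ))) =
      {z : Plane | (2 * Real.pi) • z ∈ box γ 0} := by
    ext z
    simp only [mem_preimage, mem_Icc, Pi.le_def, box, mem_ofPred_eq, PiLp.smul_apply, smul_eq_mul,
      abs_mul, pow_zero, mul_one, abs_of_pos Real.two_pi_pos]
    have hpi := Real.pi_pos
    constructor
    · rintro ⟨ha, hb⟩ i
      have : |z i| ≤ 1 / 2 := abs_le.2 ⟨by linarith [ha i], by linarith [hb i]⟩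
      nlinarith
    · intro h
      have h' : ∀ i, |z i| ≤ 1 / 2 := fun i => by
        have := h i
        by_contra hc
        nlinarith [not_le.1 hc]
      exact ⟨fun i => by linarith [(abs_le.1 (h' i)).1], fun i => by linarith [(abs_le.1 (h' i)).2]⟩
  have hm3 : MeasurableSet {z : Plane | (2 * Real.pi) • z ∈ box γ 0} :=
    (measurableSet_box γ 0).preimage (measurable_const_smul _)
  rw [h3, ← integral_indicator hm3, ← integral_indicator (measurableSet_box γ 0)]
  have h4 : ({z : Plane | (2 * Real.pi) • z ∈ box γ 0}.indicator
      fun z : Plane => F ((2 * Real.pi) • WithLp.toLp 2 z.ofLp)) =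
      fun z => (box γ 0).indicator F ((2 * Real.pi) • z) := by
    ext z
    by_cases hz : (2 * Real.pi) • z ∈ box γ 0
    · rw [indicator_of_mem hz, indicator_of_mem (by exact hz)]
    · rw [indicator_of_notMem hz, indicator_of_notMem (by exact hz)]
  rw [h4, Measure.integral_comp_smul volume, finrank_plane, abs_of_pos (by positivity),
    Complex.real_smul, Complex.ofReal_inv]

/-- The inverse Fourier transform on the lattice. -/
noncomputable def latticeFourier (γ : ℕ) (f : Plane → ℂ) (y : Site) : ℂ :=
  (((2 * Real.pi) ^ 2 : ℝ) : ℂ)⁻¹ *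
    ∫ p in box γ 0, Complex.exp (Complex.I * (pair p y : ℂ)) * f p

lemma mFourierCoeff_comp_torusRep (γ : ℕ) (f : Plane → ℂ) (y : Site) :
    UnitAddTorus.mFourierCoeff (fun t => f (torusRep t)) (-y) = latticeFourier γ f y := by
  rw [latticeFourier, ← integral_comp_torusRep γ
    (fun p => Complex.exp (Complex.I * (pair p y : ℂ)) * f p), UnitAddTorus.mFourierCoeff]
  simp_rw [neg_neg, mFourier_eq_exp, smul_eq_mul]

/-- Parseval's identity on the lattice. -/
lemma hasSum_latticeFourier (γ : ℕ) {f g : Plane → ℂ} {a : ℝ} (hf : Measurable f)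
    (hg : Measurable g) (bf : ∀ p, ‖f p‖ ≤ a) (bg : ∀ p, ‖g p‖ ≤ a) :
    HasSum (fun y => conj (latticeFourier γ f y) * latticeFourier γ g y)
      ((((2 * Real.pi) ^ 2 : ℝ) : ℂ)⁻¹ * ∫ p in box γ 0, conj (f p) * g p) := by
  have m : ∀ h : Plane → ℂ, Measurable h → (∀ p, ‖h p‖ ≤ a) →
      MemLp (fun t => h (torusRep t)) 2 (volume : Measure (UnitAddTorus (Fin 2))) :=
    fun h hm hb => MemLp.of_bound (hm.comp measurable_torusRep).aestronglyMeasurable a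
      (Eventually.of_forall fun t => hb _)
  have c : ∀ (h : Plane → ℂ) (hm : Measurable h) (hb : ∀ p, ‖h p‖ ≤ a) (y : Site),
      UnitAddTorus.mFourierCoeff ((m h hm hb).toLp _) (-y) = latticeFourier γ h y := by
    intro h hm hb y
    rw [← mFourierCoeff_comp_torusRep]
    refine integral_congr_ae ?_
    filter_upwards [(m h hm hb).coeFn_toLp] with t ht
    rw [ht]
  have key := UnitAddTorus.hasSum_prod_mFourierCoeff ((m f hf bf).toLp _) ((m g hg bg).toLp _)
  -- Torus Fourier coefficients carry e^{-ip·y}, whereas the lattice transform carries e^{ip·y};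
  -- hence the reindexing by y ↦ -y.
  rw [← (Equiv.neg Site).hasSum_iff] at key
  have e : ∫ t, conj ((m f hf bf).toLp _ t) * ((m g hg bg).toLp _ t) =
      ∫ t, (fun p => conj (f p) * g p) (torusRep t) := by
    refine integral_congr_ae ?_
    filter_upwards [(m f hf bf).coeFn_toLp, (m g hg bg).coeFn_toLp] with t h1 h2
    rw [h1, h2]
  rw [e.trans (integral_comp_torusRep γ (fun p => conj (f p) * g p))] at key
  refine key.congr_fun fun y => ?_
  rw [← c f hf bf, ← c g hg bg]
  rfl

end CoulombGas

/-! ### Lattice gradients of blocks as energy integrals. -/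

namespace CoulombGas

open MeasureTheory Filter Topology Set
open scoped ComplexConjugate

/-- The numerator `F_h(γ^h p) - F_{h+m}(γ^{h+m} p)` of the Fourier transform of `m` consecutive
slices. -/
noncomputable def slabSymbol (γ : ℕ) (A : ℕ → ℕ → Plane → ℂ) (h m : ℕ) (p : Plane) : ℝ :=
  CutoffEstimates.increment γ A h m ((γ : ℝ) ^ h • p)

/-- The Fourier transform of the sum of `m` consecutive slices. -/
noncomputable def slabKernel (γ : ℕ) (A : ℕ → ℕ → Plane → ℂ) (h m : ℕ) : Plane → ℝ :=
  (box γ 0).indicator fun p => slabSymbol γ A h m p / lapSymbol p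

lemma slabSymbol_eq (γ : ℕ) (A : ℕ → ℕ → Plane → ℂ) (h m : ℕ) (p : Plane) :
    slabSymbol γ A h m p =
      cutoff A h ((γ : ℝ) ^ h • p) - cutoff A (h + m) ((γ : ℝ) ^ (h + m) • p) := by
  rw [slabSymbol, CutoffEstimates.increment, smul_smul, ← pow_add, add_comm m h]

lemma sum_slabSymbol (γ : ℕ) (A : ℕ → ℕ → Plane → ℂ) (h M : ℕ) (p : Plane) :
    ∑ m ∈ Finset.range M, slabSymbol γ A (h + m) 1 p = slabSymbol γ A h M p := by
  simp_rw [slabSymbol_eq, add_assoc]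
  exact Finset.sum_range_sub' (fun m => cutoff A (h + m) ((γ : ℝ) ^ (h + m) • p)) M

/-- Since F_0 = 1, the telescoping sum starts exactly at 1. This 1 is what later completes the
square in the energy. -/
lemma sum_slabSymbol_block (γ : ℕ) (A : ℕ → ℕ → Plane → ℂ) (M j : ℕ) (p : Plane) :
    ∑ n ∈ Finset.range j, slabSymbol γ A (n * M) M p =
      1 - cutoff A (j * M) ((γ : ℝ) ^ (j * M) • p) := by
  have : ∀ n, slabSymbol γ A (n * M) M p = cutoff A (n * M) ((γ : ℝ) ^ (n * M) • p) -
      cutoff A ((n + 1) * M) ((γ : ℝ) ^ ((n + 1) * M) • p) := fun n => by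
    rw [slabSymbol_eq, add_one_mul]
  simp_rw [this]
  rw [Finset.sum_range_sub' (fun n => cutoff A (n * M) ((γ : ℝ) ^ (n * M) • p))]
  simp [cutoff]

lemma sum_slabKernel (γ : ℕ) (A : ℕ → ℕ → Plane → ℂ) (h M : ℕ) (p : Plane) :
    ∑ m ∈ Finset.range M, slabKernel γ A (h + m) 1 p = slabKernel γ A h M p := by
  by_cases hp : p ∈ box γ 0
  · simp only [slabKernel, indicator_of_mem hp]
    rw [← Finset.sum_div, sum_slabSymbol]
  · simp [slabKernel, hp]

lemma sliceCov_eq_latticeFourier (γ : ℕ) (A : ℕ → ℕ → Plane → ℂ) (h : ℕ) (y : Site) :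
    sliceCov γ A h y = latticeFourier γ (fun p => (slabKernel γ A h 1 p : ℂ)) y := by
  rw [sliceCov, latticeFourier]
  congr 1
  refine setIntegral_congr_fun (measurableSet_box γ 0) fun p hp => ?_
  simp only [slabKernel]
  rw [indicator_of_mem hp, slabSymbol_eq]

lemma norm_le_five_of_mem_box {γ : ℕ} {p : Plane} (hp : p ∈ box γ 0) : ‖p‖ ≤ 5 := by
  simpa using norm_le_of_mem_box hp

lemma volume_box_lt_top (γ : ℕ) : volume (box γ 0) < ⊤ :=
  lt_of_le_of_lt (measure_mono (t := Metric.closedBall 0 5) fun p hp => by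
    simpa using norm_le_five_of_mem_box hp) measure_closedBall_lt_top

lemma integrableOn_box_of_bound {γ : ℕ} {f : Plane → ℝ} {a : ℝ} (hf : Measurable f)
    (hb : ∀ p ∈ box γ 0, |f p| ≤ a) : IntegrableOn f (box γ 0) :=
  Measure.integrableOn_of_bounded (M := a) (volume_box_lt_top γ).ne hf.aestronglyMeasurable
    ((ae_restrict_iff' (measurableSet_box γ 0)).2 (Eventually.of_forall fun p hp => hb p hp))

namespace CutoffEstimates

variable {γ : ℕ} {A : ℕ → ℕ → Plane → ℂ} {u : Plane → ℝ} {C : ℝ}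

lemma smul_mem_box_zero (hγ : 1 < γ) {p : Plane} (hp : p ∈ box γ 0) (h : ℕ) :
    (γ : ℝ) ^ h • p ∈ box γ h := by
  have hg : (0 : ℝ) < (γ : ℝ) ^ h := by positivity
  rwa [← inv_smul_mem_box_iff hγ, inv_smul_smul₀ hg.ne']

lemma abs_increment_le_norm (H : CutoffEstimates γ A u C) (hγ : 1 < γ) {h : ℕ} (m : ℕ) {q : Plane}
    (hq : q ∈ box γ h) : |increment γ A h m q| ≤ 2 * C * (γ : ℝ) ^ m * ‖q‖ := by
  have hC := H.pos
  have h1 := H.origin h q hq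
  have h2 := H.origin (h + m) _ (smul_mem_box hq)
  have h3 := norm_le_smul hγ m q
  rw [norm_pow_smul] at h2 h3
  have e : increment γ A h m q = (1 - cutoff A (h + m) ((γ : ℝ) ^ m • q)) - (1 - cutoff A h q) := by
    rw [increment]; ring
  rw [e]
  refine (abs_sub _ _).trans ((add_le_add h2 h1).trans ?_)
  nlinarith

lemma abs_slabSymbol_le (H : CutoffEstimates γ A u C) (hγ : 1 < γ) (h m : ℕ) {p : Plane}
    (hp : p ∈ box γ 0) : |slabSymbol γ A h m p| ≤ 2 * C * (γ : ℝ) ^ (h + m) * ‖p‖ := by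
  refine (H.abs_increment_le_norm hγ m (smul_mem_box_zero hγ hp h)).trans_eq ?_
  rw [norm_pow_smul, pow_add]
  ring

lemma measurable_slab (H : CutoffEstimates γ A u C) (hγ : 1 < γ) (h m : ℕ) :
    Measurable ((box γ 0).indicator (slabSymbol γ A h m)) := by
  classical
  rw [← piecewise_eq_indicator]
  refine ContinuousOn.measurable_piecewise ?_ continuousOn_const (measurableSet_box γ 0)
  exact (H.continuousOn_increment h m).comp (by fun_prop) fun p hp => smul_mem_box_zero hγ hp h

lemma measurable_slabKernel (H : CutoffEstimates γ A u C) (hγ : 1 < γ) (h m : ℕ) :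
    Measurable (slabKernel γ A h m) := by
  have e : slabKernel γ A h m = fun p =>
      (box γ 0).indicator (slabSymbol γ A h m) p / lapSymbol p := by
    ext q; by_cases hq : q ∈ box γ 0 <;> simp [slabKernel, hq]
  rw [e]
  exact (H.measurable_slab hγ h m).div continuous_lapSymbol.measurable

/-- The numerator vanishes linearly at zero momentum, which leaves a singularity 1/|p|. A lattice
derivative supplies the missing |p| and makes the kernel bounded, as Parseval's identity requires
here. -/
lemma abs_slabKernel_le (H : CutoffEstimates γ A u C) (hγ : 1 < γ) (h m : ℕ) (p : Plane) :
    |slabKernel γ A h m p| ≤ 8 * C * (γ : ℝ) ^ (h + m) * ‖p‖⁻¹ := by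
  have hC := H.pos
  by_cases hp : p ∈ box γ 0
  · rw [slabKernel, indicator_of_mem hp, abs_div, abs_of_nonneg (lapSymbol_nonneg p)]
    by_cases h0 : p = 0
    · simp [h0, lapSymbol]
    have hn : 0 < ‖p‖ := norm_pos_iff.2 h0
    have hl := le_lapSymbol hp
    calc _ ≤ 2 * C * (γ : ℝ) ^ (h + m) * ‖p‖ / (‖p‖ ^ 2 / 4) := by
          gcongr
          exact H.abs_slabSymbol_le hγ h m hp
      _ = _ := by field_simp; ring
  · rw [slabKernel, indicator_of_notMem hp, abs_zero]
    positivity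

lemma integrableOn_slabKernel (H : CutoffEstimates γ A u C) (hγ : 1 < γ) (h m : ℕ) :
    IntegrableOn (slabKernel γ A h m) (box γ 0) := by
  have h1 := (integrableOn_norm_rpow (s := -1) (by norm_num) (by norm_num : (0 : ℝ) ≤ 5)).1
  have h2 : box γ 0 ⊆ Metric.closedBall (0 : Plane) 5 := fun p hp => by
    simpa using norm_le_five_of_mem_box hp
  refine ((h1.mono_set h2).const_mul (8 * C * (γ : ℝ) ^ (h + m))).mono'
    (H.measurable_slabKernel hγ h m).aestronglyMeasurable (Eventually.of_forall fun p => ?_)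
  rw [Real.norm_eq_abs, Real.rpow_neg_one]
  exact H.abs_slabKernel_le hγ h m p

lemma integrableOn_exp_mul (H : CutoffEstimates γ A u C) (hγ : 1 < γ) (h m : ℕ) (y : Site) :
    IntegrableOn (fun p => Complex.exp (Complex.I * (pair p y : ℂ)) * (slabKernel γ A h m p : ℂ))
      (box γ 0) := by
  refine (H.integrableOn_slabKernel hγ h m).ofReal.bdd_mul (c := 1) ?_
    (Eventually.of_forall fun q => ?_)
  · refine (Continuous.measurable ?_).aestronglyMeasurable
    unfold pair
    fun_prop
  · rw [mul_comm, Complex.norm_exp_ofReal_mul_I]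

lemma ofReal_blockCov (H : CutoffEstimates γ A u C) (hγ : 1 < γ)
    (hre : ∀ h x, (sliceCov γ A h x).im = 0) (M j : ℕ) (y : Site) :
    (blockCov γ M A j y : ℂ) =
      latticeFourier γ (fun p => (slabKernel γ A (j * M) M p : ℂ)) y := by
  have h1 : ∀ h, (((sliceCov γ A h y).re : ℝ) : ℂ) = sliceCov γ A h y := fun h =>
    Complex.ext (by simp) (by simp [hre])
  rw [blockCov, Complex.ofReal_sum]
  simp_rw [h1, sliceCov_eq_latticeFourier, latticeFourier]
  rw [← Finset.mul_sum, ← integral_finsetSum _ fun m _ => H.integrableOn_exp_mul hγ _ _ _]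
  congr 1
  refine integral_congr_ae (Eventually.of_forall fun p => ?_)
  simp only []
  rw [← Finset.mul_sum, ← Complex.ofReal_sum, sum_slabKernel]

lemma ofReal_latticeDeriv (H : CutoffEstimates γ A u C) (hγ : 1 < γ)
    (hre : ∀ h x, (sliceCov γ A h x).im = 0) (M j : ℕ) (μ y : Site) :
    (latticeDeriv μ (blockCov γ M A j) y : ℂ) = latticeFourier γ (fun p =>
      (Complex.exp (Complex.I * (pair p μ : ℂ)) - 1) * (slabKernel γ A (j * M) M p : ℂ)) y := by
  rw [latticeDeriv, Complex.ofReal_sub, H.ofReal_blockCov hγ hre, H.ofReal_blockCov hγ hre,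
    latticeFourier, latticeFourier, latticeFourier, ← mul_sub,
    ← integral_sub (H.integrableOn_exp_mul hγ _ _ _) (H.integrableOn_exp_mul hγ _ _ _)]
  congr 1
  refine integral_congr_ae (Eventually.of_forall fun p => ?_)
  have : pair p (y + μ) = pair p y + pair p μ := by
    simp only [pair, Pi.add_apply, Int.cast_add, mul_add, Finset.sum_add_distrib]
  simp only [this, Complex.ofReal_add, mul_add, Complex.exp_add]
  ring

/-- Parseval, with |e^{ip·μ} - 1|² = 2(1 - cos p·μ). -/
lemma hasSum_latticeDeriv (H : CutoffEstimates γ A u C) (hγ : 1 < γ)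
    (hre : ∀ h x, (sliceCov γ A h x).im = 0) (M n j : ℕ) (μ : Site) :
    HasSum (fun y => latticeDeriv μ (blockCov γ M A n) y * latticeDeriv μ (blockCov γ M A j) y)
      (((2 * Real.pi) ^ 2)⁻¹ * ∫ p in box γ 0, 2 * (1 - Real.cos (pair p μ)) *
        (slabKernel γ A (n * M) M p * slabKernel γ A (j * M) M p)) := by
  have hC := H.pos
  set f : ℕ → Plane → ℂ := fun h p => (Complex.exp (Complex.I * (pair p μ : ℂ)) - 1) *
    (slabKernel γ A (h * M) M p : ℂ) with hf
  have hm : ∀ h, Measurable (f h) := fun h => by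
    refine Measurable.mul ?_ (Complex.measurable_ofReal.comp (H.measurable_slabKernel hγ _ _))
    refine Continuous.measurable ?_
    unfold pair
    fun_prop
  have hb : ∀ h p, ‖f h p‖ ≤ ‖toPlane μ‖ * (8 * C * (γ : ℝ) ^ (h * M + M)) := fun h p => by
    rw [hf, norm_mul, Complex.norm_real, Real.norm_eq_abs]
    have h1 : ‖Complex.exp (Complex.I * (pair p μ : ℂ)) - 1‖ ≤ ‖p‖ * ‖toPlane μ‖ := by
      refine (Real.norm_exp_I_mul_ofReal_sub_one_le).trans ?_
      rw [pair_eq_inner]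
      exact norm_inner_le_norm _ _
    have h2 := H.abs_slabKernel_le hγ (h * M) M p
    by_cases h0 : p = 0
    · rw [h0, norm_zero, inv_zero, mul_zero] at h2
      rw [h0, le_antisymm h2 (abs_nonneg _), mul_zero]
      positivity
    have hn : 0 < ‖p‖ := norm_pos_iff.2 h0
    calc _ ≤ ‖p‖ * ‖toPlane μ‖ * (8 * C * (γ : ℝ) ^ (h * M + M) * ‖p‖⁻¹) := by gcongr
      _ = _ := by field_simp
  have key := hasSum_latticeFourier γ (hm n) (hm j)
    (a := max (‖toPlane μ‖ * (8 * C * (γ : ℝ) ^ (n * M + M)))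
      (‖toPlane μ‖ * (8 * C * (γ : ℝ) ^ (j * M + M))))
    (fun p => (hb n p).trans (le_max_left _ _)) (fun p => (hb j p).trans (le_max_right _ _))
  have e : ∫ p in box γ 0, conj (f n p) * f j p = ∫ p in box γ 0,
      ((2 * (1 - Real.cos (pair p μ)) *
        (slabKernel γ A (n * M) M p * slabKernel γ A (j * M) M p) : ℝ) : ℂ) := by
    refine integral_congr_ae (Eventually.of_forall fun p => ?_)
    simp only [hf, map_mul, Complex.conj_ofReal]
    have h1 : conj (Complex.exp (Complex.I * (pair p μ : ℂ)) - 1) *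
        (Complex.exp (Complex.I * (pair p μ : ℂ)) - 1) = ((2 * (1 - Real.cos (pair p μ)) : ℝ) : ℂ) := by
      rw [← Complex.normSq_eq_conj_mul_self, mul_comm Complex.I, Complex.normSq_apply]
      congr 1
      simp only [Complex.sub_re, Complex.sub_im, Complex.exp_ofReal_mul_I_re,
        Complex.exp_ofReal_mul_I_im, Complex.one_re, Complex.one_im]
      nlinarith [Real.sin_sq_add_cos_sq (pair p μ)]
    rw [Complex.ofReal_mul, ← h1]
    push_cast
    ring
  rw [e, integral_complex_ofReal, ← Complex.ofReal_inv, ← Complex.ofReal_mul] at key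
  rw [← Complex.hasSum_ofReal]
  refine key.congr_fun fun y => ?_
  rw [← H.ofReal_latticeDeriv hγ hre, ← H.ofReal_latticeDeriv hγ hre, Complex.conj_ofReal,
    Complex.ofReal_mul]

/-- The energy form of two blocks. -/
noncomputable def slabEnergy (γ : ℕ) (A : ℕ → ℕ → Plane → ℂ) (M n j : ℕ) : ℝ :=
  ∫ p in box γ 0, slabSymbol γ A (n * M) M p * slabSymbol γ A (j * M) M p / lapSymbol p

/-- Half the sum over the four directions of 2(1 - cos p·μ) is the Laplacian symbol. It cancels one
of the two inverse symbols. -/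
lemma hasSum_dirSum (H : CutoffEstimates γ A u C) (hγ : 1 < γ)
    (hre : ∀ h x, (sliceCov γ A h x).im = 0) (M n j : ℕ) :
    HasSum (fun y => dirSum fun μ =>
      latticeDeriv μ (blockCov γ M A n) y * latticeDeriv μ (blockCov γ M A j) y)
      (((2 * Real.pi) ^ 2)⁻¹ * slabEnergy γ A M n j) := by
  have hC := H.pos
  have h1 := fun μ => H.hasSum_latticeDeriv hγ hre M n j μ
  have hI : ∀ μ, IntegrableOn (fun p => 2 * (1 - Real.cos (pair p μ)) *
      (slabKernel γ A (n * M) M p * slabKernel γ A (j * M) M p)) (box γ 0) := by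
    intro μ
    refine integrableOn_box_of_bound (a := ‖toPlane μ‖ ^ 2 * (8 * C * (γ : ℝ) ^ (n * M + M)) *
      (8 * C * (γ : ℝ) ^ (j * M + M))) ?_ fun p hp => ?_
    · refine Measurable.mul (Continuous.measurable ?_)
        ((H.measurable_slabKernel hγ _ _).mul (H.measurable_slabKernel hγ _ _))
      unfold pair
      fun_prop
    · have b1 := H.abs_slabKernel_le hγ (n * M) M p
      have b2 := H.abs_slabKernel_le hγ (j * M) M p
      have b3 : |2 * (1 - Real.cos (pair p μ))| ≤ ‖p‖ ^ 2 * ‖toPlane μ‖ ^ 2 := by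
        rw [abs_of_nonneg (by linarith [Real.cos_le_one (pair p μ)])]
        have x1 := Real.one_sub_sq_div_two_le_cos (x := pair p μ)
        have x2 : pair p μ ^ 2 ≤ (‖p‖ * ‖toPlane μ‖) ^ 2 := by
          rw [← sq_abs, pair_eq_inner]
          have := abs_real_inner_le_norm p (toPlane μ)
          gcongr
        rw [mul_pow] at x2
        linarith
      by_cases h0 : p = 0
      · rw [h0, norm_zero, zero_pow two_ne_zero, zero_mul] at b3
        rw [h0, abs_mul, le_antisymm b3 (abs_nonneg _), zero_mul]
        positivity
      have hn : 0 < ‖p‖ := norm_pos_iff.2 h0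
      rw [abs_mul (2 * _), abs_mul (slabKernel γ A (n * M) M p)]
      calc _ ≤ ‖p‖ ^ 2 * ‖toPlane μ‖ ^ 2 * ((8 * C * (γ : ℝ) ^ (n * M + M) * ‖p‖⁻¹) *
            (8 * C * (γ : ℝ) ^ (j * M + M) * ‖p‖⁻¹)) := by gcongr
        _ = _ := by field_simp
  have h2 := (hasSum_sum (s := (Finset.univ : Finset (Fin 2))) fun i _ =>
    (h1 (Pi.single i 1)).add (h1 (Pi.single i (-1)))).mul_left (1 / 2)
  have e : ∀ p i, pair p (Pi.single i 1) = p i ∧ pair p (Pi.single i (-1)) = -p i := by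
    intro p i
    constructor <;> fin_cases i <;> simp [pair]
  have hI' : ∀ i, IntegrableOn (fun p => 2 * (1 - Real.cos (p i)) *
      (slabKernel γ A (n * M) M p * slabKernel γ A (j * M) M p)) (box γ 0) := fun i => by
    simpa only [(e _ _).1] using hI (Pi.single i 1)
  have e2 : slabEnergy γ A M n j = (∫ p in box γ 0, 2 * (1 - Real.cos (p 0)) *
      (slabKernel γ A (n * M) M p * slabKernel γ A (j * M) M p)) + ∫ p in box γ 0,
      2 * (1 - Real.cos (p 1)) * (slabKernel γ A (n * M) M p * slabKernel γ A (j * M) M p) := by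
    rw [← integral_add (hI' 0) (hI' 1), slabEnergy]
    refine setIntegral_congr_fun (measurableSet_box γ 0) fun p hp => ?_
    simp only [slabKernel, indicator_of_mem hp]
    rw [← add_mul]
    have e3 : 2 * (1 - Real.cos (p 0)) + 2 * (1 - Real.cos (p 1)) = lapSymbol p := by
      rw [lapSymbol, Fin.sum_univ_two, mul_add]
    rw [e3]
    by_cases hl : lapSymbol p = 0
    · simp [hl]
    · field_simp
  simp only [(e _ _).1, (e _ _).2, Real.cos_neg, Fin.sum_univ_two] at h2
  rw [e2]
  convert! h2 using 1
  · ext y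
    rw [dirSum, Fin.sum_univ_two]
  · ring

end CutoffEstimates

end CoulombGas

/-! ### Convergence of b_j. -/

namespace CoulombGas

open MeasureTheory Filter Topology Set

lemma dirSum_add (f g : Site → ℝ) : dirSum (fun μ => f μ + g μ) = dirSum f + dirSum g := by
  simp only [dirSum, Fin.sum_univ_two]; ring

lemma dirSum_const_mul (a : ℝ) (f : Site → ℝ) : dirSum (fun μ => a * f μ) = a * dirSum f := by
  simp only [dirSum, Fin.sum_univ_two]; ring

lemma dirSum_sum {ι : Type*} (s : Finset ι) (f : ι → Site → ℝ) :
    dirSum (fun μ => ∑ i ∈ s, f i μ) = ∑ i ∈ s, dirSum (f i) := by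
  simp only [dirSum, Fin.sum_univ_two, ← Finset.sum_add_distrib, Finset.mul_sum]

/-- Each power γ² cancels the limit ln γ/(2π) of one slice at zero. The remaining exponent is a
geometric sum of errors starting at n. -/
lemma ScaleProfile.abs_exp_sumCov_sub_one_le {γ : ℕ} {c : ℕ → Site → ℝ} {V : Plane → ℝ} {κ K : ℝ}
    (P : ScaleProfile γ c V κ K) (hγ : 1 < γ) (n j : ℕ) :
    |Real.exp (-(4 * Real.pi) * sumCov c n j 0) * (γ : ℝ) ^ (2 * (j - n)) - 1| ≤
      4 * Real.pi * (K * (1 - rate γ)⁻¹) * Real.exp (4 * Real.pi * (K * (1 - rate γ)⁻¹)) *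
        rate γ ^ n := by
  have hg : (0 : ℝ) < γ := by positivity
  have hK := P.nonneg
  have hr0 := rate_pos hγ
  have hr1 := rate_lt_one hγ
  have hr : 0 < 1 - rate γ := by linarith
  set D := K * (1 - rate γ)⁻¹ with hD
  have hD0 : 0 ≤ D := by positivity
  set t := ∑ k ∈ Finset.Ico n j, (c k 0 - Real.log γ / (2 * Real.pi)) with ht
  have h1 : |t| ≤ D * rate γ ^ n := by
    refine (Finset.abs_sum_le_sum_abs _ _).trans ?_
    calc _ ≤ ∑ k ∈ Finset.Ico n j, K * rate γ ^ k := by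
          refine Finset.sum_le_sum fun k _ => ?_
          have := P.approx k 0
          rwa [toPlane_zero, smul_zero, sliceProfile_zero] at this
      _ ≤ K * (rate γ ^ n * (1 - rate γ)⁻¹) := by
          rw [← Finset.mul_sum]
          gcongr
          exact sum_Ico_rate_le hγ n j
      _ = _ := by rw [hD]; ring
  have e : Real.exp (-(4 * Real.pi) * sumCov c n j 0) * (γ : ℝ) ^ (2 * (j - n)) =
      Real.exp (-(4 * Real.pi) * t) := by
    have h2 : t = sumCov c n j 0 - (j - n : ℕ) * (Real.log γ / (2 * Real.pi)) := by
      rw [ht, Finset.sum_sub_distrib, sumCov]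
      simp
    have h3 : (γ : ℝ) ^ (2 * (j - n)) = Real.exp (Real.log γ * (2 * (j - n : ℕ))) := by
      rw [Real.exp_mul, Real.exp_log hg]
      norm_cast
    rw [h3, ← Real.exp_add, h2]
    congr 1
    field_simp
    ring
  have h3 : |-(4 * Real.pi) * t| ≤ 4 * Real.pi * D * rate γ ^ n := by
    rw [abs_mul, abs_neg, abs_of_pos (by positivity)]
    calc _ ≤ 4 * Real.pi * (D * rate γ ^ n) := by gcongr
      _ = _ := by ring
  have h4 : 4 * Real.pi * D * rate γ ^ n ≤ 4 * Real.pi * D :=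
    mul_le_of_le_one_right (by positivity) (pow_le_one₀ hr0.le hr1.le)
  rw [e]
  refine (abs_exp_sub_one_le _).trans ?_
  calc _ ≤ (4 * Real.pi * D * rate γ ^ n) * Real.exp (4 * Real.pi * D) := by
        gcongr
        exact h3.trans h4
    _ = _ := by ring

lemma setIntegral_box_zero {γ : ℕ} (hγ : 1 < γ) (h : ℕ) (f : Plane → ℝ) :
    ∫ p in box γ 0, f p =
      (((γ : ℝ) ^ h) ^ 2)⁻¹ * ∫ q in box γ h, f (((γ : ℝ) ^ h)⁻¹ • q) := by
  have hg : (0 : ℝ) < (γ : ℝ) ^ h := by positivity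
  rw [← integral_indicator (measurableSet_box γ 0), ← integral_indicator (measurableSet_box γ h)]
  have e : (box γ h).indicator (fun q => f (((γ : ℝ) ^ h)⁻¹ • q)) =
      fun q => (box γ 0).indicator f (((γ : ℝ) ^ h)⁻¹ • q) := by
    ext q
    by_cases hq : q ∈ box γ h
    · rw [indicator_of_mem hq, indicator_of_mem ((inv_smul_mem_box_iff hγ).2 hq)]
    · rw [indicator_of_notMem hq,
        indicator_of_notMem fun hc => hq ((inv_smul_mem_box_iff hγ).1 hc)]
  rw [e, Measure.integral_comp_smul volume, finrank_plane, abs_of_pos (by positivity), smul_eq_mul]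
  field_simp

lemma measurable_indicator_div_scaledLap {γ h : ℕ} {X : Plane → ℝ}
    (hX : ContinuousOn X (box γ h)) :
    Measurable ((box γ h).indicator fun q => X q / scaledLap γ h q) := by
  have e : ((box γ h).indicator fun q => X q / scaledLap γ h q) = fun q =>
      (box γ h).indicator X q / scaledLap γ h q := by
    ext q; by_cases hq : q ∈ box γ h <;> simp [hq]
  rw [e]
  refine Measurable.div ?_ (continuous_scaledLap γ h).measurable
  classical
  rw [← piecewise_eq_indicator]
  exact hX.measurable_piecewise continuousOn_const (measurableSet_box γ h)

namespace CutoffEstimates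

variable {γ : ℕ} {A : ℕ → ℕ → Plane → ℂ} {u : Plane → ℝ} {C : ℝ}

/-- The integrand of `slabEnergy` after rescaling. -/
noncomputable def energyKernel (γ : ℕ) (A : ℕ → ℕ → Plane → ℂ) (M n j : ℕ) : Plane → ℝ :=
  (box γ (j * M)).indicator fun q => slabSymbol γ A (n * M) M (((γ : ℝ) ^ (j * M))⁻¹ • q) *
    increment γ A (j * M) M q / scaledLap γ (j * M) q

lemma slabEnergy_eq (hγ : 1 < γ) (M n j : ℕ) :
    slabEnergy γ A M n j = ∫ q, energyKernel γ A M n j q := by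
  have hg : (0 : ℝ) < (γ : ℝ) ^ (j * M) := by positivity
  unfold energyKernel
  rw [slabEnergy, setIntegral_box_zero hγ (j * M), ← integral_const_mul,
    integral_indicator (measurableSet_box γ (j * M))]
  refine integral_congr_ae (Eventually.of_forall fun q => ?_)
  have : slabSymbol γ A (j * M) M (((γ : ℝ) ^ (j * M))⁻¹ • q) = increment γ A (j * M) M q := by
    rw [slabSymbol, smul_inv_smul₀ hg.ne']
  simp only [this, scaledLap]
  rw [← div_eq_inv_mul, div_div, mul_comm (lapSymbol _)]

/-- On scale j the numerator of block n is linear in |q| with slope of order γ^{nM+M}/γ^{jM}, and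
the numerator of block j decays. Blocks at distant scales are therefore almost orthogonal. -/
lemma abs_energyKernel_le (H : CutoffEstimates γ A u C) (hγ : 1 < γ) (M n j : ℕ) (q : Plane) :
    |energyKernel γ A M n j q| ≤
      8 * C ^ 2 * ((γ : ℝ) ^ (n * M + M) * ((γ : ℝ) ^ (j * M))⁻¹) * weight (-1) q := by
  have hC := H.pos
  have hw := weight_nonneg (-1) q
  by_cases hq : q ∈ box γ (j * M)
  · rw [energyKernel, indicator_of_mem hq]
    by_cases h0 : q = 0
    · have : scaledLap γ (j * M) q = 0 := by simp [h0, scaledLap, lapSymbol]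
      rw [this, div_zero, abs_zero]
      positivity
    have hn : 0 < ‖q‖ := norm_pos_iff.2 h0
    have h1 := H.abs_slabSymbol_le hγ (n * M) M ((inv_smul_mem_box_iff hγ).2 hq)
    have h2 := (H.abs_increment_le hγ M hq).trans (H.div_pow_four_le q)
    have h3 := le_scaledLap hγ hq
    rw [norm_inv_smul hγ] at h1
    rw [abs_div, abs_mul, abs_of_nonneg (scaledLap_nonneg γ (j * M) q), weight, Real.rpow_neg_one]
    calc _ ≤ 2 * C * (γ : ℝ) ^ (n * M + M) * (((γ : ℝ) ^ (j * M))⁻¹ * ‖q‖) *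
          (C / (1 + ‖q‖ ^ 2)) / (‖q‖ ^ 2 / 4) := by gcongr
      _ = _ := by field_simp; ring
  · rw [energyKernel, indicator_of_notMem hq, abs_zero]
    positivity

lemma integrable_energyKernel (H : CutoffEstimates γ A u C) (hγ : 1 < γ) (M n j : ℕ) :
    Integrable (energyKernel γ A M n j) := by
  refine ((integrable_weight (s := -1) (by norm_num) (by norm_num)).const_mul (8 * C ^ 2 *
    ((γ : ℝ) ^ (n * M + M) * ((γ : ℝ) ^ (j * M))⁻¹))).mono' (Measurable.aestronglyMeasurable ?_)
    (Eventually.of_forall fun q => H.abs_energyKernel_le hγ M n j q)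
  refine measurable_indicator_div_scaledLap (ContinuousOn.mul ?_ (H.continuousOn_increment _ _))
  refine ((H.continuousOn_increment (n * M) M).comp (by fun_prop)
    fun p hp => smul_mem_box_zero hγ hp (n * M)).comp (by fun_prop) fun q hq => ?_
  exact (inv_smul_mem_box_iff hγ).2 hq

lemma abs_slabEnergy_le (H : CutoffEstimates γ A u C) (hγ : 1 < γ) (M n j : ℕ) :
    |slabEnergy γ A M n j| ≤ 8 * C ^ 2 * (∫ q, weight (-1) q) *
      ((γ : ℝ) ^ (n * M + M) * ((γ : ℝ) ^ (j * M))⁻¹) := by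
  rw [slabEnergy_eq hγ, ← Real.norm_eq_abs]
  refine (norm_integral_le_of_norm_le ((integrable_weight (s := -1) (by norm_num)
    (by norm_num)).const_mul (8 * C ^ 2 * ((γ : ℝ) ^ (n * M + M) * ((γ : ℝ) ^ (j * M))⁻¹)))
    (Eventually.of_forall fun q => H.abs_energyKernel_le hγ M n j q)).trans_eq ?_
  rw [integral_const_mul]
  ring

/-- The numerator of the total energy kernel. -/
noncomputable def totalSymbol (γ : ℕ) (A : ℕ → ℕ → Plane → ℂ) (h M : ℕ) (q : Plane) : ℝ :=
  (2 * cutoff A h q - cutoff A h q ^ 2) -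
    (2 * cutoff A (h + M) ((γ : ℝ) ^ M • q) - cutoff A (h + M) ((γ : ℝ) ^ M • q) ^ 2)

/-- With G and G' the cutoffs at the two ends of block j, (G - G')² + 2(1 - G)(G - G') = (2G - G²) -
(2G' - G'²). This is again a difference of one function at two scales, ready for Frullani. -/
lemma energyKernel_add_sum (hγ : 1 < γ) (M j : ℕ) (q : Plane) :
    energyKernel γ A M j j q + 2 * ∑ n ∈ Finset.range j, energyKernel γ A M n j q =
      (box γ (j * M)).indicator
        (fun q => totalSymbol γ A (j * M) M q / scaledLap γ (j * M) q) q := by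
  have hg : (0 : ℝ) < (γ : ℝ) ^ (j * M) := by positivity
  by_cases hq : q ∈ box γ (j * M)
  · simp only [energyKernel, indicator_of_mem hq]
    rw [← Finset.sum_div, ← Finset.sum_mul, sum_slabSymbol_block, slabSymbol,
      smul_inv_smul₀ hg.ne', totalSymbol, increment]
    ring
  · simp [energyKernel, hq]

lemma abs_two_mul_sub_sq_le {a b : ℝ} (ha : a ∈ Icc (0 : ℝ) 1) (hb : b ∈ Icc (0 : ℝ) 1) :
    |(2 * a - a ^ 2) - (2 * b - b ^ 2)| ≤ 2 * |a - b| := by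
  have e : (2 * a - a ^ 2) - (2 * b - b ^ 2) = (2 - a - b) * (a - b) := by ring
  rw [e, abs_mul, abs_of_nonneg (by linarith [ha.2, hb.2])]
  gcongr
  linarith [ha.1, hb.1]

/-- The limit of the total energy. -/
lemma abs_total_energy_sub_le (H : CutoffEstimates γ A u C) (hγ : 1 < γ) (M j : ℕ) :
    |slabEnergy γ A M j j + 2 * ∑ n ∈ Finset.range j, slabEnergy γ A M n j -
      2 * Real.pi * Real.log ((γ : ℝ) ^ M)| ≤
      404 * C * (∫ q, weight (-(7 / 4)) q) * rate γ ^ (j * M) := by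
  have hC := H.pos
  have hg : (1 : ℝ) < γ := by exact_mod_cast hγ
  have hint := fun n => H.integrable_energyKernel hγ M n j
  have e1 : slabEnergy γ A M j j + 2 * ∑ n ∈ Finset.range j, slabEnergy γ A M n j =
      ∫ q, (box γ (j * M)).indicator
        (fun q => totalSymbol γ A (j * M) M q / scaledLap γ (j * M) q) q := by
    simp_rw [slabEnergy_eq hγ]
    rw [← integral_finsetSum _ fun n _ => hint n, ← integral_const_mul, ← integral_add (hint j)
      ((integrable_finsetSum _ fun n _ => hint n).const_mul 2)]
    simp_rw [energyKernel_add_sum hγ]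
  have i1 : Integrable ((box γ (j * M)).indicator
      (fun q => totalSymbol γ A (j * M) M q / scaledLap γ (j * M) q)) := by
    refine ((hint j).add ((integrable_finsetSum (Finset.range j)
      fun n _ => hint n).const_mul 2)).congr (Eventually.of_forall fun q => ?_)
    exact energyKernel_add_sum hγ M j q
  have f01 : ∀ h, ∀ q ∈ box γ h, cutoff A h q ∈ Icc (0 : ℝ) 1 := fun h q hq =>
    ⟨H.nonneg h q, H.le_one h q hq⟩
  have u01 : ∀ q, u q ∈ Icc (0 : ℝ) 1 := fun q => ⟨H.lim_nonneg q, H.lim_le_one q⟩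
  have hum := H.measurable
  -- The function 2u - u² also equals 1 at the origin, so the total energy has limit 2π ln L.
  obtain ⟨i2, e2⟩ := frullani (φ := fun q => 2 * u q - u q ^ 2) (φ₀ := 1) (C := 2 * C)
    (L := (γ : ℝ) ^ M) (by fun_prop) (fun q => by
      have h1 := abs_two_mul_sub_sq_le (u01 q) (by simp : (1 : ℝ) ∈ Icc (0 : ℝ) 1)
      have h2 := H.lim_origin q
      rw [abs_sub_comm] at h2
      norm_num at h1
      linarith) (fun q => by
      have h1 := abs_two_mul_sub_sq_le (u01 q) (by simp : (0 : ℝ) ∈ Icc (0 : ℝ) 1)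
      have h2 := (H.lim_decay q).trans (H.div_pow_four_le q)
      norm_num at h1
      rw [abs_of_nonneg (u01 q).1] at h1
      rw [mul_div_assoc]
      linarith) (one_le_pow₀ hg.le)
  have key := abs_kernel_sub_le hγ (h := j * M) (X := totalSymbol γ A (j * M) M)
    (v := fun q => (2 * u q - u q ^ 2) - (2 * u ((γ : ℝ) ^ M • q) - u ((γ : ℝ) ^ M • q) ^ 2))
    (a := 4 * C) (fun q hq => ?_) (fun q => ?_) (fun q hq => ?_)
  · rw [e1, show 2 * Real.pi * Real.log ((γ : ℝ) ^ M) = 2 * Real.pi * 1 * Real.log ((γ : ℝ) ^ M)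
      by ring, ← e2, ← integral_sub i1 i2, ← Real.norm_eq_abs]
    refine (norm_integral_le_of_norm_le ((integrable_weight (s := -(7 / 4)) (by norm_num)
      (by norm_num)).const_mul (101 * (4 * C) * rate γ ^ (j * M)))
      (Eventually.of_forall key)).trans_eq ?_
    rw [integral_const_mul]
    ring
  · have h1 := abs_two_mul_sub_sq_le (f01 _ q hq) (f01 (j * M + M) _ (smul_mem_box hq))
    have h2 := (H.abs_increment_le hγ M hq).trans (H.div_pow_four_le q)
    rw [increment] at h2
    have h3 : 0 ≤ C / (1 + ‖q‖ ^ 2) := by positivity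
    rw [totalSymbol, mul_div_assoc]
    linarith
  · have h1 := abs_two_mul_sub_sq_le (u01 q) (u01 ((γ : ℝ) ^ M • q))
    have h2 := (H.abs_lim_sub_le hγ M q).trans (H.div_pow_four_le q)
    have h3 : 0 ≤ C / (1 + ‖q‖ ^ 2) := by positivity
    rw [mul_div_assoc]
    linarith
  · have h1 := abs_two_mul_sub_sq_le (f01 _ q hq) (u01 q)
    have h2 := abs_two_mul_sub_sq_le (f01 (j * M + M) _ (smul_mem_box hq)) (u01 ((γ : ℝ) ^ M • q))
    have h3 := H.dist _ q hq
    have h4 := H.dist_smul hγ M hq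
    have e3 : totalSymbol γ A (j * M) M q -
        (2 * u q - u q ^ 2 - (2 * u ((γ : ℝ) ^ M • q) - u ((γ : ℝ) ^ M • q) ^ 2)) =
        ((2 * cutoff A (j * M) q - cutoff A (j * M) q ^ 2) - (2 * u q - u q ^ 2)) -
        ((2 * cutoff A (j * M + M) ((γ : ℝ) ^ M • q) -
          cutoff A (j * M + M) ((γ : ℝ) ^ M • q) ^ 2) -
            (2 * u ((γ : ℝ) ^ M • q) - u ((γ : ℝ) ^ M • q) ^ 2)) := by
      rw [totalSymbol]; ring
    rw [e3]
    refine (abs_sub _ _).trans ?_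
    linarith

/-- At α² = 8π the prefactor is (α²/2)(2π)^{-2} = 1/π. -/
lemma bCoeff_eq (H : CutoffEstimates γ A u C) (hγ : 1 < γ)
    (hre : ∀ h x, (sliceCov γ A h x).im = 0) {α : ℝ} (hα : α ^ 2 = 8 * Real.pi) (L : ℝ) (M j : ℕ) :
    bCoeff α L (blockCov γ M A) j = Real.pi⁻¹ * (slabEnergy γ A M j j +
      2 * ∑ n ∈ Finset.range j, Real.exp (-(4 * Real.pi) * sumCov (blockCov γ M A) n j 0) *
        L ^ (2 * (j - n)) * slabEnergy γ A M n j) := by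
  have h1 := fun n => H.hasSum_dirSum hγ hre M n j
  have h2 := (h1 j).add ((hasSum_sum (s := Finset.range j) fun n _ => (h1 n).mul_left
    (Real.exp (-(4 * Real.pi) * sumCov (blockCov γ M A) n j 0) * L ^ (2 * (j - n)))).mul_left 2)
  have e : ∀ y, (dirSum fun μ => latticeDeriv μ (blockCov γ M A j) y ^ 2 +
      2 * ∑ n ∈ Finset.range j, latticeDeriv μ (blockCov γ M A n) y *
        latticeDeriv μ (blockCov γ M A j) y *
        Real.exp (-(α ^ 2 / 2) * sumCov (blockCov γ M A) n j 0) * L ^ (2 * (j - n))) =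
      (dirSum fun μ => latticeDeriv μ (blockCov γ M A j) y * latticeDeriv μ (blockCov γ M A j) y) +
      2 * ∑ n ∈ Finset.range j,
        Real.exp (-(4 * Real.pi) * sumCov (blockCov γ M A) n j 0) * L ^ (2 * (j - n)) *
        dirSum fun μ => latticeDeriv μ (blockCov γ M A n) y *
          latticeDeriv μ (blockCov γ M A j) y := by
    intro y
    rw [dirSum_add, dirSum_const_mul, dirSum_sum, hα, show 8 * Real.pi / 2 = 4 * Real.pi by ring]
    congr 1
    · simp_rw [sq]
    · congr 1
      refine Finset.sum_congr rfl fun n _ => ?_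
      rw [← dirSum_const_mul]
      congr 1
      ext μ
      ring
  rw [bCoeff]
  simp_rw [e]
  rw [h2.tsum_eq, hα]
  have e2 : ∀ n, Real.exp (-(4 * Real.pi) * sumCov (blockCov γ M A) n j 0) * L ^ (2 * (j - n)) *
      (((2 * Real.pi) ^ 2)⁻¹ * slabEnergy γ A M n j) = ((2 * Real.pi) ^ 2)⁻¹ *
      (Real.exp (-(4 * Real.pi) * sumCov (blockCov γ M A) n j 0) * L ^ (2 * (j - n)) *
        slabEnergy γ A M n j) := fun n => by ring
  simp_rw [e2]
  rw [← Finset.mul_sum]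
  field_simp
  ring

/-- The convergence of `b_j`. -/
lemma exists_bCoeff_bound (H : CutoffEstimates γ A u C) (hγ : 1 < γ)
    (hre : ∀ h x, (sliceCov γ A h x).im = 0) {α : ℝ} (hα : α ^ 2 = 8 * Real.pi) {M : ℕ}
    (hM : 1 ≤ M) {V : Plane → ℝ} {κ K : ℝ} (P : ScaleProfile (γ ^ M) (blockCov γ M A) V κ K) :
    ∃ B, ∀ j, |bCoeff α (γ ^ M : ℕ) (blockCov γ M A) j - 2 * Real.log (γ ^ M : ℕ)| ≤
      B * rate (γ ^ M) ^ j := by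
  have hγM : 1 < γ ^ M := Nat.one_lt_pow (by omega) hγ
  have hC := H.pos
  have hK := P.nonneg
  have hr0 := rate_pos hγM
  have hr1 := rate_lt_one hγM
  have hr : 0 < 1 - rate (γ ^ M) := by linarith
  set L : ℝ := ((γ ^ M : ℕ) : ℝ) with hL
  have hLe : L = (γ : ℝ) ^ M := by rw [hL]; push_cast; rfl
  have hL0 : 0 < L := by rw [hLe]; positivity
  have w1 : 0 ≤ ∫ q, weight (-(7 / 4)) q := integral_nonneg fun q => weight_nonneg _ q
  have w2 : 0 ≤ ∫ q, weight (-1) q := integral_nonneg fun q => weight_nonneg _ q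
  set D := 4 * Real.pi * (K * (1 - rate (γ ^ M))⁻¹) *
    Real.exp (4 * Real.pi * (K * (1 - rate (γ ^ M))⁻¹)) with hD
  have hD0 : 0 ≤ D := by positivity
  set E := 8 * C ^ 2 * (∫ q, weight (-1) q) with hE
  have hE0 : 0 ≤ E := by positivity
  refine ⟨Real.pi⁻¹ * (404 * C * (∫ q, weight (-(7 / 4)) q) +
    2 * (D * E * L * (1 - rate (γ ^ M))⁻¹)), fun j => ?_⟩
  have h1 := H.abs_total_energy_sub_le hγ M j
  rw [← hLe, mul_comm j M, pow_mul, ← rate_pow_cast] at h1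
  set s : ℕ → ℝ := fun n =>
    Real.exp (-(4 * Real.pi) * sumCov (blockCov γ M A) n j 0) * L ^ (2 * (j - n)) with hs
  -- Setting the weights to 1 costs the n-th power of the rate of L at block n, times the overlap L
  -- · L^{-(j-n)} of the blocks. Summed over n this is of the order of the j-th power.
  have h2 : |∑ n ∈ Finset.range j, (s n - 1) * slabEnergy γ A M n j| ≤
      D * E * L * (rate (γ ^ M) ^ j * (1 - rate (γ ^ M))⁻¹) := by
    refine (Finset.abs_sum_le_sum_abs _ _).trans ?_
    calc _ ≤ ∑ n ∈ Finset.range j, D * E * L * (rate (γ ^ M) ^ n * (L ^ (j - n))⁻¹) := by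
          refine Finset.sum_le_sum fun n hn => ?_
          have hn' : n < j := by simpa using hn
          have b1 : |s n - 1| ≤ D * rate (γ ^ M) ^ n := P.abs_exp_sumCov_sub_one_le hγM n j
          have b2 := H.abs_slabEnergy_le hγ M n j
          have e : (γ : ℝ) ^ (n * M + M) * ((γ : ℝ) ^ (j * M))⁻¹ = L * (L ^ (j - n))⁻¹ := by
            obtain ⟨k, rfl⟩ := Nat.exists_eq_add_of_lt hn'
            rw [hLe, pow_add, mul_comm n M, mul_comm _ M, pow_mul, pow_mul,
              show n + k + 1 - n = k + 1 by omega]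
            field_simp
            ring
          rw [e] at b2
          rw [abs_mul]
          calc _ ≤ D * rate (γ ^ M) ^ n * (E * (L * (L ^ (j - n))⁻¹)) := by gcongr
            _ = _ := by ring
      _ ≤ _ := by
          rw [← Finset.mul_sum]
          gcongr
          exact ScaleProfile.sum_rate_mul_le hγM j
  have e : bCoeff α L (blockCov γ M A) j - 2 * Real.log L =
      Real.pi⁻¹ * ((slabEnergy γ A M j j + 2 * ∑ n ∈ Finset.range j, slabEnergy γ A M n j -
        2 * Real.pi * Real.log L) +
        2 * ∑ n ∈ Finset.range j, (s n - 1) * slabEnergy γ A M n j) := by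
    rw [H.bCoeff_eq hγ hre hα]
    simp only [hs, sub_mul, one_mul, Finset.sum_sub_distrib]
    field_simp
    ring
  rw [e, abs_mul, abs_of_pos (by positivity), mul_assoc Real.pi⁻¹]
  gcongr
  refine (abs_add_le _ _).trans ?_
  rw [abs_mul, abs_two]
  linarith

end CutoffEstimates

end CoulombGas

/-! ### Dirichlet kernels in the lattice Laplacian. -/

namespace CoulombGas

open MeasureTheory Filter Topology Set Polynomial

/-- The normalized Dirichlet kernel `sin ((2m + 1) φ) / ((2m + 1) sin φ)`. -/
noncomputable def dirichletKernel (m : ℕ) (φ : ℝ) : ℝ :=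
  (2 * m + 1 : ℝ)⁻¹ * (1 + 2 * ∑ l ∈ Finset.range m, Real.cos (2 * (l + 1) * φ))

lemma sin_mul_dirichletKernel (m : ℕ) (φ : ℝ) :
    (2 * m + 1) * Real.sin φ * dirichletKernel m φ = Real.sin ((2 * m + 1) * φ) := by
  have key : ∀ m : ℕ, Real.sin φ * (1 + 2 * ∑ l ∈ Finset.range m, Real.cos (2 * (l + 1) * φ)) =
      Real.sin ((2 * m + 1) * φ) := by
    intro m
    induction m with
    | zero => simp
    | succ m ih =>
      rw [Finset.sum_range_succ, mul_add 2, ← add_assoc, mul_add, ih]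
      have h1 : (2 * (m : ℝ) + 1) * φ = 2 * (m + 1) * φ - φ := by ring
      have h2 : (2 * ((m + 1 : ℕ) : ℝ) + 1) * φ = 2 * (m + 1) * φ + φ := by push_cast; ring
      rw [h1, h2, Real.sin_sub, Real.sin_add]
      ring
  rw [← key m, dirichletKernel, mul_comm (2 * (m : ℝ) + 1), mul_assoc,
    mul_inv_cancel_left₀ (by positivity)]

lemma abs_dirichletKernel_le_one (m : ℕ) (φ : ℝ) : |dirichletKernel m φ| ≤ 1 := by
  rw [dirichletKernel, abs_mul, abs_of_pos (by positivity), inv_mul_le_iff₀ (by positivity), mul_one]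
  have h : |∑ l ∈ Finset.range m, Real.cos (2 * (l + 1) * φ)| ≤ m := by
    refine (Finset.abs_sum_le_sum_abs _ _).trans ((Finset.sum_le_sum fun l _ =>
      Real.abs_cos_le_one _).trans ?_)
    simp
  refine (abs_add_le _ _).trans ?_
  rw [abs_one, abs_mul, abs_two]
  linarith

lemma abs_one_sub_dirichletKernel_le (m : ℕ) {φ : ℝ} (hφ : 0 ≤ φ) :
    |1 - dirichletKernel m φ| ≤ (2 * m + 1) * φ := by
  have e : 1 - dirichletKernel m φ = (2 * m + 1 : ℝ)⁻¹ *
      (2 * ∑ l ∈ Finset.range m, (1 - Real.cos (2 * (l + 1) * φ))) := by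
    have h : (2 * m + 1 : ℝ)⁻¹ * (2 * m + 1) = 1 := inv_mul_cancel₀ (by positivity)
    rw [dirichletKernel, Finset.sum_sub_distrib]
    simp only [Finset.sum_const, Finset.card_range, nsmul_eq_mul, mul_one]
    linear_combination -h
  have h0 : 0 ≤ ∑ l ∈ Finset.range m, (1 - Real.cos (2 * (l + 1) * φ)) :=
    Finset.sum_nonneg fun l _ => by linarith [Real.cos_le_one (2 * (l + 1) * φ)]
  have h1 : ∑ l ∈ Finset.range m, (1 - Real.cos (2 * (l + 1) * φ)) ≤ m * (2 * m * φ) := by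
    calc _ ≤ ∑ l ∈ Finset.range m, 2 * m * φ := by
          refine Finset.sum_le_sum fun l hl => ?_
          have hl' : (l : ℝ) + 1 ≤ m := by exact_mod_cast Finset.mem_range.1 hl
          refine (CutoffEstimates.one_sub_cos_le_abs _).trans ?_
          rw [abs_of_nonneg (by positivity)]
          gcongr
      _ = _ := by rw [Finset.sum_const, Finset.card_range, nsmul_eq_mul]
  rw [e, abs_of_nonneg (by positivity), inv_mul_le_iff₀ (by positivity)]
  have h2 : (0 : ℝ) ≤ m := by positivity
  nlinarith [mul_nonneg h2 hφ]

/-- The Dirichlet kernel as a polynomial in `8 sin² φ`. -/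
noncomputable def dirichletPoly (m : ℕ) : ℝ[X] :=
  C (2 * m + 1 : ℝ)⁻¹ *
    (1 + C 2 * ∑ l ∈ Finset.range m, (Chebyshev.T ℝ (l + 1 : ℕ)).comp (1 - C (1 / 4) * X))

/-- At X = 8 sin²φ the inner polynomial 1 - X/4 is cos 2φ, and the Chebyshev polynomial of index l +
1 turns it into cos 2(l+1)φ. -/
lemma eval_dirichletPoly (m : ℕ) (φ : ℝ) :
    (dirichletPoly m).eval (8 * Real.sin φ ^ 2) = dirichletKernel m φ := by
  have h : (1 : ℝ) - 1 / 4 * (8 * Real.sin φ ^ 2) = Real.cos (2 * φ) := by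
    rw [Real.cos_two_mul']
    nlinarith [Real.sin_sq_add_cos_sq φ]
  simp only [dirichletPoly, dirichletKernel, eval_mul, eval_C, eval_add, eval_one, eval_finsetSum,
    eval_comp, eval_sub, eval_X, h, Chebyshev.T_real_cos]
  congr 3
  refine Finset.sum_congr rfl fun l _ => ?_
  push_cast
  ring_nf

lemma natDegree_dirichletPoly_le (m : ℕ) : (dirichletPoly m).natDegree ≤ m := by
  refine (natDegree_C_mul_le _ _).trans ((natDegree_add_le _ _).trans ?_)
  rw [natDegree_one, max_eq_right (Nat.zero_le _)]
  refine (natDegree_C_mul_le _ _).trans (natDegree_sum_le_of_forall_le _ _ fun l hl => ?_)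
  refine natDegree_comp_le.trans ?_
  have h1 : (1 - C (1 / 4) * X : ℝ[X]).natDegree ≤ 1 := by compute_degree
  have h2 : (Chebyshev.T ℝ (l + 1 : ℕ)).natDegree ≤ l + 1 := by
    rw [Chebyshev.natDegree_T]; omega
  have hl' := Finset.mem_range.1 hl
  calc _ ≤ (l + 1) * 1 := Nat.mul_le_mul h2 h1
    _ ≤ m := by omega

lemma lapSymbol_le_eight (p : Plane) : lapSymbol p ≤ 8 := by
  rw [lapSymbol, Fin.sum_univ_two]
  linarith [Real.neg_one_le_cos (p 0), Real.neg_one_le_cos (p 1)]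

/-- The angle `φ` with `8 sin² φ` equal to the symbol of the Laplacian. -/
noncomputable def lapAngle (p : Plane) : ℝ := Real.arcsin (Real.sqrt (lapSymbol p / 8))

lemma sin_lapAngle (p : Plane) : Real.sin (lapAngle p) = Real.sqrt (lapSymbol p / 8) := by
  refine Real.sin_arcsin ?_ ?_
  · linarith [Real.sqrt_nonneg (lapSymbol p / 8)]
  · refine Real.sqrt_le_one.2 ?_
    linarith [lapSymbol_le_eight p]

lemma eight_mul_sin_sq (p : Plane) : 8 * Real.sin (lapAngle p) ^ 2 = lapSymbol p := by
  rw [sin_lapAngle, Real.sq_sqrt (by linarith [lapSymbol_nonneg p])]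
  ring

lemma lapAngle_mem (p : Plane) : lapAngle p ∈ Icc 0 (Real.pi / 2) :=
  ⟨Real.arcsin_nonneg.2 (Real.sqrt_nonneg _), Real.arcsin_le_pi_div_two _⟩

/-- The building block of a finite range decomposition. -/
noncomputable def rangeFactor (m : ℕ) (p : Plane) : ℝ := (dirichletPoly m).eval (lapSymbol p)

lemma rangeFactor_eq (m : ℕ) (p : Plane) : rangeFactor m p = dirichletKernel m (lapAngle p) := by
  rw [rangeFactor, ← eight_mul_sin_sq, eval_dirichletPoly]

lemma abs_rangeFactor_le_one (m : ℕ) (p : Plane) : |rangeFactor m p| ≤ 1 := by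
  rw [rangeFactor_eq]; exact abs_dirichletKernel_le_one _ _

lemma sin_lapAngle_le (p : Plane) : Real.sin (lapAngle p) ≤ ‖p‖ / Real.sqrt 8 := by
  rw [sin_lapAngle, Real.sqrt_div (lapSymbol_nonneg p)]
  gcongr
  rw [← Real.sqrt_sq (norm_nonneg p)]
  exact Real.sqrt_le_sqrt (lapSymbol_le p)

lemma le_sin_lapAngle {γ : ℕ} {p : Plane} (hp : p ∈ box γ 0) :
    ‖p‖ / Real.sqrt 8 / 2 ≤ Real.sin (lapAngle p) := by
  have h := le_lapSymbol hp
  have h2 : ‖p‖ / 2 ≤ Real.sqrt (lapSymbol p) := by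
    refine Real.le_sqrt_of_sq_le ?_
    linarith
  rw [sin_lapAngle, Real.sqrt_div (lapSymbol_nonneg p), div_right_comm]
  gcongr

lemma lapAngle_le (p : Plane) : lapAngle p ≤ 2 * Real.sin (lapAngle p) := by
  obtain ⟨h0, h1⟩ := lapAngle_mem p
  have := Real.mul_le_sin h0 h1
  have h2 : lapAngle p / 2 ≤ 2 / Real.pi * lapAngle p := by
    rw [div_mul_eq_mul_div, le_div_iff₀ Real.pi_pos]
    nlinarith [Real.pi_le_four]
  linarith

lemma rangeFactor_zero (m : ℕ) : rangeFactor m 0 = 1 := by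
  have h : lapAngle 0 = 0 := by simp [lapAngle, lapSymbol]
  have := abs_one_sub_dirichletKernel_le m le_rfl
  rw [mul_zero] at this
  rw [rangeFactor_eq, h]
  linarith [abs_nonpos_iff.1 this]

lemma abs_one_sub_rangeFactor_le (m : ℕ) (p : Plane) :
    |1 - rangeFactor m p| ≤ (2 * m + 1) * ‖p‖ := by
  have h8 : (2 : ℝ) ≤ Real.sqrt 8 := Real.le_sqrt_of_sq_le (by norm_num)
  rw [rangeFactor_eq]
  refine (abs_one_sub_dirichletKernel_le m (lapAngle_mem p).1).trans ?_
  gcongr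
  refine (lapAngle_le p).trans ((mul_le_mul_of_nonneg_left (sin_lapAngle_le p) zero_le_two).trans ?_)
  rw [mul_div_assoc', div_le_iff₀ (by positivity)]
  nlinarith [norm_nonneg p]

/-- Comes from |sin((2m+1)φ)| ≤ 1 and a lower bound on sin φ in the Brillouin zone. The fourth power
of this decay is the one required of the factors. -/
lemma abs_rangeFactor_mul_le {γ : ℕ} (m : ℕ) {p : Plane} (hp : p ∈ box γ 0) :
    (2 * m + 1) * (‖p‖ / Real.sqrt 8 / 2) * |rangeFactor m p| ≤ 1 := by
  have h := sin_mul_dirichletKernel m (lapAngle p)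
  have h1 := le_sin_lapAngle hp
  have h0 : 0 ≤ Real.sin (lapAngle p) := le_trans (by positivity) h1
  rw [rangeFactor_eq]
  calc _ ≤ (2 * m + 1) * Real.sin (lapAngle p) * |dirichletKernel m (lapAngle p)| := by gcongr
    _ = |Real.sin ((2 * m + 1) * lapAngle p)| := by
        rw [← h, abs_mul, abs_of_nonneg (by positivity : 0 ≤ (2 * (m : ℝ) + 1) * Real.sin (lapAngle p))]
    _ ≤ 1 := Real.abs_sin_le_one _

lemma abs_pow_four_sub_le {a b t : ℝ} (ha : |a| ≤ 1) (hb : |b| ≤ 1) (ha' : |a| ≤ t)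
    (hb' : |b| ≤ t) : |a ^ 4 - b ^ 4| ≤ 4 * |a - b| ∧ |a ^ 4 - b ^ 4| ≤ 4 * t * |a - b| := by
  have e : a ^ 4 - b ^ 4 = ((a + b) * (a ^ 2 + b ^ 2)) * (a - b) := by ring
  have h1 : a ^ 2 + b ^ 2 ≤ 2 := by
    have := sq_le_one_iff_abs_le_one a |>.2 ha
    have := sq_le_one_iff_abs_le_one b |>.2 hb
    linarith
  have h2 : |(a + b) * (a ^ 2 + b ^ 2)| ≤ |a + b| * 2 := by
    rw [abs_mul, abs_of_nonneg (by positivity : 0 ≤ a ^ 2 + b ^ 2)]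
    gcongr
  have h3 := abs_add_le a b
  rw [e, abs_mul]
  constructor
  · gcongr; linarith
  · gcongr; linarith

lemma sub_sin_le {φ : ℝ} (h0 : 0 ≤ φ) (h1 : φ ≤ Real.pi / 2) : φ - Real.sin φ ≤ φ ^ 3 / 2 := by
  have h : φ * Real.cos φ ≤ Real.sin φ := by
    rcases h1.lt_or_eq with h | rfl
    · have hc : 0 < Real.cos φ := Real.cos_pos_of_mem_Ioo ⟨by linarith, h⟩
      have := Real.le_tan h0 h
      rw [Real.tan_eq_sin_div_cos, le_div_iff₀ hc] at this
      exact this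
    · simp
  have h2 := Real.one_sub_sq_div_two_le_cos (x := φ)
  nlinarith

/-- Comparison of the building block with a continuum profile. -/
lemma abs_rangeFactor_sub_sinc_le {γ : ℕ} (m : ℕ) {p : Plane} (hp : p ∈ box γ 0) :
    |rangeFactor m p ^ 4 - Real.sinc ((2 * m + 1) * (‖p‖ / Real.sqrt 8)) ^ 4| ≤
      448 / (2 * m + 1) := by
  set N : ℝ := 2 * m + 1 with hN
  have hN0 : 0 < N := by positivity
  set σ := ‖p‖ / Real.sqrt 8 with hσ
  by_cases hp0 : p = 0
  · have h0 : σ = 0 := by rw [hσ, hp0]; simp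
    rw [h0, mul_zero, Real.sinc_zero, hp0, rangeFactor_zero, sub_self, abs_zero]
    positivity
  have hn : 0 < ‖p‖ := norm_pos_iff.2 hp0
  have h8 : (0 : ℝ) < Real.sqrt 8 := by positivity
  have h8' : Real.sqrt 8 ^ 2 = 8 := Real.sq_sqrt (by norm_num)
  have hσ0 : 0 < σ := by positivity
  have hσ2 : σ ^ 2 = ‖p‖ ^ 2 / 8 := by rw [hσ, div_pow, h8']
  have hσ1 : σ ≤ 2 := by
    refine le_of_sq_le_sq ?_ (by norm_num)
    have := norm_le_five_of_mem_box hp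
    rw [hσ2]
    nlinarith
  obtain ⟨f0, f1⟩ := lapAngle_mem p
  have s1 := sin_lapAngle_le p
  have s2 := le_sin_lapAngle hp
  have s3 := eight_mul_sin_sq p
  have f2 := lapAngle_le p
  have hD := sin_mul_dirichletKernel m (lapAngle p)
  have d1 := abs_rangeFactor_le_one m p
  have d2 := abs_rangeFactor_mul_le m hp
  rw [← rangeFactor_eq] at hD
  rw [← hN] at hD d2
  rw [← hσ] at s1 s2 d2
  set φ := lapAngle p
  set s := Real.sin φ with hs
  set D := rangeFactor m p
  have hs0 : 0 < s := by linarith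
  set G := Real.sinc (N * σ) with hG
  have hG' : N * σ * G = Real.sin (N * σ) := by
    rw [hG, Real.sinc_of_ne_zero (by positivity)]
    field_simp
  have g1 : |G| ≤ 1 := Real.abs_sinc_le_one _
  have g2 : |G| ≤ 2 / (N * σ) := by
    rw [le_div_iff₀ (by positivity)]
    have : |N * σ * G| ≤ 1 := by rw [hG']; exact Real.abs_sin_le_one _
    rw [abs_mul, abs_of_pos (by positivity : 0 < N * σ)] at this
    linarith
  have d3 : |D| ≤ 2 / (N * σ) := by
    rw [le_div_iff₀ (by positivity)]
    linarith
  -- From σ² - s² ≤ 8σ⁴ and σ + s ≥ σ.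
  have hdiff : σ - s ≤ 8 * σ ^ 3 := by
    have h1 := sub_lapSymbol_le p
    have h2 : σ ^ 2 - s ^ 2 ≤ 8 * σ ^ 4 := by
      have : σ ^ 4 = ‖p‖ ^ 4 / 64 := by
        rw [show σ ^ 4 = (σ ^ 2) ^ 2 by ring, hσ2]; ring
      rw [this, hσ2]
      linarith
    by_contra hc
    rw [not_le] at hc
    nlinarith
  have hφ : |φ - σ| ≤ 12 * σ ^ 3 := by
    have h1 := sub_sin_le f0 f1
    have h2 : φ ^ 3 ≤ (2 * σ) ^ 3 := by
      have : φ ≤ 2 * σ := by linarith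
      gcongr
    have h3 := Real.sin_le f0
    rw [abs_le]
    constructor <;> nlinarith [pow_pos hσ0 3]
  have hDG : |D - G| ≤ 12 * σ ^ 2 + 16 * (σ / N) := by
    -- The two quotients differ in phase, φ against σ, and in denominator, sin φ against σ.
    have e : D - G = (Real.sin (N * φ) - Real.sin (N * σ)) / (N * σ) + D * ((σ - s) / σ) := by
      rw [← hD, ← hG']
      field_simp
      ring
    have e1 : |(Real.sin (N * φ) - Real.sin (N * σ)) / (N * σ)| ≤ 12 * σ ^ 2 := by
      have h1 : |Real.sin (N * φ) - Real.sin (N * σ)| ≤ |N * φ - N * σ| := by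
        have := Real.lipschitzWith_sin.dist_le_mul (N * φ) (N * σ)
        simpa [Real.dist_eq] using this
      rw [← mul_sub, abs_mul, abs_of_pos hN0] at h1
      rw [abs_div, abs_of_pos (by positivity : 0 < N * σ), div_le_iff₀ (by positivity)]
      calc _ ≤ N * (12 * σ ^ 3) := h1.trans (by gcongr)
        _ = _ := by ring
    have e2 : |D * ((σ - s) / σ)| ≤ 16 * (σ / N) := by
      rw [abs_mul, abs_div, abs_of_pos hσ0, abs_of_nonneg (by linarith : 0 ≤ σ - s)]
      calc _ ≤ 2 / (N * σ) * (8 * σ ^ 3 / σ) := by gcongr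
        _ = _ := by field_simp; ring
    rw [e]
    exact (abs_add_le _ _).trans (add_le_add e1 e2)
  obtain ⟨p1, p2⟩ := abs_pow_four_sub_le d1 g1 d3 g2
  have hq : 0 ≤ σ / N := by positivity
  -- If Nσ ≤ 1 then σ² ≤ σ/N and boundedness suffices. If Nσ ≥ 1, the decay 2/(Nσ) of both kernels
  -- turns σ² into a multiple of σ/N. Finally σ ≤ 2.
  have key : |D ^ 4 - G ^ 4| ≤ 224 * (σ / N) := by
    rcases le_total (σ ^ 2) (σ / N) with h | h
    · linarith
    · have h1 : (N * σ)⁻¹ ≤ 1 := by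
        refine inv_le_one_of_one_le₀ ?_
        rw [div_le_iff₀ hN0] at h
        nlinarith
      calc _ ≤ 4 * (2 / (N * σ)) * (12 * σ ^ 2 + 16 * (σ / N)) := p2.trans (by gcongr)
        _ = 96 * (σ / N) + 128 * (σ / N) * (N * σ)⁻¹ := by field_simp; ring
        _ ≤ 96 * (σ / N) + 128 * (σ / N) * 1 := by gcongr
        _ = _ := by ring
  calc _ ≤ 224 * (σ / N) := key
    _ ≤ 224 * (2 / N) := by gcongr
    _ = _ := by ring

end CoulombGas

/-! ### Finite range of polynomials in the Laplacian, and positivity. -/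

namespace CoulombGas

open MeasureTheory Filter Topology Set Polynomial
open scoped ComplexConjugate

noncomputable local instance : MeasureSpace UnitAddCircle := ⟨AddCircle.haarAddCircle⟩

lemma isCompact_box (γ : ℕ) : IsCompact (box γ 0) :=
  Metric.isCompact_of_isClosed_isBounded (isClosed_box γ 0)
    ((Metric.isBounded_closedBall (x := (0 : Plane)) (r := 5)).subset fun p hp => by
      simpa using norm_le_five_of_mem_box hp)

lemma continuous_exp_pair (x : Site) :
    Continuous fun p => Complex.exp (Complex.I * (pair p x : ℂ)) := by
  unfold pair
  fun_prop

lemma setIntegral_exp_pair (γ : ℕ) {x : Site} (hx : x ≠ 0) :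
    ∫ p in box γ 0, Complex.exp (Complex.I * (pair p x : ℂ)) = 0 := by
  have h := (orthonormal_iff_ite.1 (UnitAddTorus.orthonormal_mFourier (d := Fin 2))) 0 x
  rw [if_neg hx.symm, ContinuousMap.inner_toLp] at h
  have e : ∫ t, Complex.exp (Complex.I * (pair (torusRep t) x : ℂ)) = 0 := by
    rw [← h]
    refine integral_congr_ae (Eventually.of_forall fun t => ?_)
    simp only [UnitAddTorus.mFourier_zero, ContinuousMap.one_apply, map_one, mul_one,
      mFourier_eq_exp]
  rw [integral_comp_torusRep γ (fun p => Complex.exp (Complex.I * (pair p x : ℂ)))] at e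
  exact (mul_eq_zero.1 e).resolve_left
    (inv_ne_zero (by exact_mod_cast (by positivity : (2 * Real.pi) ^ 2 ≠ 0)))

lemma lapSymbol_eq_exp (p : Plane) : (lapSymbol p : ℂ) = 4 - ∑ i : Fin 2,
    (Complex.exp (Complex.I * (pair p (Pi.single i 1) : ℂ)) +
      Complex.exp (Complex.I * (pair p (Pi.single i (-1)) : ℂ))) := by
  have e : ∀ i, pair p (Pi.single i 1) = p i ∧ pair p (Pi.single i (-1)) = -p i := by
    intro i
    constructor <;> fin_cases i <;> simp [pair]
  have h : ∀ i, Complex.exp (Complex.I * (pair p (Pi.single i 1) : ℂ)) +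
      Complex.exp (Complex.I * (pair p (Pi.single i (-1)) : ℂ)) = 2 * Real.cos (p i) := by
    intro i
    rw [(e i).1, (e i).2, Complex.ofReal_cos, Complex.two_cos]
    push_cast
    ring_nf
  simp_rw [h, Fin.sum_univ_two, lapSymbol, Fin.sum_univ_two]
  push_cast
  ring

/-- The symbol is a combination of 1 and the four unit exponentials. Each of its factors moves the
site by at most one step, and distinct exponentials are orthogonal. -/
lemma setIntegral_exp_mul_pow (γ k : ℕ) : ∀ x : Site, (∃ i, (k : ℤ) < |x i|) →
    ∫ p in box γ 0, Complex.exp (Complex.I * (pair p x : ℂ)) * (lapSymbol p : ℂ) ^ k = 0 := by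
  have hl := continuous_lapSymbol
  have hI : ∀ (k : ℕ) (x : Site), IntegrableOn
      (fun p => Complex.exp (Complex.I * (pair p x : ℂ)) * (lapSymbol p : ℂ) ^ k) (box γ 0) :=
    fun k x => ((continuous_exp_pair x).mul (by fun_prop)).continuousOn.integrableOn_compact
      (isCompact_box γ)
  induction k with
  | zero =>
    rintro x ⟨i, hi⟩
    simp only [pow_zero, mul_one]
    refine setIntegral_exp_pair γ fun h => ?_
    rw [h] at hi
    simp at hi
  | succ k ih =>
    rintro x ⟨i, hi⟩
    push_cast at hi
    have h1 : ∀ μ : Site, |μ i| ≤ 1 → ∫ p in box γ 0,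
        Complex.exp (Complex.I * (pair p (x + μ) : ℂ)) * (lapSymbol p : ℂ) ^ k = 0 := by
      intro μ hμ
      refine ih _ ⟨i, ?_⟩
      rw [Pi.add_apply]
      have := abs_sub_abs_le_abs_sub (x i) (-μ i)
      rw [abs_neg, sub_neg_eq_add] at this
      omega
    have hs : ∀ (l : Fin 2) (s : ℤ), |s| = 1 → |(Pi.single l s : Site) i| ≤ 1 := by
      intro l s hs
      by_cases h : i = l
      · subst h; simp [hs]
      · simp [h]
    have e : ∀ p, Complex.exp (Complex.I * (pair p x : ℂ)) * (lapSymbol p : ℂ) ^ (k + 1) =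
        4 * (Complex.exp (Complex.I * (pair p x : ℂ)) * (lapSymbol p : ℂ) ^ k) -
        ∑ l : Fin 2,
          (Complex.exp (Complex.I * (pair p (x + Pi.single l 1) : ℂ)) * (lapSymbol p : ℂ) ^ k +
          Complex.exp (Complex.I * (pair p (x + Pi.single l (-1)) : ℂ)) *
            (lapSymbol p : ℂ) ^ k) := by
      intro p
      have hp : ∀ μ, pair p (x + μ) = pair p x + pair p μ := fun μ => by
        simp only [pair, Pi.add_apply, Int.cast_add, mul_add, Finset.sum_add_distrib]
      simp only [hp, Complex.ofReal_add, mul_add, Complex.exp_add]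
      rw [pow_succ]
      nth_rw 2 [lapSymbol_eq_exp]
      simp only [Fin.sum_univ_two]
      ring
    have hA : ∀ l : Fin 2, IntegrableOn (fun p =>
        Complex.exp (Complex.I * (pair p (x + Pi.single l 1) : ℂ)) * (lapSymbol p : ℂ) ^ k +
          Complex.exp (Complex.I * (pair p (x + Pi.single l (-1)) : ℂ)) * (lapSymbol p : ℂ) ^ k)
        (box γ 0) := fun l => (hI k _).add (hI k _)
    simp_rw [e]
    rw [integral_sub ((hI k x).const_mul 4) (integrable_finsetSum _ fun l _ => hA l),
      integral_const_mul, ih x ⟨i, by omega⟩, integral_finsetSum _ fun l _ => hA l]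
    rw [Finset.sum_eq_zero fun l _ => ?_]
    · simp
    · rw [integral_add (hI k _) (hI k _), h1 _ (hs l 1 (by simp)), h1 _ (hs l (-1) (by simp)),
        add_zero]

/-- Polynomials of the lattice Laplacian have finite range. -/
lemma setIntegral_exp_mul_eval (γ : ℕ) (R : ℝ[X]) {x : Site} {i : Fin 2}
    (hx : (R.natDegree : ℤ) < |x i|) :
    ∫ p in box γ 0, Complex.exp (Complex.I * (pair p x : ℂ)) *
      ((R.eval (lapSymbol p) : ℝ) : ℂ) = 0 := by
  have hl := continuous_lapSymbol
  have e : ∀ p, Complex.exp (Complex.I * (pair p x : ℂ)) * ((R.eval (lapSymbol p) : ℝ) : ℂ) =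
      ∑ k ∈ Finset.range (R.natDegree + 1), (R.coeff k : ℂ) *
        (Complex.exp (Complex.I * (pair p x : ℂ)) * (lapSymbol p : ℂ) ^ k) := by
    intro p
    rw [eval_eq_sum_range]
    push_cast
    rw [Finset.mul_sum]
    exact Finset.sum_congr rfl fun k _ => by ring
  have hI : ∀ k, IntegrableOn (fun p => (R.coeff k : ℂ) *
      (Complex.exp (Complex.I * (pair p x : ℂ)) * (lapSymbol p : ℂ) ^ k)) (box γ 0) := fun k =>
    (continuous_const.mul ((continuous_exp_pair x).mul
      (by fun_prop))).continuousOn.integrableOn_compact (isCompact_box γ)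
  simp_rw [e]
  rw [integral_finsetSum _ fun k _ => hI k]
  refine Finset.sum_eq_zero fun k hk => ?_
  have hk' := Finset.mem_range.1 hk
  rw [integral_const_mul, setIntegral_exp_mul_pow γ k x ⟨i, by omega⟩, mul_zero]

lemma latticeFourier_ofReal (γ : ℕ) {f : Plane → ℝ} (hf : IntegrableOn f (box γ 0)) (y : Site) :
    latticeFourier γ (fun p => (f p : ℂ)) y =
      ((((2 * Real.pi) ^ 2)⁻¹ * ∫ p in box γ 0, Real.cos (pair p y) * f p : ℝ) : ℂ) +
      ((((2 * Real.pi) ^ 2)⁻¹ * ∫ p in box γ 0, Real.sin (pair p y) * f p : ℝ) : ℂ) * Complex.I := by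
  have hc : ∀ g : ℝ → ℝ, Continuous g → (∀ t, |g t| ≤ 1) →
      IntegrableOn (fun p => g (pair p y) * f p) (box γ 0) := fun g hg hb => by
    refine hf.bdd_mul (c := 1) (Continuous.measurable ?_).aestronglyMeasurable
      (Eventually.of_forall fun q => hb _)
    unfold pair
    fun_prop
  have i1 := hc Real.cos Real.continuous_cos Real.abs_cos_le_one
  have i2 := hc Real.sin Real.continuous_sin Real.abs_sin_le_one
  have e : ∀ p, Complex.exp (Complex.I * (pair p y : ℂ)) * (f p : ℂ) =
      ((Real.cos (pair p y) * f p : ℝ) : ℂ) + ((Real.sin (pair p y) * f p : ℝ) : ℂ) * Complex.I := by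
    intro p
    rw [mul_comm Complex.I, Complex.exp_mul_I]
    push_cast
    ring
  rw [latticeFourier]
  simp_rw [e]
  rw [integral_add i1.ofReal (i2.ofReal.mul_const _), integral_mul_const, integral_complex_ofReal,
    integral_complex_ofReal]
  push_cast
  ring

lemma pair_neg (p : Plane) (y : Site) : pair (-p) y = -pair p y := by
  simp [pair, Finset.sum_neg_distrib]

lemma latticeFourier_im (γ : ℕ) {f : Plane → ℝ} (hf : IntegrableOn f (box γ 0))
    (he : ∀ p, f (-p) = f p) (y : Site) : (latticeFourier γ (fun p => (f p : ℂ)) y).im = 0 := by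
  have h : ∫ p in box γ 0, Real.sin (pair p y) * f p = 0 := by
    have hb : ∀ p : Plane, -p ∈ box γ 0 ↔ p ∈ box γ 0 := fun p => by simp [box]
    rw [← integral_indicator (measurableSet_box γ 0)]
    have e : ∀ p, (box γ 0).indicator (fun p => Real.sin (pair p y) * f p) (-p) =
        -(box γ 0).indicator (fun p => Real.sin (pair p y) * f p) p := by
      intro p
      by_cases hp : p ∈ box γ 0
      · rw [indicator_of_mem hp, indicator_of_mem ((hb p).2 hp), pair_neg, he, Real.sin_neg, neg_mul]
      · rw [indicator_of_notMem hp, indicator_of_notMem fun h => hp ((hb p).1 h), neg_zero]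
    have h1 := integral_neg_eq_self
      ((box γ 0).indicator (fun p => Real.sin (pair p y) * f p)) volume
    simp_rw [e, integral_neg] at h1
    linarith
  rw [latticeFourier_ofReal γ hf, h]
  rw [mul_zero, Complex.ofReal_zero, zero_mul, add_zero, Complex.ofReal_im]

lemma latticeFourier_re (γ : ℕ) {f : Plane → ℝ} (hf : IntegrableOn f (box γ 0)) (y : Site) :
    (latticeFourier γ (fun p => (f p : ℂ)) y).re =
      ((2 * Real.pi) ^ 2)⁻¹ * ∫ p in box γ 0, Real.cos (pair p y) * f p := by
  rw [latticeFourier_ofReal γ hf, Complex.add_re, Complex.ofReal_re, Complex.re_ofReal_mul,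
    Complex.I_re, mul_zero, add_zero]

/-- The quadratic form is the integral of f times |∑ v_x e^{ip·x}|², written with cosines and sines.
-/
lemma posSemidef_latticeFourier (γ : ℕ) {f : Plane → ℝ} (hf : IntegrableOn f (box γ 0))
    (h0 : ∀ p ∈ box γ 0, 0 ≤ f p) : Matrix.PosSemidef
      (Matrix.of fun x y : Site => (latticeFourier γ (fun p => (f p : ℂ)) (x - y)).re) := by
  have hp : ∀ p (x y : Site), pair p (x - y) = pair p x - pair p y := fun p x y => by
    simp only [pair, Pi.sub_apply, Int.cast_sub, mul_sub, Finset.sum_sub_distrib]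
  have hc : ∀ y : Site, IntegrableOn (fun p => Real.cos (pair p y) * f p) (box γ 0) := fun y => by
    refine hf.bdd_mul (c := 1) (Continuous.measurable ?_).aestronglyMeasurable
      (Eventually.of_forall fun q => Real.abs_cos_le_one _)
    unfold pair
    fun_prop
  refine ⟨?_, fun v => ?_⟩
  · ext x y
    simp only [Matrix.conjTranspose_apply, Matrix.of_apply, star_trivial, latticeFourier_re γ hf]
    congr 2
    ext p
    rw [hp, hp, ← Real.cos_neg, neg_sub]
  · simp only [Finsupp.sum, Matrix.of_apply, star_trivial, latticeFourier_re γ hf]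
    have e : ∑ x ∈ v.support, ∑ y ∈ v.support, v x * (((2 * Real.pi) ^ 2)⁻¹ *
        ∫ p in box γ 0, Real.cos (pair p (x - y)) * f p) * v y = ((2 * Real.pi) ^ 2)⁻¹ *
        ∫ p in box γ 0, ((∑ x ∈ v.support, v x * Real.cos (pair p x)) ^ 2 +
          (∑ x ∈ v.support, v x * Real.sin (pair p x)) ^ 2) * f p := by
      have e1 : ∀ x y, v x * (((2 * Real.pi) ^ 2)⁻¹ *
          ∫ p in box γ 0, Real.cos (pair p (x - y)) * f p) * v y = ((2 * Real.pi) ^ 2)⁻¹ *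
          ∫ p in box γ 0, v x * v y * (Real.cos (pair p (x - y)) * f p) := fun x y => by
        rw [integral_const_mul]; ring
      simp_rw [e1, ← Finset.mul_sum]
      congr 1
      simp_rw [← integral_finsetSum v.support fun y _ => (hc _).const_mul _]
      rw [← integral_finsetSum v.support fun x _ => integrable_finsetSum v.support
        fun y _ => (hc _).const_mul _]
      refine integral_congr_ae (Eventually.of_forall fun p => ?_)
      simp only [hp, Real.cos_sub]
      rw [sq, sq, Finset.sum_mul_sum, Finset.sum_mul_sum, ← Finset.sum_add_distrib, Finset.sum_mul]
      refine Finset.sum_congr rfl fun x _ => ?_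
      rw [← Finset.sum_add_distrib, Finset.sum_mul]
      exact Finset.sum_congr rfl fun y _ => by ring
    rw [e]
    exact mul_nonneg (by positivity) (setIntegral_nonneg (measurableSet_box γ 0) fun p hp' =>
      mul_nonneg (by positivity) (h0 p hp'))

end CoulombGas

/-! ### Existence of a finite range decomposition. -/

namespace CoulombGas

open MeasureTheory Filter Topology Set Polynomial

/-- The degree of the `n`-th factor: `2 * rangeOrder γ n + 1 = γ ^ (n - 2)` for odd `γ`. -/
def rangeOrder (γ n : ℕ) : ℕ := γ ^ (n - 2) / 2

/-- A finite range decomposition whose factors are fourth powers of Dirichlet kernels. -/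
noncomputable def rangeFamily (γ h n : ℕ) (p : Plane) : ℂ :=
  ((rangeFactor (rangeOrder γ n) (((γ : ℝ) ^ h)⁻¹ • p) ^ 4 : ℝ) : ℂ)

lemma two_mul_rangeOrder_add_one {γ : ℕ} (hγ : Odd γ) (n : ℕ) :
    2 * rangeOrder γ n + 1 = γ ^ (n - 2) :=
  Nat.two_mul_div_two_add_one_of_odd hγ.pow

lemma cast_two_mul_rangeOrder_add_one {γ : ℕ} (hγ : Odd γ) (n : ℕ) :
    (2 * (rangeOrder γ n : ℝ) + 1) = (γ : ℝ) ^ (n - 2) := by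
  exact_mod_cast two_mul_rangeOrder_add_one hγ n

/-- The cutoff contains eighth powers: fourth powers of kernels, then a squared modulus. The shift n
- 2 in the order provides a factor γ² ≥ 9 that absorbs this 8. -/
lemma sum_rangeOrder_le {γ : ℕ} (hγ : 3 ≤ γ) (h : ℕ) :
    2 * ∑ n ∈ Finset.range (h + 1), 8 * rangeOrder γ n ≤ γ ^ (h + 1) := by
  -- The subtraction n - 2 is truncated, so for n ≤ 2 the order is 0 and the factor is identically
  -- 1.
  have h0 : ∀ n < 3, rangeOrder γ n = 0 := by
    intro n hn
    rw [rangeOrder, Nat.sub_eq_zero_of_le (by omega), pow_zero, Nat.div_eq_of_lt one_lt_two]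
  induction h with
  | zero => simp [h0]
  | succ h ih =>
    rw [Finset.sum_range_succ, mul_add]
    rcases h with _ | h
    · simp [h0]
    · have e1 : 2 * rangeOrder γ (h + 1 + 1) ≤ γ ^ h := Nat.mul_div_le _ _
      have e2 : γ ^ (h + 1 + 1) = γ ^ h * (γ * γ) := by ring
      have e3 : γ ^ (h + 1 + 1 + 1) = γ ^ (h + 1 + 1) * γ := by ring
      have e4 : γ ^ h * 9 ≤ γ ^ (h + 1 + 1) := by
        rw [e2]; exact Nat.mul_le_mul_left _ (Nat.mul_le_mul hγ hγ)
      have e5 : γ ^ (h + 1 + 1) * 3 ≤ γ ^ (h + 1 + 1 + 1) := by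
        rw [e3]; exact Nat.mul_le_mul_left _ hγ
      omega

/-- The Fourier multiplier of the first `h` factors. -/
noncomputable def cutoffPoly (γ h : ℕ) : ℝ[X] :=
  ∏ n ∈ Finset.range h, dirichletPoly (rangeOrder γ n) ^ 8

/-- The covariance of the scale `h` as a polynomial of the lattice Laplacian. -/
noncomputable def slicePoly (γ h : ℕ) : ℝ[X] := (cutoffPoly γ h - cutoffPoly γ (h + 1)).divX

lemma eval_cutoffPoly (γ h : ℕ) (p : Plane) : (cutoffPoly γ h).eval (lapSymbol p) =
    ∏ n ∈ Finset.range h, rangeFactor (rangeOrder γ n) p ^ 8 := by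
  simp [cutoffPoly, eval_prod, rangeFactor]

lemma cutoff_rangeFamily {γ : ℕ} (hγ : 1 < γ) (h : ℕ) (p : Plane) :
    cutoff (rangeFamily γ) h ((γ : ℝ) ^ h • p) = (cutoffPoly γ h).eval (lapSymbol p) := by
  have hg : (γ : ℝ) ^ h ≠ 0 := by positivity
  rw [eval_cutoffPoly, cutoff]
  refine Finset.prod_congr rfl fun n _ => ?_
  rw [rangeFamily, inv_smul_smul₀ hg, Complex.norm_real, Real.norm_eq_abs, sq_abs]
  ring

lemma slabSymbol_rangeFamily {γ : ℕ} (hγ : 1 < γ) (h : ℕ) (p : Plane) :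
    slabSymbol γ (rangeFamily γ) h 1 p =
      (cutoffPoly γ h - cutoffPoly γ (h + 1)).eval (lapSymbol p) := by
  rw [slabSymbol_eq, cutoff_rangeFamily hγ, cutoff_rangeFamily hγ, eval_sub]

/-- In lattice units the n-th factor does not depend on h. So F_{h+1} is F_h times one more factor
in [0, 1]. -/
lemma slabSymbol_rangeFamily_nonneg {γ : ℕ} (hγ : 1 < γ) (h : ℕ) (p : Plane) :
    0 ≤ slabSymbol γ (rangeFamily γ) h 1 p := by
  rw [slabSymbol_rangeFamily hγ, eval_sub, eval_cutoffPoly, eval_cutoffPoly,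
    Finset.prod_range_succ, sub_nonneg]
  refine mul_le_of_le_one_right (Finset.prod_nonneg fun n _ => Even.pow_nonneg (by decide) _) ?_
  rw [← Even.pow_abs (by decide)]
  exact pow_le_one₀ (abs_nonneg _) (abs_rangeFactor_le_one _ _)

lemma lapSymbol_zero : lapSymbol 0 = 0 := by simp [lapSymbol]

lemma lapSymbol_neg (p : Plane) : lapSymbol (-p) = lapSymbol p := by simp [lapSymbol]

/-- Every cutoff polynomial is 1 at 0, so the difference has no constant term and is divisible by X.
The slice is thus itself a polynomial in the Laplacian. -/
lemma lapSymbol_mul_eval_slicePoly (γ h : ℕ) (p : Plane) :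
    lapSymbol p * (slicePoly γ h).eval (lapSymbol p) =
      (cutoffPoly γ h - cutoffPoly γ (h + 1)).eval (lapSymbol p) := by
  have hev : ∀ h, (cutoffPoly γ h).eval 0 = 1 := fun h => by
    rw [← lapSymbol_zero, eval_cutoffPoly]
    simp [rangeFactor_zero]
  have h0 : (cutoffPoly γ h - cutoffPoly γ (h + 1)).coeff 0 = 0 := by
    rw [coeff_zero_eq_eval_zero, eval_sub, hev, hev, sub_self]
  conv_rhs => rw [← X_mul_divX_add (cutoffPoly γ h - cutoffPoly γ (h + 1)), h0]
  simp [slicePoly]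

lemma natDegree_cutoffPoly_le (γ h : ℕ) :
    (cutoffPoly γ h).natDegree ≤ ∑ n ∈ Finset.range h, 8 * rangeOrder γ n := by
  refine (natDegree_prod_le _ _).trans (Finset.sum_le_sum fun n _ => ?_)
  exact natDegree_pow_le.trans (Nat.mul_le_mul_left _ (natDegree_dirichletPoly_le _))

lemma two_mul_natDegree_slicePoly_le {γ : ℕ} (hγ : 3 ≤ γ) (h : ℕ) :
    2 * (slicePoly γ h).natDegree ≤ γ ^ (h + 1) := by
  refine le_trans (Nat.mul_le_mul_left 2 ?_) (sum_rangeOrder_le hγ h)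
  rw [slicePoly, natDegree_divX_eq_natDegree_tsub_one]
  refine (Nat.sub_le _ _).trans ((natDegree_sub_le _ _).trans (max_le ?_ ?_))
  · refine (natDegree_cutoffPoly_le γ h).trans ?_
    rw [Finset.sum_range_succ]
    exact Nat.le_add_right _ _
  · exact natDegree_cutoffPoly_le γ (h + 1)

/-- Only almost everywhere: at p = 0 the quotient is 0 by the convention on division, not the value
of the polynomial. -/
lemma slabKernel_rangeFamily_ae {γ : ℕ} (hγ : 1 < γ) (h : ℕ) :
    slabKernel γ (rangeFamily γ) h 1 =ᵐ[volume.restrict (box γ 0)]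
      fun p => (slicePoly γ h).eval (lapSymbol p) := by
  have hne : ∀ᵐ p : Plane ∂volume.restrict (box γ 0), p ≠ 0 :=
    ae_restrict_of_ae (by simp [ae_iff])
  filter_upwards [ae_restrict_mem (measurableSet_box γ 0), hne] with p hp hp0
  have hl : lapSymbol p ≠ 0 := by
    have h1 := le_lapSymbol hp
    have h2 : 0 < ‖p‖ := norm_pos_iff.2 hp0
    exact (lt_of_lt_of_le (by positivity) h1).ne'
  rw [slabKernel, indicator_of_mem hp, slabSymbol_rangeFamily hγ, ← lapSymbol_mul_eval_slicePoly,
    mul_div_cancel_left₀ _ hl]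

lemma sliceCov_rangeFamily {γ : ℕ} (hγ : 1 < γ) (h : ℕ) (y : Site) :
    sliceCov γ (rangeFamily γ) h y =
      latticeFourier γ (fun p => (((slicePoly γ h).eval (lapSymbol p) : ℝ) : ℂ)) y := by
  rw [sliceCov_eq_latticeFourier, latticeFourier, latticeFourier]
  congr 1
  refine integral_congr_ae ?_
  filter_upwards [slabKernel_rangeFamily_ae hγ h] with p hp
  rw [hp]

lemma integrableOn_eval_lapSymbol (γ : ℕ) (R : ℝ[X]) :
    IntegrableOn (fun p => R.eval (lapSymbol p)) (box γ 0) :=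
  (R.continuous.comp continuous_lapSymbol).continuousOn.integrableOn_compact (isCompact_box γ)

lemma differentiable_rangeFamily (γ h n : ℕ) : Differentiable ℝ (rangeFamily γ h n) := by
  have hl : Differentiable ℝ lapSymbol := by
    unfold lapSymbol
    fun_prop
  have hr : ∀ m, Differentiable ℝ (rangeFactor m) := fun m =>
    (dirichletPoly m).differentiable.comp hl
  have h1 : Differentiable ℝ fun p : Plane => ((γ : ℝ) ^ h)⁻¹ • p := by fun_prop
  have h2 : Differentiable ℝ fun p : Plane =>
      rangeFactor (rangeOrder γ n) (((γ : ℝ) ^ h)⁻¹ • p) ^ 4 := ((hr _).comp h1).fun_pow 4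
  exact Complex.ofRealCLM.differentiable.comp h2

lemma norm_one_sub_rangeFamily_le {γ : ℕ} (hγ : Odd γ) (h n : ℕ) (p : Plane) :
    ‖1 - rangeFamily γ h n p‖ ≤ 4 * ((γ : ℝ) ^ (n - 2) * (((γ : ℝ) ^ h)⁻¹ * ‖p‖)) := by
  set k : Plane := ((γ : ℝ) ^ h)⁻¹ • p with hk
  have hn : ‖k‖ = ((γ : ℝ) ^ h)⁻¹ * ‖p‖ := by
    rw [hk, norm_smul, norm_inv, norm_pow, Real.norm_natCast]
  have h1 := abs_one_sub_rangeFactor_le (rangeOrder γ n) k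
  rw [cast_two_mul_rangeOrder_add_one hγ, hn] at h1
  have h2 := abs_rangeFactor_le_one (rangeOrder γ n) k
  rw [rangeFamily, ← hk, ← Complex.ofReal_one, ← Complex.ofReal_sub, Complex.norm_real,
    Real.norm_eq_abs]
  set r := rangeFactor (rangeOrder γ n) k
  have e : 1 - r ^ 4 = (1 - r) * (1 + r + r ^ 2 + r ^ 3) := by ring
  have h3 : |1 + r + r ^ 2 + r ^ 3| ≤ 4 := by
    rw [abs_le] at h2 ⊢
    constructor <;> nlinarith [sq_nonneg r, sq_nonneg (r + 1), sq_nonneg (r - 1)]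
  rw [e, abs_mul]
  calc _ ≤ |1 - r| * 4 := by gcongr
    _ ≤ _ := by linarith

lemma inv_smul_mem_box {γ h : ℕ} (hγ : 1 < γ) {p : Plane} (hp : p ∈ box γ h) :
    ((γ : ℝ) ^ h)⁻¹ • p ∈ box γ 0 := by
  intro i
  have hg : (0 : ℝ) < (γ : ℝ) ^ h := by positivity
  rw [PiLp.smul_apply, smul_eq_mul, abs_mul, abs_inv, abs_of_pos hg, inv_mul_le_iff₀ hg]
  simpa [mul_comm] using hp i

lemma norm_inv_pow_smul (γ h : ℕ) (p : Plane) :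
    ‖((γ : ℝ) ^ h)⁻¹ • p‖ = ((γ : ℝ) ^ h)⁻¹ * ‖p‖ := by
  rw [norm_smul, norm_inv, norm_pow, Real.norm_natCast]

lemma norm_rangeFamily (γ h n : ℕ) (p : Plane) : ‖rangeFamily γ h n p‖ =
    |rangeFactor (rangeOrder γ n) (((γ : ℝ) ^ h)⁻¹ • p)| ^ 4 := by
  rw [rangeFamily, Complex.norm_real, Real.norm_eq_abs, abs_pow]

lemma norm_rangeFamily_le {γ : ℕ} (hγ : Odd γ) (hγ1 : 1 < γ) {h n : ℕ} (hn : n < h) {p : Plane}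
    (hp : p ∈ box γ h) : ‖rangeFamily γ h n p‖ ≤
      (1 + (6 * (γ : ℝ) ^ 3) ^ 4) / (1 + (((γ : ℝ) ^ (h - n - 1))⁻¹ * ‖p‖) ^ 4) := by
  have hg : (1 : ℝ) ≤ γ := by exact_mod_cast hγ1.le
  have h8 : Real.sqrt 8 ≤ 3 := Real.sqrt_le_iff.2 (by norm_num)
  have h8' : 0 < Real.sqrt 8 := by positivity
  have h1 := abs_rangeFactor_mul_le (rangeOrder γ n) (inv_smul_mem_box hγ1 hp)
  have h2 := abs_rangeFactor_le_one (rangeOrder γ n) (((γ : ℝ) ^ h)⁻¹ • p)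
  rw [cast_two_mul_rangeOrder_add_one hγ, norm_inv_pow_smul] at h1
  rw [norm_rangeFamily, le_div_iff₀ (by positivity)]
  set r := |rangeFactor (rangeOrder γ n) (((γ : ℝ) ^ h)⁻¹ • p)|
  have hr : 0 ≤ r := abs_nonneg _
  set k := ((γ : ℝ) ^ h)⁻¹ * ‖p‖ with hk
  have hk0 : 0 ≤ k := by positivity
  have e : ((γ : ℝ) ^ (h - n - 1))⁻¹ * ‖p‖ = (γ : ℝ) ^ (n + 1) * k := by
    have : (γ : ℝ) ^ h = (γ : ℝ) ^ (h - n - 1) * (γ : ℝ) ^ (n + 1) := by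
      rw [← pow_add]; congr 1; omega
    rw [hk, this]
    field_simp
  have h3 : (γ : ℝ) ^ (n - 2) * k * r ≤ 6 := by
    have h4 : (γ : ℝ) ^ (n - 2) * (k / Real.sqrt 8 / 2) * r =
        (γ : ℝ) ^ (n - 2) * k * r / (Real.sqrt 8 * 2) := by
      field_simp
    rw [h4, div_le_one (by positivity)] at h1
    linarith
  -- The required decay has n + 1 where the kernel has n - 2; this costs γ³, and n + 1 ≤ (n - 2) + 3
  -- covers the truncated cases too.
  have h5 : (γ : ℝ) ^ (n + 1) * k * r ≤ 6 * (γ : ℝ) ^ 3 := by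
    have h6 : (γ : ℝ) ^ (n + 1) ≤ (γ : ℝ) ^ (n - 2) * (γ : ℝ) ^ 3 := by
      rw [← pow_add]
      exact pow_le_pow_right₀ hg (by omega)
    calc _ ≤ (γ : ℝ) ^ (n - 2) * (γ : ℝ) ^ 3 * k * r := by gcongr
      _ = (γ : ℝ) ^ (n - 2) * k * r * (γ : ℝ) ^ 3 := by ring
      _ ≤ _ := by gcongr
  rw [e]
  calc r ^ 4 * (1 + ((γ : ℝ) ^ (n + 1) * k) ^ 4) = r ^ 4 + ((γ : ℝ) ^ (n + 1) * k * r) ^ 4 := by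
        ring
    _ ≤ _ := by gcongr; exact pow_le_one₀ hr h2

/-- Both factors are compared with the same sinc profile, and the errors add. For n < 2 the trivial
bound 2 is enough. -/
lemma norm_rangeFamily_sub_le {γ : ℕ} (hγ : Odd γ) (hγ1 : 1 < γ) (h n : ℕ) {p : Plane}
    (hp : p ∈ box γ h) : ‖rangeFamily γ h n p - rangeFamily γ (h + 1) (n + 1) p‖ ≤
      896 * (γ : ℝ) ^ 2 * ((γ : ℝ) ^ n)⁻¹ := by
  have hg : (1 : ℝ) ≤ γ := by exact_mod_cast hγ1.le
  have hp' : p ∈ box γ (h + 1) := fun i => (hp i).trans (by gcongr; exact Nat.le_succ h)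
  rcases lt_or_ge n 2 with hn | hn
  · have h1 : ∀ h n, ‖rangeFamily γ h n p‖ ≤ 1 := fun h n => by
      rw [norm_rangeFamily]
      exact pow_le_one₀ (abs_nonneg _) (abs_rangeFactor_le_one _ _)
    have h2 : (γ : ℝ) ^ n ≤ (γ : ℝ) ^ 2 := pow_le_pow_right₀ hg hn.le
    have h3 : 1 ≤ (γ : ℝ) ^ 2 * ((γ : ℝ) ^ n)⁻¹ := by
      rwa [← div_eq_mul_inv, one_le_div (by positivity)]
    refine (norm_sub_le _ _).trans ?_
    linarith [h1 h n, h1 (h + 1) (n + 1)]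
  · obtain ⟨m, rfl⟩ : ∃ m, n = m + 2 := ⟨n - 2, by omega⟩
    have h1 := abs_rangeFactor_sub_sinc_le (rangeOrder γ (m + 2)) (inv_smul_mem_box hγ1 hp)
    have h2 := abs_rangeFactor_sub_sinc_le (rangeOrder γ (m + 2 + 1)) (inv_smul_mem_box hγ1 hp')
    -- Kernel length and lattice spacing change by the same factor γ, so the argument of the sinc is
    -- common to both factors.
    have e : (γ : ℝ) ^ (m + 1) * (((γ : ℝ) ^ (h + 1))⁻¹ * ‖p‖ / Real.sqrt 8) =
        (γ : ℝ) ^ m * (((γ : ℝ) ^ h)⁻¹ * ‖p‖ / Real.sqrt 8) := by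
      rw [pow_succ, pow_succ]
      field_simp
    rw [cast_two_mul_rangeOrder_add_one hγ, norm_inv_pow_smul] at h1 h2
    rw [show m + 2 + 1 - 2 = m + 1 by omega, e, abs_sub_comm] at h2
    rw [show m + 2 - 2 = m by omega] at h1
    have h3 : 448 / (γ : ℝ) ^ (m + 1) ≤ 448 / (γ : ℝ) ^ m := by
      gcongr
      exact Nat.le_succ m
    have h4 : (896 : ℝ) * (γ : ℝ) ^ 2 * ((γ : ℝ) ^ (m + 2))⁻¹ = 448 / (γ : ℝ) ^ m +
        448 / (γ : ℝ) ^ m := by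
      rw [pow_add]
      field_simp
      norm_num
    rw [rangeFamily, rangeFamily, ← Complex.ofReal_sub, Complex.norm_real, Real.norm_eq_abs, h4]
    exact (abs_sub_le _ _ _).trans (add_le_add h1 (h2.trans h3))

theorem exists_isFiniteRangeDecomposition {γ : ℕ} (hγ : Odd γ) (hγ1 : 1 < γ) :
    ∃ A, IsFiniteRangeDecomposition γ A := by
  have hγ3 : 3 ≤ γ := by
    obtain ⟨k, rfl⟩ := hγ
    omega
  have hg : (1 : ℝ) ≤ γ := by exact_mod_cast hγ1.le
  refine ⟨rangeFamily γ, fun h n _ => (differentiable_rangeFamily γ h n).differentiableOn,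
    fun h x => ?_, fun h => ?_, fun h x hx => ?_,
    -- The sum of the constants for the bound at the origin, the decay and the comparison of lattice
    -- spacings.
    4 + (1 + (6 * (γ : ℝ) ^ 3) ^ 4) + 896 * (γ : ℝ) ^ 2, fun h n hn => ⟨?_, fun p hp =>
      ⟨?_, ?_, ?_, ?_⟩⟩⟩
  · rw [sliceCov_rangeFamily hγ1]
    exact latticeFourier_im γ (integrableOn_eval_lapSymbol γ _)
      (fun p => by rw [lapSymbol_neg]) x
  · simp_rw [sliceCov_eq_latticeFourier]
    refine posSemidef_latticeFourier γ ((integrableOn_eval_lapSymbol γ (slicePoly γ h)).congr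
      (slabKernel_rangeFamily_ae hγ1 h).symm) fun p hp => ?_
    rw [slabKernel, indicator_of_mem hp]
    exact div_nonneg (slabSymbol_rangeFamily_nonneg hγ1 h p) (lapSymbol_nonneg p)
  · have hd : (2 * (slicePoly γ h).natDegree : ℝ) ≤ (γ : ℝ) ^ (h + 1) := by
      exact_mod_cast two_mul_natDegree_slicePoly_le hγ3 h
    have h1 : ((slicePoly γ h).natDegree : ℤ) < maxLen x := by
      have : ((slicePoly γ h).natDegree : ℝ) < (maxLen x : ℝ) := by linarith
      exact_mod_cast this
    rw [sliceCov_rangeFamily hγ1, latticeFourier]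
    rcases lt_max_iff.1 h1 with h2 | h2 <;>
      rw [setIntegral_exp_mul_eval γ _ h2, mul_zero]
  · rw [rangeFamily, smul_zero, rangeFactor_zero, one_pow, Complex.ofReal_one]
  · rw [norm_rangeFamily]
    exact pow_le_one₀ (abs_nonneg _) (abs_rangeFactor_le_one _ _)
  · refine (norm_one_sub_rangeFamily_le hγ h n p).trans ?_
    have h1 : (γ : ℝ) ^ (n - 2) * ((γ : ℝ) ^ h)⁻¹ ≤ ((γ : ℝ) ^ (h - n))⁻¹ := by
      have : (γ : ℝ) ^ h = (γ : ℝ) ^ (h - n) * (γ : ℝ) ^ n := by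
        rw [← pow_add]; congr 1; omega
      rw [this, mul_inv, mul_left_comm]
      refine mul_le_of_le_one_right (by positivity) ?_
      rw [← div_eq_mul_inv, div_le_one (by positivity)]
      exact pow_le_pow_right₀ hg (Nat.sub_le _ _)
    calc 4 * ((γ : ℝ) ^ (n - 2) * (((γ : ℝ) ^ h)⁻¹ * ‖p‖)) =
          4 * ‖p‖ * ((γ : ℝ) ^ (n - 2) * ((γ : ℝ) ^ h)⁻¹) := by ring
      _ ≤ _ := by
        gcongr
        linarith [show 0 ≤ 1 + (6 * (γ : ℝ) ^ 3) ^ 4 + 896 * (γ : ℝ) ^ 2 by positivity]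
  · refine (norm_rangeFamily_le hγ hγ1 hn hp).trans
      (div_le_div_of_nonneg_right ?_ (by positivity))
    linarith [show 0 ≤ 896 * (γ : ℝ) ^ 2 by positivity]
  · refine (norm_rangeFamily_sub_le hγ hγ1 h n hp).trans ?_
    gcongr
    linarith [show 0 ≤ 4 + (1 + (6 * (γ : ℝ) ^ 3) ^ 4) by positivity]

end CoulombGas

/-! ### Assembly of the theorem. -/

namespace CoulombGas

open MeasureTheory Filter Topology Set

/-- The flow coefficients of a finite range decomposition converge. -/
theorem exists_flow_bounds {γ : ℕ} (hγ : 1 < γ) {A : ℕ → ℕ → Plane → ℂ}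
    (hA : IsFiniteRangeDecomposition γ A) :
    ∃ u : Plane → ℝ, (∀ p, Tendsto (fun h => cutoff A h p) atTop (𝓝 (u p))) ∧
      ∃ c : ℝ, IsPotentialConstant u c ∧
        ∃ C : ℝ, ∀ M : ℕ, 1 ≤ M → ∀ α : ℝ, α ^ 2 = 8 * Real.pi →
          (∀ j : ℕ, |((γ ^ M : ℕ) : ℝ) ^ 2 * Real.exp (-(α ^ 2 / 2) * blockCov γ M A j 0) - 1| ≤
            C * rate (γ ^ M) ^ j) ∧
          (∃ B, ∀ j : ℕ, |aCoeff α (γ ^ M : ℕ) (blockCov γ M A) j -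
            8 * Real.pi ^ 2 * Real.exp (8 * Real.pi * c) * Real.log (γ ^ M : ℕ)| ≤
              B * rate (γ ^ M) ^ j) ∧
          ∃ B, ∀ j : ℕ, |bCoeff α (γ ^ M : ℕ) (blockCov γ M A) j - 2 * Real.log (γ ^ M : ℕ)| ≤
            B * rate (γ ^ M) ^ j := by
  obtain ⟨u, C, H⟩ := exists_cutoffEstimates hγ hA
  obtain ⟨κ, hκ⟩ := exists_isPotentialConstant H.measurable H.lim_origin fun p => by
    rw [abs_of_nonneg (H.lim_nonneg p)]
    exact (H.lim_decay p).trans (H.div_pow_four_le p)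
  obtain ⟨K, P⟩ := H.exists_scaleProfile hγ hA.finiteRange hκ
  refine ⟨u, H.tendsto, κ, hκ, 4 * Real.pi * (K * (1 - rate γ)⁻¹) *
    Real.exp (4 * Real.pi * (K * (1 - rate γ)⁻¹)), fun M hM α hα => ?_⟩
  have hγM : 1 < γ ^ M := Nat.one_lt_pow (by omega) hγ
  have PM : ScaleProfile (γ ^ M) (blockCov γ M A) (potential u) κ (K * (1 - rate γ)⁻¹) :=
    P.block hγ M
  refine ⟨fun j => ?_, PM.exists_aCoeff_bound hγM hα, H.exists_bCoeff_bound hγ hA.real hα hM PM⟩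
  rw [hα, show 8 * Real.pi / 2 = 4 * Real.pi by ring]
  exact PM.abs_sq_mul_exp_sub_one_le hγM j

theorem tendsto_of_abs_sub_le {γ : ℕ} (hγ : 1 < γ) {f : ℕ → ℝ} {a B : ℝ}
    (h : ∀ j, |f j - a| ≤ B * rate γ ^ j) : Tendsto f atTop (𝓝 a) := by
  rw [tendsto_iff_norm_sub_tendsto_zero]
  refine squeeze_zero (fun _ => norm_nonneg _) h ?_
  simpa using (tendsto_pow_atTop_nhds_zero_of_lt_one (rate_pos hγ).le (rate_lt_one hγ)).const_mul B

end CoulombGas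

theorem mainTheorem10 (γ : ℕ) (hγ_odd : Odd γ) (hγ : 1 < γ) :
    (∃ A : ℕ → ℕ → CoulombGas.Plane → ℂ, CoulombGas.IsFiniteRangeDecomposition γ A) ∧
    ∀ A : ℕ → ℕ → CoulombGas.Plane → ℂ, CoulombGas.IsFiniteRangeDecomposition γ A →
      ∃ u : CoulombGas.Plane → ℝ,
        (∀ p, Filter.Tendsto (fun h => CoulombGas.cutoff A h p) Filter.atTop (nhds (u p))) ∧
        ∃ c : ℝ, CoulombGas.IsPotentialConstant u c ∧
          ∃ C : ℝ, ∀ M : ℕ, 1 ≤ M → ∀ L : ℝ, L = (γ : ℝ) ^ M → ∀ α : ℝ, α ^ 2 = 8 * Real.pi →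
            (∀ j : ℕ, |L ^ 2 * Real.exp (-(α ^ 2 / 2) * CoulombGas.blockCov γ M A j 0) - 1|
              ≤ C * L ^ (-(j : ℝ) / 4)) ∧
            (∃ C' : ℝ, ∀ j : ℕ,
              |CoulombGas.aCoeff α L (CoulombGas.blockCov γ M A) j
                  - 8 * Real.pi ^ 2 * Real.exp (8 * Real.pi * c) * Real.log L|
                ≤ C' * L ^ (-(j : ℝ) / 4) ∧
              |CoulombGas.bCoeff α L (CoulombGas.blockCov γ M A) j - 2 * Real.log L|
                ≤ C' * L ^ (-(j : ℝ) / 4)) ∧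
            Filter.Tendsto (CoulombGas.aCoeff α L (CoulombGas.blockCov γ M A)) Filter.atTop
              (nhds (8 * Real.pi ^ 2 * Real.exp (8 * Real.pi * c) * Real.log L)) ∧
            Filter.Tendsto (CoulombGas.bCoeff α L (CoulombGas.blockCov γ M A)) Filter.atTop
              (nhds (2 * Real.log L)) := by
  refine ⟨CoulombGas.exists_isFiniteRangeDecomposition hγ_odd hγ, fun A hA => ?_⟩
  obtain ⟨u, hu, c, hc, C, hC⟩ := CoulombGas.exists_flow_bounds hγ hA
  refine ⟨u, hu, c, hc, C, fun M hM L hL α hα => ?_⟩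
  have hγM : 1 < γ ^ M := Nat.one_lt_pow (by omega) hγ
  obtain ⟨h1, ⟨B₁, h2⟩, B₂, h3⟩ := hC M hM α hα
  obtain rfl : L = ((γ ^ M : ℕ) : ℝ) := by rw [hL]; push_cast; rfl
  simp_rw [← CoulombGas.rate_pow]
  refine ⟨h1, ⟨max B₁ B₂, fun j => ⟨(h2 j).trans ?_, (h3 j).trans ?_⟩⟩,
    CoulombGas.tendsto_of_abs_sub_le hγM h2, CoulombGas.tendsto_of_abs_sub_le hγM h3⟩
  · have := CoulombGas.rate_pos hγM
    gcongr
    exact le_max_left _ _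
  · have := CoulombGas.rate_pos hγM
    gcongr
    exact le_max_right _ _
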